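/- For a finite field $\mathbb{F}_q$, an integer $n\ge 0$ and integers $\mu=(\mu_1\le\dots\le\mu_n)$ (an anti-dominant cocharacter of the diagonal torus of $GL_n$) let $\mathcal{E}_\mu=\mathcal{O}(\mu_1)\oplus\dots\oplus\mathcal{O}(\mu_n)$ on $\mathbb{P}^1$ over $\mathbb{F}_q$; every rank $n$ vector bundle on $\mathbb{P}^1$ is isomorphic to exactly one $\mathcal{E}_\mu$. For partitions $\nu^0,\nu^\infty$ of $n$ let $\mathcal{T}rip_\mu(\nu^0,\nu^\infty)$ be the set of triples $(P_0,P_\infty,\Psi)$, where $\Psi$ is a nilpotent endomorphism of $\mathcal{E}_\mu$ and, for $x\in\{0,\infty\}$, $P_x$ is a flag of $\mathbb{F}_q$-subspaces of the fibre $(\mathcal{E}_\mu)_x$ of dimensions $0,\nu^x_1,\nu^x_1+\nu^x_2,\dots,n$ that is preserved by $\Psi_x$. For each $\mu,\nu^0,\nu^\infty$ there is a unique rational function $c_{\mu}^{\nu^0,\nu^\infty}\in\mathbb{Q}(q)$ that is defined at every prime power $q$ and takes there the value $|\mathcal{T}rip_\mu(\nu^0,\nu^\infty)|/|\mathrm{Aut}(\mathcal{E}_\mu)|$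 (counted over $\mathbb{F}_q$). Put $$C_\mu[X,Y;q]=\sum_{\nu^0,\nu^\infty\vdash n}c_{\mu}^{\nu^0,\nu^\infty}(q)\,m_{\nu^0}(X)\,m_{\nu^\infty}(Y),$$ $$\Omega^{\le 0}_{n,(0,\infty)}(\mathbb{P}^1)[X,Y;q,t]=\sum_{\mu_1\le\dots\le\mu_n\le 0}t^{-\deg\mathcal{E}_\mu}\,C_\mu[X,Y;q],$$ where $m_\nu$ are the monomial symmetric functions and $X=(x_1,x_2,\dots)$, $Y=(y_1,y_2,\dots)$. Then, as formal series with coefficients in $\mathrm{Sym}_{\mathbb{Q}(q)[[t]]}[X,Y]$ (all infinite sums converging coefficientwise), $$\sum_{n=0}^{\infty}\Omega^{\le 0}_{n,(0,\infty)}(\mathbb{P}^1)[X,Y;q,t]=\mathrm{Exp}\left[\frac{XY}{(q-1)(1-t)}\right],\qquad XY=\sum_{i,j}x_iy_j,$$ where $\mathrm{Exp}[f]=\exp\left(\sum_{m\ge 1}p_m[f]/m\right)$ is the plethystic exponential and $p_m$ is the ring homomorphism over $\mathbb{Q}$ that replaces $q,t,x_i,y_j$ by $q^m,t^m,x_i^m,y_j^m$.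 -/

import Mathlib

open scoped LaurentPolynomial

universe u

noncomputable section

namespace TwoPoint

/-! ### Vector bundles on the projective line

`ℙ¹` over a field `k` is covered by `U₀ = Spec k[z]` and `U∞ = Spec k[w]`, glued along
`Spec k[T, T⁻¹]` by `z = T`, `w = T⁻¹`.  The point `0` is `z = 0` and the point `∞` is `w = 0`. -/

/-- Restriction of functions from `U₀` to `U₀ ∩ U∞`. -/
def res0 (k : Type*) [Field k] : Polynomial k →ₐ[k] k[T;T⁻¹] :=
  Polynomial.toLaurentAlg

/-- Restriction of functions from `U∞` to `U₀ ∩ U∞`; it sends the coordinate `w` to `T⁻¹`. -/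
def resInf (k : Type*) [Field k] : Polynomial k →ₐ[k] k[T;T⁻¹] :=
  (LaurentPolynomial.invert (R := k)).toAlgHom.comp Polynomial.toLaurentAlg

/-- A rank `n` vector bundle (equivalently, a principal `GL_n`-bundle) on `ℙ¹`, given by its
transition function over `U₀ ∩ U∞`: the coordinates of a section `s` in the two trivializations
are related by `s∞ = g s₀`. -/
structure Bundle (k : Type*) [Field k] (n : ℕ) where
  transition : GL (Fin n) k[T;T⁻¹]

/-- The transition function `z⁻¹` of the line bundle `𝒪(1)` (that is, of the `𝔾ₘ`-bundle
`𝒪(1)ˣ`). -/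
def cocycleO1 (k : Type*) [Field k] : (k[T;T⁻¹])ˣ where
  val := LaurentPolynomial.T (-1)
  inv := LaurentPolynomial.T 1
  val_inv := by rw [← LaurentPolynomial.T_add]; simp
  inv_val := by rw [← LaurentPolynomial.T_add]; simp

/-- The cocharacter `u ↦ diag (u ^ μ₁, …, u ^ μₙ)` of the diagonal torus of `GL_n`, on points
with values in a commutative ring `R`. -/
def cocharacter {n : ℕ} (μ : Fin n → ℤ) (R : Type*) [CommRing R] : Rˣ →* GL (Fin n) R :=
  (Units.map (Matrix.diagonalRingHom (Fin n) R).toMonoidHom).comp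
    (MulEquiv.piUnits.symm.toMonoidHom.comp
      { toFun := fun u i => u ^ μ i
        map_one' := by funext i; simp
        map_mul' := by intro u v; funext i; simp [mul_zpow] })

/-- The bundle `E_μ` obtained from `𝒪(1)ˣ` by extension of structure group along the
cocharacter `μ`; as a vector bundle it is `𝒪(μ₁) ⊕ ⋯ ⊕ 𝒪(μₙ)`. -/
def bundleOf (k : Type*) [Field k] {n : ℕ} (μ : Fin n → ℤ) : Bundle k n where
  transition := cocharacter μ k[T;T⁻¹] (cocycleO1 k)

namespace Bundle

variable {k : Type*} [Field k] {n : ℕ} (E : Bundle k n)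

/-- The degree of a bundle: its determinant has transition function `c * T ^ (-d)` for a
nonzero constant `c`, and is then isomorphic to `𝒪(d)`. -/
def degree : ℤ :=
  -((E.transition : Matrix (Fin n) (Fin n) k[T;T⁻¹]).det.degree.unbotD 0)

/-- Global sections of `ad E = End E`: a matrix of functions on `U₀` and a matrix of functions
on `U∞` that match, `A∞ = g A₀ g⁻¹`, on `U₀ ∩ U∞`. -/
def adSections :
    Subalgebra k (Matrix (Fin n) (Fin n) (Polynomial k) × Matrix (Fin n) (Fin n) (Polynomial k))
    where
  carrier := {A | A.2.map (resInf k) =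
    (E.transition : Matrix (Fin n) (Fin n) k[T;T⁻¹]) * A.1.map (res0 k) *
      ((E.transition⁻¹ : GL (Fin n) k[T;T⁻¹]) : Matrix (Fin n) (Fin n) k[T;T⁻¹])}
  mul_mem' := by
    intro A B hA hB
    simp only [Set.mem_ofPred_eq, Prod.fst_mul, Prod.snd_mul, Matrix.map_mul] at hA hB ⊢
    rw [hA, hB]
    simp only [mul_assoc, Units.inv_mul_cancel_left]
  add_mem' := by
    intro A B hA hB
    simp only [Set.mem_ofPred_eq, Prod.fst_add, Prod.snd_add] at hA hB ⊢
    rw [Matrix.map_add _ (map_add _), Matrix.map_add _ (map_add _), hA, hB, mul_add, add_mul]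
  algebraMap_mem' := by
    intro r
    have h : ∀ f : Polynomial k →ₐ[k] k[T;T⁻¹],
        (algebraMap k (Matrix (Fin n) (Fin n) (Polynomial k)) r).map f =
          algebraMap k (Matrix (Fin n) (Fin n) k[T;T⁻¹]) r := by
      intro f
      exact (f.mapMatrix (m := Fin n)).commutes r
    change (algebraMap k (Matrix (Fin n) (Fin n) (Polynomial k)) r).map (resInf k) =
      _ * (algebraMap k (Matrix (Fin n) (Fin n) (Polynomial k)) r).map (res0 k) * _
    rw [h, h, ← Algebra.commutes, mul_assoc, Units.mul_inv, mul_one]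

/-- The automorphism group of `E`. -/
abbrev Aut : Type _ := (E.adSections)ˣ

/-- The action of a section of `ad E` on the fibre of `E` at `0`. -/
def at0 (Ψ : E.adSections) : Matrix (Fin n) (Fin n) k :=
  Ψ.1.1.map (Polynomial.eval 0)

/-- The action of a section of `ad E` on the fibre of `E` at `∞`. -/
def atInf (Ψ : E.adSections) : Matrix (Fin n) (Fin n) k :=
  Ψ.1.2.map (Polynomial.eval 0)

end Bundle

/-- The sequence of parts of a partition, in decreasing order. -/
def partList {n : ℕ} (ν : n.Partition) : List ℕ := ν.parts.sort (· ≥ ·)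

/-- A parabolic structure of type `ν` on the vector space `k ^ n` (a trivialized fibre):
a flag `0 = F₀ ⊆ F₁ ⊆ ⋯ ⊆ F_l = k ^ n` with `dim F_i = ν₁ + ⋯ + ν_i`. -/
structure Flag (k : Type*) [Field k] {n : ℕ} (ν : n.Partition) where
  space : Fin ((partList ν).length + 1) → Submodule k (Fin n → k)
  mono : Monotone space
  finrank_eq : ∀ i, Module.finrank k (space i) = ((partList ν).take i).sum

/-- The matrix `A` lies in the Lie algebra of the stabilizer of the flag `P`. -/
def Flag.Preserves {k : Type*} [Field k] {n : ℕ} {ν : n.Partition} (P : Flag k ν)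
    (A : Matrix (Fin n) (Fin n) k) : Prop :=
  ∀ i, ∀ v ∈ P.space i, A.mulVec v ∈ P.space i

/-- Triples `(P₀, P∞, Ψ)`: parabolic structures on `E` at `0` and `∞`, of types `ν₀` and `ν∞`,
and a nilpotent section `Ψ` of `ad E` compatible with them. -/
structure Trip {k : Type*} [Field k] {n : ℕ} (E : Bundle k n) (ν0 νinf : n.Partition) where
  P0 : Flag k ν0
  Pinf : Flag k νinf
  Psi : E.adSections
  nilpotent : IsNilpotent Psi
  compat0 : P0.Preserves (E.at0 Psi)
  compatInf : Pinf.Preserves (E.atInf Psi)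

/-- Anti-dominant cocharacters of the diagonal torus of `GL_n` (with respect to the upper
triangular Borel subgroup): `⟨eᵢ - eⱼ, μ⟩ ≤ 0` for `i < j`.  They parametrize isomorphism
classes of rank `n` bundles on `ℙ¹`. -/
def Antidominant (n : ℕ) : Type := {μ : Fin n → ℤ // ∀ i j, i < j → μ i - μ j ≤ 0}

/-- The anti-dominant cocharacters `μ` for which every summand `𝒪(μᵢ)` of `E_μ` has degree
at most `0`. -/
def NonposAntidominant (n : ℕ) : Type := {μ : Antidominant n // ∀ i, μ.1 i ≤ 0}

/-- The degree `μ₁ + ⋯ + μₙ` of `E_μ`; see `degree_bundleOf`. -/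
def Antidominant.deg {n : ℕ} (μ : Antidominant n) : ℤ := ∑ i, μ.1 i

theorem degree_bundleOf (k : Type*) [Field k] {n : ℕ} (μ : Antidominant n) :
    (bundleOf k μ.1).degree = μ.deg := by
  have h : ∀ m : ℤ, ((cocycleO1 k ^ m : (k[T;T⁻¹])ˣ) : k[T;T⁻¹]) = LaurentPolynomial.T (-m) := by
    intro m
    have hT : ∀ a : ℕ, ((cocycleO1 k : (k[T;T⁻¹])ˣ) : k[T;T⁻¹]) ^ a =
        LaurentPolynomial.T (-(a : ℤ)) := by
      intro a
      change (LaurentPolynomial.T (-1) : k[T;T⁻¹]) ^ a = _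
      rw [LaurentPolynomial.T_pow]; simp
    have hT' : ∀ a : ℕ, (((cocycleO1 k)⁻¹ : (k[T;T⁻¹])ˣ) : k[T;T⁻¹]) ^ a =
        LaurentPolynomial.T (a : ℤ) := by
      intro a
      change (LaurentPolynomial.T 1 : k[T;T⁻¹]) ^ a = _
      rw [LaurentPolynomial.T_pow]; simp
    obtain ⟨a, rfl | rfl⟩ := m.eq_nat_or_neg
    · rw [zpow_natCast, Units.val_pow_eq_pow_val, hT]
    · rw [zpow_neg, zpow_natCast, ← inv_pow, Units.val_pow_eq_pow_val, hT', neg_neg]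
  have hprod : ∀ s : Finset (Fin n), ∏ i ∈ s, (LaurentPolynomial.T (-(μ.1 i)) : k[T;T⁻¹]) =
      LaurentPolynomial.T (-∑ i ∈ s, μ.1 i) := by
    intro s
    induction s using Finset.induction_on with
    | empty => simp
    | insert a s ha ih =>
      rw [Finset.prod_insert ha, Finset.sum_insert ha, ih, ← LaurentPolynomial.T_add]
      congr 1
      ring
  have hdet : ((bundleOf k μ.1).transition : Matrix (Fin n) (Fin n) k[T;T⁻¹]).det =
      LaurentPolynomial.T (-∑ i, μ.1 i) := by
    change (Matrix.diagonal fun i => ((cocycleO1 k ^ μ.1 i : (k[T;T⁻¹])ˣ) : k[T;T⁻¹])).det = _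
    rw [Matrix.det_diagonal]
    simp_rw [h]
    exact hprod _
  rw [Bundle.degree, hdet, LaurentPolynomial.degree_T]
  simp [Antidominant.deg]

/-! ### Symmetric functions and plethysm -/

/-- The field `ℚ(q)`. -/
abbrev Qq : Type := RatFunc ℚ

/-- The ring `ℚ(q)⟦t⟧`. -/
abbrev Coeffs : Type := PowerSeries Qq

/-- Formal power series over `ℚ(q)⟦t⟧` in the variables `x₀, x₁, …` (the variables `Sum.inl i`)
and `y₀, y₁, …` (the variables `Sum.inr j`).  It contains the ring of functions symmetric in
both sequences of variables, as well as its completion with respect to degree. -/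
abbrev Series : Type := MvPowerSeries (ℕ ⊕ ℕ) Coeffs

/-- The coefficient of `x^a y^b t^d`, where `e = (a, b)`. -/
def fullCoeff (e : ℕ ⊕ ℕ →₀ ℕ) (d : ℕ) (f : Series) : Qq :=
  PowerSeries.coeff d (MvPowerSeries.coeff e f)

/-- The formal sum of the family `f` converges, with value `s`: every coefficient in
`x, y, t` is nonzero for finitely many members only, and these add up to the coefficient of `s`.
This is convergence for the product topology with `ℚ(q)` discrete. -/
def HasFormalSum {ι : Type*} (f : ι → Series) (s : Series) : Prop :=
  ∀ e d, (Function.support fun i => fullCoeff e d (f i)).Finite ∧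
    fullCoeff e d s = ∑ᶠ i, fullCoeff e d (f i)

theorem HasFormalSum.unique {ι : Type*} {f : ι → Series} {s s' : Series}
    (h : HasFormalSum f s) (h' : HasFormalSum f s') : s = s' := by
  ext e d
  exact (h e d).2.trans (h' e d).2.symm

theorem nonZeroDivisors_le_comap_expand (m : ℕ+) :
    nonZeroDivisors (Polynomial ℚ) ≤
      (nonZeroDivisors (Polynomial ℚ)).comap (Polynomial.expand ℚ (m : ℕ)) := by
  intro p hp
  rw [Submonoid.mem_comap, mem_nonZeroDivisors_iff_ne_zero]
  exact (Polynomial.expand_ne_zero m.pos).2 (nonZeroDivisors.ne_zero hp)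

/-- The `m`-th lambda ring operation `p_m` on `ℚ(q)`: `q ↦ q ^ m`. -/
def adamsQq (m : ℕ+) : Qq →+* Qq :=
  RatFunc.mapRingHom (Polynomial.expand ℚ (m : ℕ)) (nonZeroDivisors_le_comap_expand m)

/-- The `m`-th lambda ring operation on `ℚ(q)⟦t⟧`: `q ↦ q ^ m`, `t ↦ t ^ m`. -/
def adamsCoeffs (m : ℕ+) : Coeffs →+* Coeffs :=
  (PowerSeries.expand (R := Qq) (m : ℕ) m.ne_zero).toRingHom.comp (PowerSeries.map (adamsQq m))

/-- The `m`-th lambda ring operation on series in `x, y`: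
`q ↦ q ^ m`, `t ↦ t ^ m`, `x_i ↦ x_i ^ m`, `y_j ↦ y_j ^ m`. -/
def adams (m : ℕ+) : Series →+* Series :=
  (MvPowerSeries.expand (σ := ℕ ⊕ ℕ) (R := Coeffs) (m : ℕ) m.ne_zero).toRingHom.comp
    (MvPowerSeries.map (adamsCoeffs m))

/-- The constant series with value a rational function of `q`. -/
def constQq : Qq →+* Series := (MvPowerSeries.C).comp PowerSeries.C

/-- The plethystic exponential `Exp[x] = exp (∑_{m ≥ 1} p_m[x] / m)` converges, with value `y`. -/
def HasPlethysticExp (x y : Series) : Prop :=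
  ∃ s : Series,
    HasFormalSum (fun m : ℕ+ => constQq ((m : Qq)⁻¹) * adams m x) s ∧
    HasFormalSum (fun j : ℕ => constQq ((j.factorial : Qq)⁻¹) * s ^ j) y

theorem HasPlethysticExp.unique {x y y' : Series}
    (h : HasPlethysticExp x y) (h' : HasPlethysticExp x y') : y = y' := by
  obtain ⟨s, hs, hy⟩ := h
  obtain ⟨s', hs', hy'⟩ := h'
  obtain rfl := hs.unique hs'
  exact hy.unique hy'

open scoped Classical in
/-- The monomial symmetric function `m_ν` in the variables `x₀, x₁, …`: the sum of all distinct
monomials whose nonzero exponents are the parts of `ν`. -/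
def monomialSymm {n : ℕ} (ν : n.Partition) : MvPowerSeries ℕ Coeffs :=
  fun e => if e.support.val.map e = ν.parts then 1 else 0

/-- Symmetric functions in the `x`-variables. -/
def inX : MvPowerSeries ℕ Coeffs →+* Series :=
  (MvPowerSeries.rename (R := Coeffs) (Function.Embedding.inl : ℕ ↪ ℕ ⊕ ℕ)).toRingHom

/-- Symmetric functions in the `y`-variables. -/
def inY : MvPowerSeries ℕ Coeffs →+* Series :=
  (MvPowerSeries.rename (R := Coeffs) (Function.Embedding.inr : ℕ ↪ ℕ ⊕ ℕ)).toRingHom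

open scoped Classical in
/-- The series `XY = ∑_{i,j} x_i y_j`; see `hasFormalSum_XY`. -/
def XY : Series :=
  fun e => if ∃ p : ℕ × ℕ, e = Finsupp.single (Sum.inl p.1) 1 + Finsupp.single (Sum.inr p.2) 1
    then 1 else 0

theorem hasFormalSum_XY :
    HasFormalSum (fun p : ℕ × ℕ => (MvPowerSeries.X (Sum.inl p.1) * MvPowerSeries.X (Sum.inr p.2)))
      XY := by
  classical
  intro e d
  have hc : ∀ p : ℕ × ℕ, MvPowerSeries.coeff e
      ((MvPowerSeries.X (Sum.inl p.1) * MvPowerSeries.X (Sum.inr p.2) : Series)) =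
      if e = Finsupp.single (Sum.inl p.1) 1 + Finsupp.single (Sum.inr p.2) 1 then 1 else 0 := by
    intro p
    rw [MvPowerSeries.X, MvPowerSeries.X, MvPowerSeries.monomial_mul_monomial,
      MvPowerSeries.coeff_monomial, one_mul]
  have hinj : ∀ p p' : ℕ × ℕ,
      (Finsupp.single (Sum.inl p.1) 1 + Finsupp.single (Sum.inr p.2) 1 : ℕ ⊕ ℕ →₀ ℕ) =
        Finsupp.single (Sum.inl p'.1) 1 + Finsupp.single (Sum.inr p'.2) 1 → p' = p := by
    intro p p' h
    have h1 := DFunLike.congr_fun h (Sum.inl p.1)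
    have h2 := DFunLike.congr_fun h (Sum.inr p.2)
    simp [Finsupp.single_apply] at h1 h2
    exact Prod.ext h1 h2
  by_cases he : ∃ p : ℕ × ℕ,
      e = Finsupp.single (Sum.inl p.1) 1 + Finsupp.single (Sum.inr p.2) 1
  · obtain ⟨p, rfl⟩ := he
    have hz : ∀ p', p' ≠ p → fullCoeff
        (Finsupp.single (Sum.inl p.1) 1 + Finsupp.single (Sum.inr p.2) 1) d
        ((MvPowerSeries.X (Sum.inl p'.1) * MvPowerSeries.X (Sum.inr p'.2) : Series)) = 0 := by
      intro p' hp'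
      rw [fullCoeff, hc, if_neg (fun h => hp' (hinj p p' h)), map_zero]
    refine ⟨(Set.finite_singleton p).subset fun p' hp' => ?_, ?_⟩
    · by_contra hne
      exact hp' (hz p' hne)
    · rw [finsum_eq_single _ p hz, fullCoeff, fullCoeff, hc, if_pos rfl]
      exact congrArg _ (if_pos ⟨p, rfl⟩)
  · have hz : (fun p : ℕ × ℕ => fullCoeff e d
        ((MvPowerSeries.X (Sum.inl p.1) * MvPowerSeries.X (Sum.inr p.2) : Series))) = 0 := by
      funext p
      rw [fullCoeff, hc, if_neg (fun h => he ⟨p, h⟩), map_zero]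
      rfl
    refine ⟨?_, ?_⟩
    · rw [hz]; simp
    · rw [hz]
      have hXY : MvPowerSeries.coeff e XY = 0 := if_neg he
      rw [fullCoeff, hXY, map_zero]
      exact finsum_zero.symm

/-- The argument `XY / ((q - 1) (1 - t))` of the plethystic exponential. -/
def expArgument : Series :=
  XY * MvPowerSeries.C
    (PowerSeries.C ((RatFunc.X - 1 : Qq)⁻¹) * (1 - PowerSeries.X : Coeffs)⁻¹)

/-! ### The generating function -/

/-- A family of rational functions of `q`, one for each rank `n`, anti-dominant cocharacter `μ`
of `GL_n` and pair of partitions of `n`. -/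
abbrev CountFamily : Type :=
  (n : ℕ) → Antidominant n → n.Partition → n.Partition → Qq

/-- The rational functions `C n μ ν₀ ν∞` give the weighted point counts
`|Trip_μ(ν₀, ν∞)| / |Aut E_μ|` over all finite fields: at `q = |k|` the rational function is
defined and its value is the count over `k`. -/
def IsPointCount (C : CountFamily) : Prop :=
  ∀ (n : ℕ) (μ : Antidominant n) (ν0 νinf : n.Partition)
    (k : Type u) [Field k] [Finite k],
    (C n μ ν0 νinf).denom.eval (Nat.card k : ℚ) ≠ 0 ∧
    (C n μ ν0 νinf).eval (RingHom.id ℚ) (Nat.card k : ℚ) =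
      (Nat.card (Trip (bundleOf k μ.1) ν0 νinf) : ℚ) / (Nat.card (bundleOf k μ.1).Aut : ℚ)

/-- The symmetric function `C_μ[X, Y; q] = ∑_{ν₀, ν∞} C n μ ν₀ ν∞ m_{ν₀}(X) m_{ν∞}(Y)`. -/
def countSeries (C : CountFamily) {n : ℕ} (μ : Antidominant n) : Series :=
  ∑ ν0 : n.Partition, ∑ νinf : n.Partition,
    constQq (C n μ ν0 νinf) * (inX (monomialSymm ν0) * inY (monomialSymm νinf))

/-- The term `t ^ (-deg E_μ) C_μ[X, Y; q]` of the generating function, for `μ ≤ 0`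
(so that `-deg E_μ` is a natural number). -/
def omegaTerm (C : CountFamily) {n : ℕ} (μ : NonposAntidominant n) : Series :=
  MvPowerSeries.C (PowerSeries.X ^ (-μ.1.deg).toNat) * countSeries C μ.1

end TwoPoint

end

noncomputable section

namespace TwoPoint

/-! ### Finite counting -/

/-! The (i, j) entry of a section Ψ of `End E_μ` is a section of 𝒪(μ_i − μ_j): zero if μ_i < μ_j, a
constant if μ_i = μ_j, and free to take any two values at 0 and ∞ if μ_i > μ_j. So the fibres of Ψ
at the two points share their block diagonal (Levi) part, their strictly triangular parts N₀ and N∞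
vary independently, and all other coefficients contribute a constant factor. Restriction to the Levi
part has nil kernel, hence Ψ is nilpotent, or invertible, exactly when its Levi part is.

Counting stable flags is multiplicative on average over extensions: if F_A denotes the generating
series of the numbers of A-stable flags, the average of F over all block triangular matrices with
diagonal blocks A, D is F_A F_D (`finsum_flagCount_triangular`). Averaging over N₀ and N∞ separately
gives C_μ = ∏_v B_{m_v}, where m_v is the number of i with μ_i = v and B_m = |GL_m|⁻¹ ∑ F_A(X)
F_A(Y) over nilpotent A of size m (`finsum_nilpotent_sections`).

For any weight that is multiplicative on average, the weighted number of pairs of a nilpotent A and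
an A-stable flag, divided by |GL|, is the product over the steps of the flag of the masses of the
step dimensions (`Weight.flagSum_eq`). Used with the weight F_A(Y), and then with the weight 1, this
yields ∑ B_m = ∏_{i,j} h(x_i y_j), where the coefficient h_m of z^m in h(z) is the number of
nilpotent matrices of size m over |GL_m|. Fitting's decomposition gives h_m = ∏_{i<m} q^i / (q^(i+1)
− 1) (`nilMass_one`), from which z h'/h = ∑ z^m / (q^m − 1) (`hasLogDeriv_nilRatio`). Thus ∑ B_m =
Exp[XY/(q − 1)].

A cocharacter μ ≤ 0 amounts to the multiplicities m_i of the summands 𝒪(−i), i ≥ 0, and then −deg =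
∑ i m_i. The total generating function is therefore ∏_{i ≥ 0} Exp[t^i XY/(q − 1)], which is the
claimed exponential. The infinite product is avoided: Z = Exp[XY/((q − 1)(1 − t))] satisfies Z(X) =
(∑ B_m) Z(tX), as both sides solve the same Euler differential equation (`expSeries_eq_mul_twist`),
and iterating this more than d times determines the coefficient of t^d.

The product formula also makes sense over ℚ(q), which gives existence of the rational functions;
uniqueness follows from their values at the infinitely many primes. Finally, the product of blocks
is symmetric in each set of variables, so its coefficients at partitions recover it through monomial
symmetric functions. -/

theorem finsum_fiberwise {α β M : Type*} [Finite α] [Finite β] [AddCommMonoid M] (f : α → β)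
    (g : α → M) : ∑ᶠ a, g a = ∑ᶠ b, ∑ᶠ a : {a // f a = b}, g a := by
  classical
  cases nonempty_fintype α
  cases nonempty_fintype β
  simp only [finsum_eq_sum_of_fintype]
  exact (Fintype.sum_fiberwise f g).symm

theorem finsum_prod {α β M : Type*} [Finite α] [Finite β] [AddCommMonoid M]
    (g : α × β → M) : ∑ᶠ a, g a = ∑ᶠ a, ∑ᶠ b, g (a, b) := by
  classical
  cases nonempty_fintype α
  cases nonempty_fintype β
  simp only [finsum_eq_sum_of_fintype]
  exact Fintype.sum_prod_type g

theorem finsum_swap {α β M : Type*} [Finite α] [Finite β] [AddCommMonoid M]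
    (g : α → β → M) : ∑ᶠ a, ∑ᶠ b, g a b = ∑ᶠ b, ∑ᶠ a, g a b := by
  classical
  cases nonempty_fintype α
  cases nonempty_fintype β
  simp only [finsum_eq_sum_of_fintype]
  exact Finset.sum_comm

theorem finsum_const_eq {α M : Type*} [Finite α] [AddCommMonoid M] (c : M) :
    ∑ᶠ _a : α, c = Nat.card α • c := by
  classical
  cases nonempty_fintype α
  simp [finsum_eq_sum_of_fintype]

theorem mul_finsum_of_finite {α M : Type*} [Finite α] [NonUnitalNonAssocSemiring M] (c : M)
    (f : α → M) :
    ∑ᶠ a, c * f a = c * ∑ᶠ a, f a :=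
  (mul_finsum' _ _ (Set.toFinite _)).symm

theorem finsum_mul_of_finite {α M : Type*} [Finite α] [NonUnitalNonAssocSemiring M] (c : M)
    (f : α → M) :
    ∑ᶠ a, f a * c = (∑ᶠ a, f a) * c :=
  (finsum_mul' _ _ (Set.toFinite _)).symm

theorem map_finsum_of_finite {α M N : Type*} [Finite α] [AddCommMonoid M] [AddCommMonoid N]
    {F : Type*} [FunLike F M N] [AddMonoidHomClass F M N] (φ : F) (f : α → M) :
    φ (∑ᶠ a, f a) = ∑ᶠ a, φ (f a) :=
  AddMonoidHom.map_finsum (φ : M →+ N) (Set.toFinite _)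

theorem card_eq_finsum_fiber {α β : Type*} [Finite α] [Finite β] (f : α → β) :
    Nat.card α = ∑ᶠ b, Nat.card {a // f a = b} := by
  have := finsum_fiberwise f (fun _ => 1)
  simpa [finsum_const_eq] using this

theorem card_eq_mul_card {α β : Type*} [Finite α] [Finite β] (f : α → β) {c : ℕ}
    (h : ∀ b, Nat.card {a // f a = b} = c) : Nat.card α = Nat.card β * c := by
  rw [card_eq_finsum_fiber f, finsum_congr h, finsum_const_eq, smul_eq_mul]

/-- A sum over the source of a map with fibres of constant cardinality. -/
theorem finsum_comp_of_card_fiber {α β M : Type*} [Finite α] [Finite β] [AddCommMonoid M]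
    (f : α → β) (g : β → M) {c : ℕ} (h : ∀ b, Nat.card {a // f a = b} = c) :
    ∑ᶠ a, g (f a) = c • ∑ᶠ b, g b := by
  rw [finsum_fiberwise f, smul_finsum' c (Set.toFinite _)]
  refine finsum_congr fun b => ?_
  rw [finsum_congr (g := fun _ => g b) fun a => by rw [a.2], finsum_const_eq, h]

theorem card_sigma_eq_finsum {α : Type*} [Finite α] (p : α → Type*) [∀ a, Finite (p a)] :
    Nat.card (Σ a, p a) = ∑ᶠ a, Nat.card (p a) := by
  classical
  cases nonempty_fintype α
  rw [Nat.card_sigma, finsum_eq_sum_of_fintype]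

/-! ### Stable flags -/

section Flags

variable {k : Type*} [Field k] {V : Type*} [AddCommGroup V] [Module k V]

/-- Exhaustive chains of subspaces stable under an endomorphism. -/
@[ext]
structure StableFlag (A : Module.End k V) where
  space : ℕ → Submodule k V
  mono : Monotone space
  zero : space 0 = ⊥
  top : ∃ N, space N = ⊤
  stable : ∀ i, ∀ v ∈ space i, A v ∈ space i

/-- The steps of the flag have dimensions `α 0, α 1, …`. -/
def StableFlag.HasType {A : Module.End k V} (F : StableFlag A) (α : ℕ → ℕ) : Prop :=
  ∀ i, Module.finrank k (F.space (i + 1)) = Module.finrank k (F.space i) + α i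

/-- The number of stable flags with steps of prescribed dimensions. -/
def flagCount (α : ℕ → ℕ) (A : Module.End k V) : ℕ :=
  Nat.card {F : StableFlag A // F.HasType α}

theorem StableFlag.HasType.finrank_eq {A : Module.End k V} {F : StableFlag A} {α : ℕ → ℕ}
    (h : F.HasType α) (i : ℕ) : Module.finrank k (F.space i) = ∑ j ∈ Finset.range i, α j := by
  induction i with
  | zero => rw [F.zero]; simp
  | succ i ih => rw [h, ih, Finset.sum_range_succ]

theorem StableFlag.hasType_of_finrank_eq {A : Module.End k V} {F : StableFlag A} {α : ℕ → ℕ}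
    (h : ∀ i, Module.finrank k (F.space i) = ∑ j ∈ Finset.range i, α j) : F.HasType α := by
  intro i
  rw [h, h, Finset.sum_range_succ]

theorem StableFlag.space_eq_top {A : Module.End k V} (F : StableFlag A) :
    ∃ N, ∀ i, N ≤ i → F.space i = ⊤ := by
  obtain ⟨N, hN⟩ := F.top
  exact ⟨N, fun i hi => top_le_iff.1 (hN ▸ F.mono hi)⟩

theorem StableFlag.HasType.space_eq_top [FiniteDimensional k V] {A : Module.End k V}
    {F : StableFlag A} {α : ℕ → ℕ} (h : F.HasType α) {N : ℕ} (hN : ∀ i, N ≤ i → α i = 0) {i : ℕ}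
    (hi : N ≤ i) : F.space i = ⊤ := by
  obtain ⟨M, hM⟩ := F.space_eq_top
  have hle : F.space i ≤ F.space (i + M) := F.mono (Nat.le_add_right _ _)
  have hf : Module.finrank k (F.space i) = Module.finrank k (F.space (i + M)) := by
    rw [h.finrank_eq, h.finrank_eq, Finset.sum_range_add]
    simp [Finset.sum_eq_zero fun x _ => hN (i + x) (by omega)]
  rw [Submodule.eq_of_le_of_finrank_eq hle hf, hM _ (Nat.le_add_left _ _)]

theorem StableFlag.HasType.sum_eq [FiniteDimensional k V] {A : Module.End k V}
    {F : StableFlag A} {α : ℕ → ℕ} (h : F.HasType α) {N : ℕ} (hN : ∀ i, N ≤ i → α i = 0) :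
    ∑ j ∈ Finset.range N, α j = Module.finrank k V := by
  rw [← h.finrank_eq, h.space_eq_top hN le_rfl, finrank_top]

/-- The steps of a flag. -/
def StableFlag.type {A : Module.End k V} (F : StableFlag A) : ℕ →₀ ℕ :=
  Finsupp.onFinset (Finset.range F.space_eq_top.choose)
    (fun i => Module.finrank k (F.space (i + 1)) - Module.finrank k (F.space i)) (by
      intro i hi
      by_contra hn
      rw [Finset.mem_range, not_lt] at hn
      have := F.space_eq_top.choose_spec
      rw [this i hn, this (i + 1) (by omega)] at hi
      simp at hi)

theorem StableFlag.hasType_type [FiniteDimensional k V] {A : Module.End k V}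
    (F : StableFlag A) : F.HasType F.type := by
  intro i
  have := Submodule.finrank_mono (F.mono (Nat.le_add_right i 1))
  simp only [type, Finsupp.onFinset_apply]
  omega

theorem StableFlag.HasType.unique {A : Module.End k V}
    {F : StableFlag A} {α β : ℕ → ℕ} (h : F.HasType α) (h' : F.HasType β) : α = β := by
  funext i
  have := h i
  have := h' i
  omega

instance finite_stableFlag [Finite V] (A : Module.End k V) (α : ℕ →₀ ℕ) :
    Finite {F : StableFlag A // F.HasType α} := by
  have : FiniteDimensional k V := Module.Finite.of_finite
  obtain ⟨N, hN⟩ : ∃ N, ∀ i, N ≤ i → α i = 0 := by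
    refine ⟨α.support.sup id + 1, fun i hi => ?_⟩
    by_contra hn
    have := Finset.le_sup (f := id) (Finsupp.mem_support_iff.2 hn)
    simp at this
    omega
  refine Finite.of_injective
    (fun F : {F : StableFlag A // F.HasType α} => fun i : Fin N => (F.1.space i)) ?_
  intro F G h
  ext1
  apply StableFlag.ext
  funext i
  by_cases hi : i < N
  · exact congrFun h ⟨i, hi⟩
  · rw [F.2.space_eq_top hN (not_lt.1 hi), G.2.space_eq_top hN (not_lt.1 hi)]

/-- Transport of stable flags along a linear equivalence. -/
def StableFlag.map {V' : Type*} [AddCommGroup V'] [Module k V'] (e : V ≃ₗ[k] V')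
    {A : Module.End k V} {A' : Module.End k V'} (h : ∀ v, e (A v) = A' (e v))
    (F : StableFlag A) : StableFlag A' where
  space i := (F.space i).map e.toLinearMap
  mono i j hij := Submodule.map_mono (F.mono hij)
  zero := by rw [F.zero, Submodule.map_bot]
  top := by
    obtain ⟨N, hN⟩ := F.top
    exact ⟨N, by rw [hN, Submodule.map_top, LinearEquiv.range]⟩
  stable := by
    rintro i _ ⟨v, hv, rfl⟩
    exact ⟨A v, F.stable i v hv, h v⟩

theorem StableFlag.HasType.map {V' : Type*} [AddCommGroup V'] [Module k V'] (e : V ≃ₗ[k] V')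
    {A : Module.End k V} {A' : Module.End k V'} (h : ∀ v, e (A v) = A' (e v))
    {F : StableFlag A} {α : ℕ → ℕ} (hF : F.HasType α) : (F.map e h).HasType α := by
  have hm : ∀ i, Module.finrank k ((F.map e h).space i) = Module.finrank k (F.space i) :=
    fun i => LinearEquiv.finrank_map_eq e (F.space i)
  intro i
  rw [hm, hm, hF i]

/-- Stable flags of conjugate endomorphisms. -/
def StableFlag.equiv {V' : Type*} [AddCommGroup V'] [Module k V'] (e : V ≃ₗ[k] V')
    {A : Module.End k V} {A' : Module.End k V'} (h : ∀ v, e (A v) = A' (e v)) :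
    StableFlag A ≃ StableFlag A' where
  toFun F := F.map e h
  invFun F := F.map e.symm (fun v => by rw [LinearEquiv.symm_apply_eq, h, e.apply_symm_apply])
  left_inv F := by
    apply StableFlag.ext
    funext i
    simp [StableFlag.map, ← Submodule.map_comp]
  right_inv F := by
    apply StableFlag.ext
    funext i
    simp [StableFlag.map, ← Submodule.map_comp]

theorem flagCount_conj {V' : Type*} [AddCommGroup V'] [Module k V'] (e : V ≃ₗ[k] V')
    {A : Module.End k V} {A' : Module.End k V'} (h : ∀ v, e (A v) = A' (e v)) (α : ℕ → ℕ) :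
    flagCount α A = flagCount α A' := by
  refine Nat.card_congr ((StableFlag.equiv e h).subtypeEquiv fun F => ⟨fun hF => hF.map e h, ?_⟩)
  intro hF
  have := hF.map e.symm (A' := A) (fun v => by rw [LinearEquiv.symm_apply_eq, h,
      e.apply_symm_apply])
  have h2 := (StableFlag.equiv e h).symm_apply_apply F
  exact h2 ▸ this

end Flags

/-! ### Flags stable under a block triangular endomorphism -/

section Extension

variable {k : Type*} [Field k] {U W : Type*} [AddCommGroup U] [Module k U] [AddCommGroup W]
  [Module k W]

/-- The endomorphism of `U × W` with diagonal blocks `A`, `D` that maps `W` to `U` by `C`. -/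
def triangular (A : Module.End k U) (C : W →ₗ[k] U) (D : Module.End k W) : Module.End k (U × W) :=
  LinearMap.prod (A ∘ₗ LinearMap.fst k U W + C ∘ₗ LinearMap.snd k U W) (D ∘ₗ LinearMap.snd k U W)

@[simp]
theorem triangular_apply (A : Module.End k U) (C : W →ₗ[k] U) (D : Module.End k W) (x : U × W) :
    triangular A C D x = (A x.1 + C x.2, D x.2) := rfl

variable {A : Module.End k U} {C : W →ₗ[k] U} {D : Module.End k W}

/-- The flag induced on the subspace `U`. -/
def StableFlag.sub (F : StableFlag (triangular A C D)) : StableFlag A where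
  space i := (F.space i).comap (LinearMap.inl k U W)
  mono i j hij := Submodule.comap_mono (F.mono hij)
  zero := by
    rw [F.zero]
    exact LinearMap.ker_eq_bot.2 LinearMap.inl_injective
  top := by
    obtain ⟨N, hN⟩ := F.top
    exact ⟨N, by rw [hN, Submodule.comap_top]⟩
  stable i v hv := by
    have := F.stable i _ hv
    simpa using this

/-- The flag induced on the quotient `W`. -/
def StableFlag.quot (F : StableFlag (triangular A C D)) : StableFlag D where
  space i := (F.space i).map (LinearMap.snd k U W)
  mono i j hij := Submodule.map_mono (F.mono hij)
  zero := by rw [F.zero, Submodule.map_bot]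
  top := by
    obtain ⟨N, hN⟩ := F.top
    exact ⟨N, by rw [hN, Submodule.map_top, LinearMap.range_eq_top.2 LinearMap.snd_surjective]⟩
  stable := by
    rintro i _ ⟨v, hv, rfl⟩
    exact ⟨_, F.stable i v hv, rfl⟩

theorem StableFlag.mem_sub (F : StableFlag (triangular A C D)) (i : ℕ) (u : U) :
    u ∈ F.sub.space i ↔ (u, (0 : W)) ∈ F.space i := Iff.rfl

theorem StableFlag.mem_quot (F : StableFlag (triangular A C D)) (i : ℕ) (w : W) :
    w ∈ F.quot.space i ↔ ∃ u, (u, w) ∈ F.space i := by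
  constructor
  · rintro ⟨⟨u, w⟩, h, rfl⟩
    exact ⟨u, h⟩
  · rintro ⟨u, h⟩
    exact ⟨_, h, rfl⟩

theorem StableFlag.finrank_space [FiniteDimensional k U] [FiniteDimensional k W]
    (F : StableFlag (triangular A C D)) (i : ℕ) :
    Module.finrank k (F.space i) =
      Module.finrank k (F.sub.space i) + Module.finrank k (F.quot.space i) := by
  set f : F.space i →ₗ[k] W := (LinearMap.snd k U W).domRestrict (F.space i) with hf
  have h1 := LinearMap.finrank_range_add_finrank_ker f
  have h2 : LinearMap.range f = F.quot.space i := by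
    rw [hf, LinearMap.range_domRestrict]
    rfl
  have h3 : LinearMap.ker f ≃ₗ[k] F.sub.space i :=
    { toFun := fun x => ⟨x.1.1.1, by
        have h : x.1.1.2 = 0 := x.2
        rw [F.mem_sub, ← h]
        exact x.1.2⟩
      invFun := fun u => ⟨⟨(u.1, 0), u.2⟩, rfl⟩
      map_add' := fun _ _ => rfl
      map_smul' := fun _ _ => rfl
      left_inv := by
        rintro ⟨⟨⟨a, b⟩, h⟩, h'⟩
        have h : b = 0 := h'
        subst h
        rfl
      right_inv := fun _ => rfl }
  rw [← h1, h2, h3.finrank_eq, add_comm]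

/-- The maps `W → U` that respect two flags. -/
def flagHom (F : StableFlag A) (G : StableFlag D) : Submodule k (W →ₗ[k] U) where
  carrier := {φ | ∀ i, ∀ w ∈ G.space i, φ w ∈ F.space i}
  add_mem' h h' i w hw := add_mem (h i w hw) (h' i w hw)
  zero_mem' _ _ _ := zero_mem _
  smul_mem' c _ h i w hw := Submodule.smul_mem _ c (h i w hw)

/-- The obstruction to stability of the graph of `φ`. -/
def graphDefect (A : Module.End k U) (C : W →ₗ[k] U) (D : Module.End k W) (φ : W →ₗ[k] U) :
    W →ₗ[k] U := C + A ∘ₗ φ - φ ∘ₗ D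

/-- The extension of the flag `G` by the flag `F` that contains the graph of `φ`. -/
def graphFlag (F : StableFlag A) (G : StableFlag D) (C : W →ₗ[k] U) (φ : W →ₗ[k] U)
    (h : graphDefect A C D φ ∈ flagHom F G) : StableFlag (triangular A C D) where
  space i := (G.space i).comap (LinearMap.snd k U W) ⊓
    (F.space i).comap (LinearMap.fst k U W - φ ∘ₗ LinearMap.snd k U W)
  mono i j hij := inf_le_inf (Submodule.comap_mono (G.mono hij)) (Submodule.comap_mono (F.mono hij))
  zero := by
    rw [G.zero, F.zero, eq_bot_iff]
    rintro ⟨a, b⟩ ⟨h1, h2⟩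
    have h1 : b = 0 := h1
    have h2 : a - φ b = 0 := h2
    subst h1
    rw [map_zero, sub_zero] at h2
    rw [h2]
    exact zero_mem _
  top := by
    obtain ⟨N, hN⟩ := F.space_eq_top
    obtain ⟨M, hM⟩ := G.space_eq_top
    exact ⟨N + M, by rw [hN _ (by omega), hM _ (by omega)]; simp⟩
  stable := by
    rintro i ⟨a, b⟩ ⟨h1, h2⟩
    have h1 : b ∈ G.space i := h1
    have h2 : a - φ b ∈ F.space i := h2
    refine ⟨G.stable i b h1, ?_⟩
    have h3 := add_mem (F.stable i _ h2) (h i b h1)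
    change A a + C b - φ (D b) ∈ F.space i
    convert h3 using 1
    simp only [graphDefect, map_sub, LinearMap.sub_apply, LinearMap.add_apply,
      LinearMap.comp_apply]
    abel

theorem mem_graphFlag {F : StableFlag A} {G : StableFlag D} {φ : W →ₗ[k] U}
    {h : graphDefect A C D φ ∈ flagHom F G} {i : ℕ} {x : U × W} :
    x ∈ (graphFlag F G C φ h).space i ↔ x.2 ∈ G.space i ∧ x.1 - φ x.2 ∈ F.space i := Iff.rfl

theorem sub_graphFlag {F : StableFlag A} {G : StableFlag D} {φ : W →ₗ[k] U}
    (h : graphDefect A C D φ ∈ flagHom F G) : (graphFlag F G C φ h).sub = F := by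
  apply StableFlag.ext
  funext i
  ext u
  rw [StableFlag.mem_sub, mem_graphFlag]
  simp

theorem quot_graphFlag {F : StableFlag A} {G : StableFlag D} {φ : W →ₗ[k] U}
    (h : graphDefect A C D φ ∈ flagHom F G) : (graphFlag F G C φ h).quot = G := by
  apply StableFlag.ext
  funext i
  ext w
  simp only [StableFlag.mem_quot, mem_graphFlag]
  exact ⟨fun ⟨u, hu⟩ => hu.1, fun hw => ⟨φ w, hw, by simp⟩⟩

/-- `φ` is a section of the projection to `W` that respects the flag. -/
def StableFlag.Splits (F : StableFlag (triangular A C D)) (φ : W →ₗ[k] U) : Prop :=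
  ∀ i, ∀ w ∈ F.quot.space i, (φ w, w) ∈ F.space i

/-- Sections of the steps of the flag exist one at a time; they are glued by induction along the
flag, changing the section only on a complement of the step already treated. -/
theorem StableFlag.exists_splits (F : StableFlag (triangular A C D)) : ∃ φ, F.Splits φ := by
  have step : ∀ n, ∃ φ : W →ₗ[k] U, ∀ i ≤ n, ∀ w ∈ F.quot.space i, (φ w, w) ∈ F.space i := by
    intro n
    induction n with
    | zero =>
      refine ⟨0, fun i hi w hw => ?_⟩
      obtain rfl : i = 0 := by omega
      rw [F.quot.zero, Submodule.mem_bot] at hw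
      subst hw
      exact zero_mem _
    | succ n ih =>
      obtain ⟨φ, hφ⟩ := ih
      obtain ⟨p, hp⟩ := (F.quot.space n).subtype.exists_leftInverse_of_injective
        (F.quot.space n).ker_subtype
      obtain ⟨g, hg⟩ := ((LinearMap.snd k U W).submoduleMap
        (F.space (n + 1))).exists_rightInverse_of_surjective
        (LinearMap.range_eq_top.2 (LinearMap.submoduleMap_surjective _ _))
      obtain ⟨σ, hσ⟩ := LinearMap.exists_extend ((F.space (n + 1)).subtype ∘ₗ g)
      have hσ' : ∀ w ∈ F.quot.space (n + 1), ((σ w).1, w) ∈ F.space (n + 1) := by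
        intro w hw
        have h1 : σ w = g ⟨w, hw⟩ := LinearMap.congr_fun hσ ⟨w, hw⟩
        have h2 : (g ⟨w, hw⟩ : U × W).2 = w :=
          congrArg Subtype.val (LinearMap.congr_fun hg ⟨w, hw⟩)
        have h3 : ((σ w).1, w) = (g ⟨w, hw⟩ : U × W) := by
          rw [h1]
          exact Prod.ext rfl h2.symm
        rw [h3]
        exact (g ⟨w, hw⟩).2
      set π : Module.End k W := (F.quot.space n).subtype ∘ₗ p with hπ
      have hπm : ∀ w, π w ∈ F.quot.space n := fun w => (p w).2
      have hπi : ∀ w ∈ F.quot.space n, π w = w := fun w hw =>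
        congrArg Subtype.val (LinearMap.congr_fun hp ⟨w, hw⟩)
      -- The endomorphism `π` projects onto step `n` of the quotient flag, and the second component
      -- of `σ` is the identity on step `n + 1`. The new section is the old one on the image of `π`
      -- and comes from `σ` on its kernel, so it is unchanged on the earlier steps.
      refine ⟨φ ∘ₗ π + LinearMap.fst k U W ∘ₗ σ ∘ₗ (LinearMap.id - π), fun i hi w hw => ?_⟩
      simp only [LinearMap.add_apply, LinearMap.comp_apply, LinearMap.sub_apply,
        LinearMap.id_apply, LinearMap.fst_apply]
      rcases Nat.lt_or_ge n i with hn | hn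
      · obtain rfl : i = n + 1 := by omega
        have h1 := F.mono (Nat.le_add_right n 1) (hφ n le_rfl _ (hπm w))
        have h2 := hσ' (w - π w) (sub_mem hw (F.quot.mono (Nat.le_add_right n 1) (hπm w)))
        have := add_mem h1 h2
        simpa using this
      · have hw' : π w = w := hπi w (F.quot.mono hn hw)
        rw [hw', sub_self, map_zero]
        simpa using hφ i hn w hw
  obtain ⟨N, hN⟩ := F.top
  obtain ⟨φ, hφ⟩ := step N
  refine ⟨φ, fun i w hw => ?_⟩
  rcases le_total i N with hi | hi
  · exact hφ i hi w hw
  · have := F.mono hi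
    rw [hN] at this
    exact this trivial

theorem StableFlag.Splits.mem_iff {F : StableFlag (triangular A C D)} {φ : W →ₗ[k] U}
    (h : F.Splits φ) (i : ℕ) (x : U × W) :
    x ∈ F.space i ↔ x.2 ∈ F.quot.space i ∧ x.1 - φ x.2 ∈ F.sub.space i := by
  obtain ⟨a, b⟩ := x
  rw [F.mem_sub]
  have key : ((a - φ b, 0) : U × W) = (a, b) - (φ b, b) := by simp
  constructor
  · intro hx
    have hb : b ∈ F.quot.space i := (F.mem_quot i b).2 ⟨a, hx⟩
    exact ⟨hb, key ▸ sub_mem hx (h i b hb)⟩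
  · rintro ⟨hb, hx⟩
    have := add_mem hx (h i b hb)
    simpa using this

/-- Applying the endomorphism to (φ w, w) and subtracting the graph point over D w leaves precisely
the defect, which must lie in the sub flag. -/
theorem StableFlag.Splits.graphDefect_mem {F : StableFlag (triangular A C D)} {φ : W →ₗ[k] U}
    (h : F.Splits φ) : graphDefect A C D φ ∈ flagHom F.sub F.quot := by
  intro i w hw
  have h1 := (h.mem_iff i _).1 (F.stable i _ (h i w hw))
  have h2 := h1.2
  simp only [triangular_apply] at h2
  convert h2 using 1
  simp only [graphDefect, LinearMap.sub_apply, LinearMap.add_apply, LinearMap.comp_apply]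
  abel

theorem StableFlag.Splits.add {F : StableFlag (triangular A C D)} {φ ψ : W →ₗ[k] U}
    (h : F.Splits φ) (hψ : ψ ∈ flagHom F.sub F.quot) : F.Splits (φ + ψ) := by
  intro i w hw
  rw [h.mem_iff]
  exact ⟨hw, by simpa using hψ i w hw⟩

theorem StableFlag.Splits.sub_mem {F : StableFlag (triangular A C D)} {φ ψ : W →ₗ[k] U}
    (h : F.Splits φ) (h' : F.Splits ψ) : ψ - φ ∈ flagHom F.sub F.quot := by
  intro i w hw
  exact ((h.mem_iff i _).1 (h' i w hw)).2

theorem graphFlag_splits {F : StableFlag A} {G : StableFlag D} {φ : W →ₗ[k] U}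
    (h : graphDefect A C D φ ∈ flagHom F G) : (graphFlag F G C φ h).Splits φ := by
  intro i w hw
  rw [quot_graphFlag] at hw
  exact ⟨hw, by simp⟩

theorem sigma_stableFlag_ext {x y : Σ C : W →ₗ[k] U, StableFlag (triangular A C D)}
    (h : x.1 = y.1) (h' : x.2.space = y.2.space) : x = y := by
  obtain ⟨C, F⟩ := x
  obtain ⟨C', G⟩ := y
  obtain rfl : C = C' := h
  obtain rfl : F = G := StableFlag.ext h'
  rfl

/-- A section respecting the flag. -/
def splitting (x : Σ C : W →ₗ[k] U, StableFlag (triangular A C D)) : W →ₗ[k] U :=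
  x.2.exists_splits.choose

theorem splits_splitting (x : Σ C : W →ₗ[k] U, StableFlag (triangular A C D)) :
    x.2.Splits (splitting x) :=
  x.2.exists_splits.choose_spec

variable (A D) in
/-- The extensions of two flags, parametrized. -/
def extensionEquiv (F : StableFlag A) (G : StableFlag D) :
    {x : Σ C : W →ₗ[k] U, StableFlag (triangular A C D) // x.2.sub = F ∧ x.2.quot = G} ×
      flagHom F G ≃ (W →ₗ[k] U) × flagHom F G where
  toFun p := (splitting p.1.1 + p.2.1,
    ⟨graphDefect A p.1.1.1 D (splitting p.1.1 + p.2.1), by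
      obtain ⟨⟨x, rfl, rfl⟩, h⟩ := p
      exact ((splits_splitting x).add h.2).graphDefect_mem⟩)
  invFun p := by
    -- The defect is affine in `C` with linear part the identity, so a section and a prescribed
    -- defect determine `C`.
    have hd : graphDefect A (p.2.1 - A ∘ₗ p.1 + p.1 ∘ₗ D) D p.1 = p.2.1 := by
      rw [graphDefect]
      abel
    have hm : graphDefect A (p.2.1 - A ∘ₗ p.1 + p.1 ∘ₗ D) D p.1 ∈ flagHom F G := by
      rw [hd]
      exact p.2.2
    refine (⟨⟨p.2.1 - A ∘ₗ p.1 + p.1 ∘ₗ D, graphFlag F G _ p.1 hm⟩, sub_graphFlag hm,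
      quot_graphFlag hm⟩, ⟨p.1 - splitting ⟨_, graphFlag F G _ p.1 hm⟩, ?_⟩)
    have := (splits_splitting ⟨_, graphFlag F G _ p.1 hm⟩).sub_mem (graphFlag_splits hm)
    rwa [sub_graphFlag, quot_graphFlag] at this
  left_inv := by
    rintro ⟨⟨x, rfl, rfl⟩, ψ, hψ⟩
    have hs := (splits_splitting x).add hψ
    have hx : ∀ C' hm, C' = x.1 →
        (⟨C', graphFlag x.2.sub x.2.quot C' (splitting x + ψ) hm⟩ :
        Σ C : W →ₗ[k] U, StableFlag (triangular A C D)) = x := by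
      rintro C' hm rfl
      refine sigma_stableFlag_ext rfl (funext fun i => ?_)
      ext y
      rw [hs.mem_iff]
      rfl
    have hC : graphDefect A x.1 D (splitting x + ψ) - A ∘ₗ (splitting x + ψ) +
        (splitting x + ψ) ∘ₗ D = x.1 := by
      rw [graphDefect]
      abel
    refine Prod.ext (Subtype.ext (hx _ _ hC)) (Subtype.ext ?_)
    dsimp only
    rw [hx _ _ hC]
    abel
  right_inv := by
    rintro ⟨φ, h⟩
    refine Prod.ext ?_ (Subtype.ext ?_)
    · simp
    · simp [graphDefect]
      abel

/-- For a given extension, the splittings form a torsor under `flagHom F G`; for a given φ, the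
admissible C form a coset of the same group. Its order cancels, which is why the count depends on
neither the flags nor A and D. -/
theorem card_extensions [Finite U] [Finite W] (F : StableFlag A) (G : StableFlag D) :
    Nat.card {x : Σ C : W →ₗ[k] U, StableFlag (triangular A C D) // x.2.sub = F ∧ x.2.quot = G} =
      Nat.card (W →ₗ[k] U) := by
  have : Finite (W →ₗ[k] U) := Finite.of_injective _ DFunLike.coe_injective
  have h := Nat.card_congr (extensionEquiv A D F G)
  rw [Nat.card_prod, Nat.card_prod] at h
  exact Nat.eq_of_mul_eq_mul_right Nat.card_pos h

theorem StableFlag.hasType_iff [FiniteDimensional k U] [FiniteDimensional k W]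
    (F : StableFlag (triangular A C D)) (α : ℕ → ℕ) :
    F.HasType α ↔ ∀ i, F.sub.type i + F.quot.type i = α i := by
  refine forall_congr' fun i => ?_
  rw [F.finrank_space, F.finrank_space, F.sub.hasType_type, F.quot.hasType_type]
  omega

/-- A stable flag of an extension induces stable flags on sub and quotient whose types add up to its
own type. Every pair of such flags arises equally often as C varies, so the average over C is the
convolution of the two counts. -/
theorem finsum_flagCount_triangular [Finite U] [Finite W] (A : Module.End k U)
    (D : Module.End k W) (α : ℕ →₀ ℕ) :
    ∑ᶠ C : W →ₗ[k] U, flagCount α (triangular A C D) = Nat.card (W →ₗ[k] U) *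
      ∑ p ∈ Finset.HasAntidiagonal.antidiagonal α, flagCount p.1 A * flagCount p.2 D := by
  classical
  have : Finite (W →ₗ[k] U) := Finite.of_injective _ DFunLike.coe_injective
  have : FiniteDimensional k U := Module.Finite.of_finite
  have : FiniteDimensional k W := Module.Finite.of_finite
  let X := Σ C : W →ₗ[k] U, {F : StableFlag (triangular A C D) // F.HasType α}
  let Y := Σ p : Finset.HasAntidiagonal.antidiagonal α,
    {F : StableFlag A // F.HasType p.1.1} × {G : StableFlag D // G.HasType p.1.2}
  have hX : Nat.card X = ∑ᶠ C : W →ₗ[k] U, flagCount α (triangular A C D) :=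
    card_sigma_eq_finsum _
  have hY : Nat.card Y = ∑ p ∈ Finset.HasAntidiagonal.antidiagonal α,
      flagCount p.1 A * flagCount p.2 D := by
    rw [card_sigma_eq_finsum, finsum_eq_sum_of_fintype, ← Finset.sum_coe_sort
      (Finset.HasAntidiagonal.antidiagonal α) (fun p => flagCount p.1 A * flagCount p.2 D)]
    exact Fintype.sum_congr _ _ fun p => Nat.card_prod _ _
  rw [← hX, ← hY, mul_comm]
  let f : X → Y := fun x => ⟨⟨(x.2.1.sub.type, x.2.1.quot.type), by
      rw [Finset.HasAntidiagonal.mem_antidiagonal]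
      exact Finsupp.ext ((x.2.1.hasType_iff α).1 x.2.2)⟩,
    ⟨x.2.1.sub, x.2.1.sub.hasType_type⟩, ⟨x.2.1.quot, x.2.1.quot.hasType_type⟩⟩
  refine card_eq_mul_card f fun y => ?_
  obtain ⟨⟨⟨a, b⟩, hp⟩, ⟨F, hF⟩, ⟨G, hG⟩⟩ := y
  rw [← card_extensions F G]
  refine Nat.card_congr
    { toFun := fun x => ⟨⟨x.1.1, x.1.2.1⟩, ?_⟩
      invFun := fun x => ⟨⟨x.1.1, x.1.2, ?_⟩, ?_⟩
      left_inv := fun x => rfl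
      right_inv := fun x => rfl }
  · have h1 := congrArg (fun y : Y => y.2.1.1) x.2
    have h2 := congrArg (fun y : Y => y.2.2.1) x.2
    exact ⟨h1, h2⟩
  · obtain ⟨x, rfl, rfl⟩ := x
    dsimp only
    have h : a + b = α := Finset.HasAntidiagonal.mem_antidiagonal.1 hp
    refine (x.2.hasType_iff α).2 fun i => ?_
    rw [← h, congrFun (x.2.sub.hasType_type.unique hF) i,
      congrFun (x.2.quot.hasType_type.unique hG) i]
    rfl
  · obtain ⟨x, rfl, rfl⟩ := x
    obtain rfl : x.2.sub.type = a := DFunLike.coe_injective (x.2.sub.hasType_type.unique hF)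
    obtain rfl : x.2.quot.type = b := DFunLike.coe_injective (x.2.quot.hasType_type.unique hG)
    rfl

end Extension

/-! ### Sums over subspaces and over block triangular endomorphisms -/

theorem finsum_of_injective {α β M : Type*} [Finite α] [Finite β] [AddCommMonoid M] (i : α → β)
    (hi : Function.Injective i) (g : β → M) (h : ∀ b, b ∉ Set.range i → g b = 0) :
    ∑ᶠ b, g b = ∑ᶠ a, g (i a) := by
  classical
  cases nonempty_fintype α
  cases nonempty_fintype β
  rw [finsum_eq_sum_of_fintype, finsum_eq_sum_of_fintype]
  exact (Fintype.sum_of_injective i hi _ _ h fun _ => rfl).symm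

theorem finsum_mul_finsum {α β M : Type*} [Finite α] [Finite β] [NonUnitalNonAssocSemiring M]
    (f : α → M) (g : β → M) : (∑ᶠ a, f a) * ∑ᶠ b, g b = ∑ᶠ a, ∑ᶠ b, f a * g b := by
  rw [← finsum_mul_of_finite]
  exact finsum_congr fun a => (mul_finsum_of_finite _ _).symm

instance {k V V' : Type*} [Field k] [AddCommGroup V] [Module k V] [AddCommGroup V'] [Module k V']
    [Finite V] [Finite V'] : Finite (V →ₗ[k] V') :=
  Finite.of_injective _ DFunLike.coe_injective

instance {k V V' : Type*} [Field k] [AddCommGroup V] [Module k V] [AddCommGroup V'] [Module k V']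
    [Finite V] [Finite V'] : Finite (V ≃ₗ[k] V') :=
  Finite.of_injective _ DFunLike.coe_injective

section Grassmannian

variable {k : Type*} [Field k] {U W V : Type*} [AddCommGroup U] [Module k U] [AddCommGroup W]
  [Module k W] [AddCommGroup V] [Module k V]

variable (k V) in
/-- The order of the general linear group of `V`. -/
def glCard : ℕ := Nat.card (V ≃ₗ[k] V)

theorem glCard_pos [Finite V] : 0 < glCard k V := Nat.card_pos

theorem card_linearEquiv (e : V ≃ₗ[k] U) : Nat.card (V ≃ₗ[k] U) = glCard k V :=
  Nat.card_congr
    { toFun := fun f => f.trans e.symm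
      invFun := fun f => f.trans e
      left_inv := fun f => by ext; simp
      right_inv := fun f => by ext; simp }

theorem glCard_congr (e : V ≃ₗ[k] U) : glCard k V = glCard k U := by
  rw [← card_linearEquiv e]
  exact Nat.card_congr
    { toFun := fun f => e.symm.trans f
      invFun := fun f => e.trans f
      left_inv := fun f => by ext; simp
      right_inv := fun f => by ext; simp }

/-- The block triangular automorphism of `U × W` with given blocks. -/
def triangularEquiv (a : U ≃ₗ[k] U) (d : W ≃ₗ[k] W) (c : W →ₗ[k] U) : (U × W) ≃ₗ[k] (U × W) :=
  LinearEquiv.ofLinearMap (triangular a.toLinearMap c d.toLinearMap)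
    (triangular a.symm.toLinearMap (-(a.symm.toLinearMap ∘ₗ c ∘ₗ d.symm.toLinearMap))
      d.symm.toLinearMap)
    (by
      apply LinearMap.ext
      rintro ⟨x, y⟩
      simp)
    (by
      apply LinearMap.ext
      rintro ⟨x, y⟩
      simp)

theorem card_parabolic [Finite U] [Finite W] :
    Nat.card {g : (U × W) ≃ₗ[k] (U × W) // ∀ x, (g x).2 = 0 ↔ x.2 = 0} =
      glCard k U * glCard k W * Nat.card (W →ₗ[k] U) := by
  have : FiniteDimensional k U := Module.Finite.of_finite
  have : FiniteDimensional k W := Module.Finite.of_finite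
  let F : ((U ≃ₗ[k] U) × (W ≃ₗ[k] W)) × (W →ₗ[k] U) →
      {g : (U × W) ≃ₗ[k] (U × W) // ∀ x, (g x).2 = 0 ↔ x.2 = 0} := fun p =>
    ⟨triangularEquiv p.1.1 p.1.2 p.2, fun x => by
      change p.1.2 x.2 = 0 ↔ _
      simp⟩
  have hF : Function.Bijective F := by
    constructor
    · rintro ⟨⟨a, d⟩, c⟩ ⟨⟨a', d'⟩, c'⟩ h
      have h1 : ∀ x : U × W, (a x.1 + c x.2, d x.2) = (a' x.1 + c' x.2, d' x.2) := fun x =>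
        LinearEquiv.congr_fun (congrArg Subtype.val h) x
      have ha : a = a' := by
        ext u
        simpa using congrArg Prod.fst (h1 (u, 0))
      have hd : d = d' := by
        ext w
        simpa using congrArg Prod.snd (h1 (0, w))
      have hc : c = c' := by
        ext w
        simpa using congrArg Prod.fst (h1 (0, w))
      rw [ha, hd, hc]
    · rintro ⟨g, hg⟩
      let a : U →ₗ[k] U := LinearMap.fst k U W ∘ₗ g.toLinearMap ∘ₗ LinearMap.inl k U W
      let d : W →ₗ[k] W := LinearMap.snd k U W ∘ₗ g.toLinearMap ∘ₗ LinearMap.inr k U W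
      let c : W →ₗ[k] U := LinearMap.fst k U W ∘ₗ g.toLinearMap ∘ₗ LinearMap.inr k U W
      have hs : ∀ u, (g (u, 0)).2 = 0 := fun u => (hg (u, 0)).2 rfl
      have ha : Function.Injective a := by
        rw [← LinearMap.ker_eq_bot, LinearMap.ker_eq_bot']
        intro u hu
        have h1 : g (u, 0) = 0 := Prod.ext hu (hs u)
        rw [LinearEquiv.map_eq_zero_iff] at h1
        exact congrArg Prod.fst h1
      have hd : Function.Injective d := by
        rw [← LinearMap.ker_eq_bot, LinearMap.ker_eq_bot']
        intro w hw
        exact (hg (0, w)).1 hw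
      refine ⟨((LinearEquiv.ofInjectiveEndo a ha, LinearEquiv.ofInjectiveEndo d hd), c), ?_⟩
      apply Subtype.ext
      apply LinearEquiv.ext
      rintro ⟨u, w⟩
      have h1 : ((u, w) : U × W) = (u, 0) + (0, w) := by simp
      change (a u + c w, d w) = g (u, w)
      rw [h1, map_add]
      refine Prod.ext rfl ?_
      rw [Prod.snd_add, hs, zero_add]
      rfl
  rw [← Nat.card_congr (Equiv.ofBijective F hF), Nat.card_prod, Nat.card_prod]
  rfl

/-- All subspaces of one dimension are equivalent under coordinates V ≅ U × W, so the coordinate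
subspace U may stand for each of them. -/
theorem exists_equiv_ker_eq [FiniteDimensional k V] [FiniteDimensional k U]
    [FiniteDimensional k W] (hV : Module.finrank k V = Module.finrank k U + Module.finrank k W)
    (S : Submodule k V) (hS : Module.finrank k S = Module.finrank k U) :
    ∃ e : V ≃ₗ[k] U × W, ∀ x, (e x).2 = 0 ↔ x ∈ S := by
  obtain ⟨T, hT⟩ := S.exists_isCompl
  have hT' : Module.finrank k T = Module.finrank k W := by
    have := Submodule.finrank_add_eq_of_isCompl hT
    omega
  refine ⟨(Submodule.prodEquivOfIsCompl S T hT).symm.trans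
    ((LinearEquiv.ofFinrankEq _ _ hS).prodCongr (LinearEquiv.ofFinrankEq _ _ hT')), fun x => ?_⟩
  simp

theorem finrank_ker_snd [FiniteDimensional k V] [FiniteDimensional k U]
    [FiniteDimensional k W] (e : V ≃ₗ[k] U × W) :
    Module.finrank k (LinearMap.ker (LinearMap.snd k U W ∘ₗ e.toLinearMap)) =
      Module.finrank k U := by
  have h1 := LinearMap.finrank_range_add_finrank_ker (LinearMap.snd k U W ∘ₗ e.toLinearMap)
  have h2 : LinearMap.range (LinearMap.snd k U W ∘ₗ e.toLinearMap) = ⊤ :=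
    LinearMap.range_eq_top.2 (Prod.snd_surjective.comp e.surjective)
  have h3 := e.finrank_eq
  rw [Module.finrank_prod] at h3
  rw [h2, finrank_top] at h1
  omega

/-- Summation over the subspaces of `V` of the dimension of `U`. -/
theorem finsum_submodule [Finite V] [Finite U] [Finite W] {M : Type*} [AddCommMonoid M]
    (hV : Module.finrank k V = Module.finrank k U + Module.finrank k W)
    (f : Submodule k V → Module.End k V → M) (g : Module.End k (U × W) → M)
    (h : ∀ (e : V ≃ₗ[k] U × W) (S : Submodule k V) (A : Module.End k V),
      (∀ x, (e x).2 = 0 ↔ x ∈ S) → f S A = g (e.conj A)) :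
    (glCard k U * glCard k W * Nat.card (W →ₗ[k] U)) •
      ∑ᶠ S : {S : Submodule k V // Module.finrank k S = Module.finrank k U}, ∑ᶠ A, f S A =
      glCard k V • ∑ᶠ A, g A := by
  have : FiniteDimensional k U := Module.Finite.of_finite
  have : FiniteDimensional k W := Module.Finite.of_finite
  have : FiniteDimensional k V := Module.Finite.of_finite
  have e₀ : V ≃ₗ[k] U × W := LinearEquiv.ofFinrankEq _ _ (by rw [hV, Module.finrank_prod])
  let F : (V ≃ₗ[k] U × W) → {S : Submodule k V // Module.finrank k S = Module.finrank k U} :=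
    fun e => ⟨LinearMap.ker (LinearMap.snd k U W ∘ₗ e.toLinearMap), finrank_ker_snd e⟩
  have hF : ∀ e S, F e = S ↔ ∀ x, (e x).2 = 0 ↔ x ∈ S.1 := by
    intro e S
    rw [Subtype.ext_iff, SetLike.ext_iff]
    rfl
  -- The coordinates adapted to a given subspace are a torsor under the parabolic subgroup. Summing
  -- over all coordinates thus counts each subspace with that multiplicity.
  have hc : ∀ S, Nat.card {e // F e = S} = glCard k U * glCard k W * Nat.card (W →ₗ[k] U) := by
    intro S
    obtain ⟨e, he⟩ := exists_equiv_ker_eq hV S.1 S.2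
    rw [← card_parabolic]
    refine Nat.card_congr
      { toFun := fun e' => ⟨e.symm.trans e'.1, fun x => ?_⟩
        invFun := fun a => ⟨e.trans a.1, ?_⟩
        left_inv := fun e' => by ext1; apply LinearEquiv.ext; intro x; simp
        right_inv := fun a => by ext1; apply LinearEquiv.ext; intro x; simp }
    · rw [LinearEquiv.trans_apply, (hF _ _).1 e'.2, ← he, LinearEquiv.apply_symm_apply]
    · rw [hF]
      intro x
      rw [LinearEquiv.trans_apply, a.2, he]
  rw [← finsum_comp_of_card_fiber F (fun S => ∑ᶠ A, f S A) hc, ← card_linearEquiv e₀,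
    ← finsum_const_eq]
  refine finsum_congr fun e => ?_
  rw [← finsum_comp_equiv e.conj.toEquiv]
  exact finsum_congr fun A => h e _ A ((hF e _).1 rfl)

variable (k U W) in
/-- The blocks of a block triangular endomorphism. -/
def ofBlocks (p : Module.End k U × (W →ₗ[k] U) × Module.End k W) : Module.End k (U × W) :=
  triangular p.1 p.2.1 p.2.2

theorem ofBlocks_injective : Function.Injective (ofBlocks k U W) := by
  rintro ⟨a, c, d⟩ ⟨a', c', d'⟩ h
  have h1 : ∀ x : U × W, (a x.1 + c x.2, d x.2) = (a' x.1 + c' x.2, d' x.2) := fun x =>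
    LinearMap.congr_fun h x
  have ha : a = a' := by
    ext u
    simpa using congrArg Prod.fst (h1 (u, 0))
  have hd : d = d' := by
    ext w
    simpa using congrArg Prod.snd (h1 (0, w))
  have hc : c = c' := by
    ext w
    simpa using congrArg Prod.fst (h1 (0, w))
  rw [ha, hd, hc]

theorem mem_range_ofBlocks {A : Module.End k (U × W)} (h : ∀ u, (A (u, 0)).2 = 0) :
    A ∈ Set.range (ofBlocks k U W) := by
  refine ⟨(LinearMap.fst k U W ∘ₗ A ∘ₗ LinearMap.inl k U W,
    LinearMap.fst k U W ∘ₗ A ∘ₗ LinearMap.inr k U W,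
    LinearMap.snd k U W ∘ₗ A ∘ₗ LinearMap.inr k U W), ?_⟩
  apply LinearMap.ext
  rintro ⟨u, w⟩
  have h2 : A (u, w) = A (u, 0) + A (0, w) := by
    rw [← map_add]
    simp
  rw [h2]
  refine Prod.ext rfl ?_
  rw [Prod.snd_add, h, zero_add]
  rfl

theorem finsum_end_prod [Finite U] [Finite W] {M : Type*} [AddCommMonoid M]
    (g : Module.End k (U × W) → M) (h : ∀ A, (¬ ∀ u, (A (u, 0)).2 = 0) → g A = 0) :
    ∑ᶠ A, g A = ∑ᶠ A, ∑ᶠ D, ∑ᶠ C, g (triangular A C D) := by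
  rw [finsum_of_injective (ofBlocks k U W) ofBlocks_injective g
    fun b hb => h b fun hb' => hb (mem_range_ofBlocks hb'), finsum_prod]
  refine finsum_congr fun A => ?_
  rw [finsum_prod, finsum_swap]
  rfl

theorem triangular_pow (A : Module.End k U) (C : W →ₗ[k] U) (D : Module.End k W) (n : ℕ) :
    ∃ C', triangular A C D ^ n = triangular (A ^ n) C' (D ^ n) := by
  induction n with
  | zero =>
    refine ⟨0, ?_⟩
    apply LinearMap.ext
    rintro ⟨u, w⟩
    simp
  | succ n ih =>
    obtain ⟨C', h⟩ := ih
    refine ⟨(A ^ n) ∘ₗ C + C' ∘ₗ D, ?_⟩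
    rw [pow_succ, h]
    apply LinearMap.ext
    rintro ⟨u, w⟩
    simp [pow_succ, add_assoc]

theorem isNilpotent_triangular {A : Module.End k U} {C : W →ₗ[k] U} {D : Module.End k W} :
    IsNilpotent (triangular A C D) ↔ IsNilpotent A ∧ IsNilpotent D := by
  constructor
  · rintro ⟨n, hn⟩
    obtain ⟨C', h⟩ := triangular_pow A C D n
    rw [h] at hn
    refine ⟨⟨n, LinearMap.ext fun u => ?_⟩, n, LinearMap.ext fun w => ?_⟩
    · simpa using congrArg Prod.fst (LinearMap.congr_fun hn (u, 0))
    · simpa using congrArg Prod.snd (LinearMap.congr_fun hn (0, w))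
  · rintro ⟨⟨a, ha⟩, d, hd⟩
    obtain ⟨C', h⟩ := triangular_pow A C D d
    obtain ⟨C'', h'⟩ := triangular_pow A C D a
    refine ⟨a + d, ?_⟩
    rw [pow_add, h, h', ha, hd]
    apply LinearMap.ext
    rintro ⟨u, w⟩
    simp

end Grassmannian

/-! ### Flags through a fixed subspace -/

section Through

variable {k : Type*} [Field k]

/-- The number of stable flags of a given type with prescribed `N`-th subspace. -/
def flagCountThrough {V : Type*} [AddCommGroup V] [Module k V] (α : ℕ → ℕ) (N : ℕ)
    (S : Submodule k V) (A : Module.End k V) : ℕ :=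
  Nat.card {F : StableFlag A // F.HasType α ∧ F.space N = S}

theorem flagCount_eq_finsum_through {V : Type*} [AddCommGroup V] [Module k V] [Finite V]
    (α : ℕ →₀ ℕ) (N r : ℕ) (hr : ∑ j ∈ Finset.range N, α j = r) (A : Module.End k V) :
    flagCount α A = ∑ᶠ S : {S : Submodule k V // Module.finrank k S = r},
      flagCountThrough α N S.1 A := by
  rw [flagCount, card_eq_finsum_fiber (fun F : {F : StableFlag A // F.HasType α} =>
    (⟨F.1.space N, by rw [F.2.finrank_eq, hr]⟩ :
      {S : Submodule k V // Module.finrank k S = r}))]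
  refine finsum_congr fun S => Nat.card_congr
    { toFun := fun F => ⟨F.1.1, F.1.2, congrArg Subtype.val F.2⟩
      invFun := fun F => ⟨⟨F.1, F.2.1⟩, Subtype.ext F.2.2⟩
      left_inv := fun _ => rfl
      right_inv := fun _ => rfl }

theorem flagCountThrough_conj {V V' : Type*} [AddCommGroup V] [Module k V] [AddCommGroup V']
    [Module k V'] (e : V ≃ₗ[k] V') {A : Module.End k V} {A' : Module.End k V'}
    (h : ∀ v, e (A v) = A' (e v)) {S : Submodule k V} {S' : Submodule k V'}
    (hS : ∀ v, e v ∈ S' ↔ v ∈ S) (α : ℕ → ℕ) (N : ℕ) :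
    flagCountThrough α N S A = flagCountThrough α N S' A' := by
  have h' : ∀ v, e.symm (A' v) = A (e.symm v) := fun v => by
    rw [LinearEquiv.symm_apply_eq, h, e.apply_symm_apply]
  refine Nat.card_congr ((StableFlag.equiv e h).subtypeEquiv fun F => and_congr ?_ ?_)
  · refine ⟨fun hF => hF.map e h, fun hF => ?_⟩
    have h2 := (StableFlag.equiv e h).symm_apply_apply F
    exact h2 ▸ hF.map e.symm h'
  · change _ ↔ (F.space N).map e.toLinearMap = S'
    have : S' = S.map e.toLinearMap := by
      ext x
      constructor
      · intro hx
        exact ⟨e.symm x, (hS _).1 (by simpa using hx), by simp⟩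
      · rintro ⟨y, hy, rfl⟩
        exact (hS y).2 hy
    rw [this]
    exact (Submodule.map_injective_of_injective (f := e.toLinearMap) e.injective).eq_iff.symm

variable {U W : Type*} [AddCommGroup U] [Module k U] [AddCommGroup W] [Module k W]

/-- The flag of `U × W` that first runs through a flag of `U`. -/
def StableFlag.prepend {A : Module.End k U} (G : StableFlag A) (C : W →ₗ[k] U)
    (D : Module.End k W) (N : ℕ) : StableFlag (triangular A C D) where
  space i := if i ≤ N then (G.space i).map (LinearMap.inl k U W) else ⊤
  mono i j hij := by
    dsimp only
    split_ifs with h1 h2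
    · exact Submodule.map_mono (G.mono hij)
    · exact le_top
    · omega
    · exact le_rfl
  zero := by rw [if_pos (Nat.zero_le _), G.zero, Submodule.map_bot]
  top := ⟨N + 1, if_neg (by omega)⟩
  stable i v hv := by
    split_ifs at hv ⊢ with h
    · obtain ⟨u, hu, rfl⟩ := hv
      exact ⟨A u, G.stable i u hu, by simp⟩
    · trivial

theorem map_inl_top : (⊤ : Submodule k U).map (LinearMap.inl k U W) =
    LinearMap.ker (LinearMap.snd k U W) := by
  rw [Submodule.map_top, LinearMap.range_inl]

theorem StableFlag.map_inl_sub {A : Module.End k U} {C : W →ₗ[k] U} {D : Module.End k W}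
    {F : StableFlag (triangular A C D)} {N : ℕ} (hF : F.space N = LinearMap.ker (LinearMap.snd k U
      W))
    {i : ℕ} (hi : i ≤ N) : (F.sub.space i).map (LinearMap.inl k U W) = F.space i := by
  have h := F.mono hi
  rw [hF, ← LinearMap.range_inl] at h
  exact Submodule.map_comap_eq_of_le h

/-- As α vanishes from N on, step N is the last nonzero step possible and leads from U to the whole
space. All freedom lies below U, and the off-diagonal block C plays no role. -/
theorem flagCountThrough_triangular [Finite U] [Finite W] (A : Module.End k U)
    (C : W →ₗ[k] U) (D : Module.End k W) (α : ℕ →₀ ℕ) (N : ℕ) (hα : ∀ c ∈ α.support, c < N)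
    (hU : Module.finrank k U = ∑ j ∈ Finset.range N, α j) :
    flagCountThrough ⇑(Finsupp.single N (Module.finrank k W) + α) N
      (LinearMap.ker (LinearMap.snd k U W)) (triangular A C D) = flagCount α A := by
  have : FiniteDimensional k U := Module.Finite.of_finite
  have : FiniteDimensional k W := Module.Finite.of_finite
  have h0 : ∀ i, N ≤ i → α i = 0 := by
    intro i hi
    by_contra hne
    have := hα i (Finsupp.mem_support_iff.2 hne)
    omega
  have hfin : ∀ S : Submodule k U, Module.finrank k (S.map (LinearMap.inl k U W)) =
      Module.finrank k S := fun S => (Submodule.equivMapOfInjective _ LinearMap.inl_injective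
        S).finrank_eq.symm
  refine Nat.card_congr
    { toFun := fun F => ⟨F.1.sub, ?_⟩
      invFun := fun G => ⟨G.1.prepend C D N, ?_, ?_⟩
      left_inv := ?_
      right_inv := ?_ }
  · obtain ⟨F, hF, hN⟩ := F
    dsimp only
    apply StableFlag.hasType_of_finrank_eq
    intro i
    rcases le_total i N with hi | hi
    · rw [← hfin, F.map_inl_sub hN hi, hF.finrank_eq]
      refine Finset.sum_congr rfl fun j hj => ?_
      have : N ≠ j := by
        have := Finset.mem_range.1 hj
        omega
      simp [this.symm]
    · have ht : F.sub.space i = ⊤ := by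
        rw [eq_top_iff]
        refine le_trans ?_ (F.sub.mono hi)
        intro u _
        rw [F.mem_sub, hN]
        rfl
      rw [ht, finrank_top, hU]
      obtain ⟨m, rfl⟩ := Nat.exists_eq_add_of_le hi
      rw [Finset.sum_range_add, Finset.sum_eq_zero (fun x _ => h0 (N + x) (by omega)), add_zero]
  · obtain ⟨G, hG⟩ := G
    dsimp only
    apply StableFlag.hasType_of_finrank_eq
    intro i
    by_cases hi : i ≤ N
    · have hs : (G.prepend C D N).space i = (G.space i).map (LinearMap.inl k U W) := if_pos hi
      rw [hs, hfin, hG.finrank_eq]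
      refine Finset.sum_congr rfl fun j hj => ?_
      have : N ≠ j := by
        have := Finset.mem_range.1 hj
        omega
      simp [this.symm]
    · obtain ⟨m, rfl⟩ := Nat.exists_eq_add_of_lt (not_le.1 hi)
      have hz : ∀ x ∈ Finset.range m, (Finsupp.single N (Module.finrank k W) + α) (N + 1 + x) = 0
          := by
        intro x _
        have : N ≠ N + 1 + x := by omega
        simp [this.symm, h0 (N + 1 + x) (by omega)]
      have hs : (G.prepend C D N).space (N + m + 1) = ⊤ := if_neg hi
      rw [hs, finrank_top, Module.finrank_prod, show N + m + 1 = N + 1 + m by ring,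
        Finset.sum_range_add, Finset.sum_eq_zero hz, Finset.sum_range_succ, hU, add_zero]
      congr 1
      · refine Finset.sum_congr rfl fun j hj => ?_
        have : N ≠ j := by
          have := Finset.mem_range.1 hj
          omega
        simp [this.symm]
      · simp [h0 N le_rfl]
  · obtain ⟨G, hG⟩ := G
    change (if N ≤ N then (G.space N).map (LinearMap.inl k U W) else ⊤ :
      Submodule k (U × W)) = _
    rw [if_pos le_rfl, hG.space_eq_top h0 le_rfl, map_inl_top]
  · rintro ⟨F, hF, hN⟩
    apply Subtype.ext
    apply StableFlag.ext
    funext i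
    change (if i ≤ N then (F.sub.space i).map (LinearMap.inl k U W) else ⊤ :
      Submodule k (U × W)) = _
    split_ifs with hi
    · exact F.map_inl_sub hN hi
    · refine (hF.space_eq_top (N := N + 1) (fun i hi => ?_) (by omega)).symm
      have : N ≠ i := by omega
      simp [this.symm, h0 i (by omega)]
  · rintro ⟨G, hG⟩
    apply Subtype.ext
    apply StableFlag.ext
    funext i
    change (if i ≤ N then (G.space i).map (LinearMap.inl k U W) else ⊤ :
      Submodule k (U × W)).comap (LinearMap.inl k U W) = _
    split_ifs with hi
    · exact Submodule.comap_map_eq_of_injective LinearMap.inl_injective _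
    · rw [Submodule.comap_top, hG.space_eq_top h0 (by omega)]

theorem flagCountThrough_eq_zero {A : Module.End k (U × W)} (h : ¬ ∀ u, (A (u, 0)).2 = 0)
    (α : ℕ → ℕ) (N : ℕ) : flagCountThrough α N (LinearMap.ker (LinearMap.snd k U W)) A = 0 := by
  have : IsEmpty {F : StableFlag A // F.HasType α ∧
      F.space N = LinearMap.ker (LinearMap.snd k U W)} := by
    refine ⟨fun F => h fun u => ?_⟩
    have := F.1.stable N (u, 0) (by rw [F.2.2]; rfl)
    rw [F.2.2] at this
    exact this
  exact Nat.card_of_isEmpty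

end Through

theorem flagCount_of_subsingleton {k V : Type*} [Field k] [AddCommGroup V] [Module k V]
    [Subsingleton V] (A : Module.End k V) : flagCount (0 : ℕ →₀ ℕ) A = 1 := by
  have : Subsingleton {F : StableFlag A // F.HasType (0 : ℕ →₀ ℕ)} :=
    ⟨fun F G => Subtype.ext (StableFlag.ext (Subsingleton.elim _ _))⟩
  have : Nonempty {F : StableFlag A // F.HasType (0 : ℕ →₀ ℕ)} :=
    ⟨⟨⟨fun _ => ⊥, monotone_const, rfl, ⟨0, Subsingleton.elim _ _⟩, fun _ v _ => by
      rw [Subsingleton.elim (A v) 0]; exact zero_mem _⟩, fun i => rfl⟩⟩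
  exact Nat.card_eq_one_iff_unique.2 ⟨‹_›, ‹_›⟩

/-! ### Weights that are multiplicative on average, and their sums over nilpotent endomorphisms -/

/-- Functions of endomorphisms of finite vector spaces that are invariant under conjugation and
multiplicative on average in extensions. -/
structure Weight (k : Type u) [Field k] (R : Type*) [CommRing R] where
  val : ∀ {V : Type u} [AddCommGroup V] [Module k V], Module.End k V → R
  of_subsingleton : ∀ {V : Type u} [AddCommGroup V] [Module k V] [Subsingleton V]
    (A : Module.End k V), val A = 1
  conj : ∀ {V V' : Type u} [AddCommGroup V] [Module k V] [AddCommGroup V'] [Module k V']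
    (e : V ≃ₗ[k] V') {A : Module.End k V} {A' : Module.End k V'},
    (∀ v, e (A v) = A' (e v)) → val A = val A'
  extension : ∀ {U W : Type u} [AddCommGroup U] [Module k U] [AddCommGroup W] [Module k W]
    [Finite U] [Finite W] (A : Module.End k U) (D : Module.End k W),
    ∑ᶠ C : W →ₗ[k] U, val (triangular A C D) = Nat.card (W →ₗ[k] U) • (val A * val D)

/-- The constant weight. -/
def Weight.one (k : Type u) [Field k] (R : Type*) [CommRing R] : Weight k R where
  val _ := 1
  of_subsingleton _ := rfl
  conj _ _ _ _ := rfl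
  extension _ _ := by rw [finsum_const_eq, mul_one]

section Nil

variable {k : Type u} [Field k] {R : Type*} [CommRing R]

open scoped Classical in
/-- The sum of a weight over nilpotent endomorphisms. -/
def Weight.nilSum (Φ : Weight k R) (V : Type u) [AddCommGroup V] [Module k V] : R :=
  ∑ᶠ A : Module.End k V, if IsNilpotent A then Φ.val A else 0

open scoped Classical in
/-- The sum of a weight over nilpotent endomorphisms with a stable flag. -/
def Weight.flagSum (Φ : Weight k R) (α : ℕ → ℕ) (V : Type u) [AddCommGroup V] [Module k V] : R :=
  ∑ᶠ A : Module.End k V, if IsNilpotent A then flagCount α A • Φ.val A else 0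

theorem isNilpotent_conj_iff {V V' : Type*} [AddCommGroup V] [Module k V] [AddCommGroup V']
    [Module k V'] (e : V ≃ₗ[k] V') (A : Module.End k V) :
    IsNilpotent (e.conj A) ↔ IsNilpotent A :=
  IsNilpotent.map_iff (f := e.conjRingEquiv) e.conjRingEquiv.injective

/-- Splitting off the top step of the flag: fix its N-th subspace, move it to U ⊆ U × W, and observe
that A must then be block triangular. Only the weight depends on C, so averaging over C factors the
sum. After division by the group orders the factor |Hom(W, U)| disappears. -/
theorem Weight.flagSum_step [Finite k] (Φ : Weight k R) (α : ℕ →₀ ℕ) (N : ℕ)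
    (hα : ∀ c ∈ α.support, c < N) (V U W : Type u) [AddCommGroup V] [Module k V]
    [AddCommGroup U] [Module k U] [AddCommGroup W] [Module k W] [Finite V] [Finite U] [Finite W]
    (hV : Module.finrank k V = Module.finrank k U + Module.finrank k W)
    (hU : Module.finrank k U = ∑ j ∈ Finset.range N, α j) :
    (glCard k U * glCard k W * Nat.card (W →ₗ[k] U)) •
      Φ.flagSum ⇑(Finsupp.single N (Module.finrank k W) + α) V =
      glCard k V • Nat.card (W →ₗ[k] U) • (Φ.flagSum α U * Φ.nilSum W) := by
  classical
  set β := Finsupp.single N (Module.finrank k W) + α with hβ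
  have hsum : ∑ j ∈ Finset.range N, β j = Module.finrank k U := by
    rw [hU]
    refine Finset.sum_congr rfl fun j hj => ?_
    have : N ≠ j := by
      have := Finset.mem_range.1 hj
      omega
    simp [hβ, this.symm]
  -- The flags are sorted by their `N`-th subspace, whose dimension is forced by the type.
  have h1 : Φ.flagSum β V = ∑ᶠ S : {S : Submodule k V // Module.finrank k S = Module.finrank k U},
      ∑ᶠ A : Module.End k V, if IsNilpotent A then flagCountThrough β N S.1 A • Φ.val A else 0 := by
    rw [Weight.flagSum, finsum_swap]
    refine finsum_congr fun A => ?_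
    rw [flagCount_eq_finsum_through β N _ hsum]
    split_ifs
    · cases nonempty_fintype {S : Submodule k V // Module.finrank k S = Module.finrank k U}
      rw [finsum_eq_sum_of_fintype, finsum_eq_sum_of_fintype, Finset.sum_smul]
    · simp
  rw [h1, finsum_submodule hV (fun S A => if IsNilpotent A then
    flagCountThrough β N S A • Φ.val A else 0) (fun A => if IsNilpotent A then
    flagCountThrough β N (LinearMap.ker (LinearMap.snd k U W)) A • Φ.val A else 0)]
  · congr 1
    rw [finsum_end_prod]
    · simp_rw [isNilpotent_triangular, hβ, flagCountThrough_triangular _ _ _ α N hα hU]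
      rw [Weight.flagSum, Weight.nilSum, finsum_mul_finsum, smul_finsum' _ (Set.toFinite _)]
      refine finsum_congr fun A => ?_
      rw [smul_finsum' _ (Set.toFinite _)]
      refine finsum_congr fun D => ?_
      by_cases hA : IsNilpotent A
      · by_cases hD : IsNilpotent D
        · simp only [hA, hD, and_self, if_true]
          rw [← smul_finsum' _ (Set.toFinite _), Φ.extension, smul_mul_assoc, smul_comm]
        · simp [hD]
      · simp [hA]
    · intro A hA
      rw [flagCountThrough_eq_zero hA, zero_smul, ite_self]
  · intro e S A hS
    have hc : ∀ v, e (A v) = e.conj A (e v) := fun v => by simp [LinearEquiv.conj_apply]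
    rw [isNilpotent_conj_iff, Φ.conj e hc, flagCountThrough_conj e hc (S' := LinearMap.ker
      (LinearMap.snd k U W)) hS]

variable [Algebra ℚ R]

/-- The sum of a weight over nilpotent endomorphisms, divided by the order of the general linear
group. -/
def Weight.nilMass (Φ : Weight k R) (V : Type u) [AddCommGroup V] [Module k V] : R :=
  (glCard k V : ℚ)⁻¹ • Φ.nilSum V

/-- Normalized by the orders of the general linear groups, flag sums are multiplicative in the
steps. The induction removes the step of largest index, so zero steps in between cost nothing. -/
theorem Weight.flagSum_eq [Finite k] (Φ : Weight k R) (α : ℕ →₀ ℕ) :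
    ∀ (V : Type u) [AddCommGroup V] [Module k V] [Finite V],
      Module.finrank k V = α.sum (fun _ m => m) →
      Φ.flagSum α V = glCard k V • α.prod fun _ m => Φ.nilMass (Fin m → k) := by
  classical
  induction α using Finsupp.induction_on_max with
  | zero =>
    intro V _ _ _ hV
    have : FiniteDimensional k V := Module.Finite.of_finite
    rw [Finsupp.sum_zero_index] at hV
    have hs : Subsingleton V := Module.finrank_zero_iff.1 hV
    have hg : glCard k V = 1 := by
      have : Subsingleton (V ≃ₗ[k] V) := ⟨fun _ _ => LinearEquiv.ext fun _ => Subsingleton.elim _ _⟩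
      exact Nat.card_eq_one_iff_unique.2 ⟨‹_›, ⟨LinearEquiv.refl k V⟩⟩
    rw [Weight.flagSum, finsum_eq_single _ (0 : Module.End k V) fun A hA =>
      absurd (LinearMap.ext fun _ => Subsingleton.elim _ _) hA, flagCount_of_subsingleton, hg,
        Φ.of_subsingleton]
    simp
  | single_add N s α hα hs ih =>
    intro V _ _ _ hV
    have hsum : α.sum (fun _ m => m) = ∑ j ∈ Finset.range N, α j :=
      Finsupp.sum_of_support_subset _ (fun c hc => Finset.mem_range.2 (hα c hc)) _
        fun _ _ => rfl
    have hα0 : α N = 0 := by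
      by_contra h
      exact lt_irrefl _ (hα N (Finsupp.mem_support_iff.2 h))
    rw [Finsupp.sum_add_index' (fun _ => rfl) (fun _ _ _ => rfl),
      Finsupp.sum_single_index rfl] at hV
    set r := α.sum fun _ m => m with hr
    have hU : Module.finrank k (Fin r → k) = r := by simp
    have hW : Module.finrank k (Fin s → k) = s := by simp
    have hst := Φ.flagSum_step α N hα V (Fin r → k) (Fin s → k) (by rw [hU, hW, hV, add_comm])
      (by rw [hU, hsum])
    rw [hW, ih (Fin r → k) hU] at hst
    have hp : (Finsupp.single N s + α).prod (fun _ m => Φ.nilMass (Fin m → k)) =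
        Φ.nilMass (Fin s → k) * α.prod fun _ m => Φ.nilMass (Fin m → k) := by
      have hd : Disjoint (Finsupp.single N s).support α.support := by
        rw [Finsupp.support_single _ hs, Finset.disjoint_singleton_left]
        simpa using hα0
      rw [Finsupp.prod_add_index_of_disjoint hd, Finsupp.prod, Finsupp.support_single _ hs,
        Finset.prod_singleton,
        Finsupp.single_eq_same]
    have h1 : (glCard k (Fin r → k) : ℚ) ≠ 0 := Nat.cast_ne_zero.2 glCard_pos.ne'
    have h2 : (glCard k (Fin s → k) : ℚ) ≠ 0 := Nat.cast_ne_zero.2 glCard_pos.ne'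
    have h3 : (Nat.card ((Fin s → k) →ₗ[k] (Fin r → k)) : ℚ) ≠ 0 :=
      Nat.cast_ne_zero.2 Nat.card_pos.ne'
    rw [hp, Weight.nilMass]
    simp only [← Nat.cast_smul_eq_nsmul ℚ, Nat.cast_mul] at hst ⊢
    have h4 := congrArg (fun x => ((glCard k (Fin r → k) : ℚ) * (glCard k (Fin s → k) : ℚ) *
      (Nat.card ((Fin s → k) →ₗ[k] (Fin r → k)) : ℚ))⁻¹ • x) hst
    rw [inv_smul_smul₀ (by positivity)] at h4
    rw [h4]
    simp only [smul_smul, smul_mul_assoc]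
    rw [mul_comm (Φ.nilSum _)]
    congr 1
    field_simp

end Nil

/-! ### Fitting's decomposition and the number of endomorphisms -/

section Fitting

variable {k : Type*} [Field k] {V : Type*} [AddCommGroup V] [Module k V]

theorem mem_maxGenEigenspace_zero {A : Module.End k V} {x : V} :
    x ∈ A.maxGenEigenspace 0 ↔ ∃ n : ℕ, (A ^ n) x = 0 := by
  rw [Module.End.mem_maxGenEigenspace]
  simp

/-- The generalized kernel equals the subspace U precisely when the operator is nilpotent on U and
injective on the quotient, with no condition on C. This is what makes endomorphisms with a given
Fitting subspace countable. -/
theorem ker_snd_eq_maxGenEigenspace {U W : Type*} [AddCommGroup U] [Module k U] [AddCommGroup W]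
    [Module k W] [FiniteDimensional k U] {A : Module.End k U} {C : W →ₗ[k] U}
    {D : Module.End k W} :
    LinearMap.ker (LinearMap.snd k U W) = (triangular A C D).maxGenEigenspace 0 ↔
      IsNilpotent A ∧ Function.Injective D := by
  have hp : ∀ n (x : U × W), ((triangular A C D ^ n) x).2 = (D ^ n) x.2 := by
    intro n x
    obtain ⟨C', h⟩ := triangular_pow A C D n
    rw [h]
    rfl
  have hq : ∀ n (u : U), (triangular A C D ^ n) (u, 0) = ((A ^ n) u, 0) := by
    intro n u
    obtain ⟨C', h⟩ := triangular_pow A C D n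
    rw [h]
    simp
  constructor
  · intro h
    constructor
    · rw [Module.End.isNilpotent_iff_of_finite]
      intro u
      have : (u, (0 : W)) ∈ LinearMap.ker (LinearMap.snd k U W) := rfl
      rw [h, mem_maxGenEigenspace_zero] at this
      obtain ⟨n, hn⟩ := this
      rw [hq] at hn
      exact ⟨n, congrArg Prod.fst hn⟩
    · rw [← LinearMap.ker_eq_bot, LinearMap.ker_eq_bot']
      intro w hw
      have h1 : triangular A C D (0, w) ∈ LinearMap.ker (LinearMap.snd k U W) := hw
      rw [h, mem_maxGenEigenspace_zero] at h1
      obtain ⟨n, hn⟩ := h1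
      have h2 : ((0 : U), w) ∈ (triangular A C D).maxGenEigenspace 0 :=
        mem_maxGenEigenspace_zero.2 ⟨n + 1, by rw [pow_succ]; exact hn⟩
      rw [← h] at h2
      exact h2
  · rintro ⟨⟨a, ha⟩, hD⟩
    ext ⟨u, w⟩
    rw [mem_maxGenEigenspace_zero]
    constructor
    · intro hw
      have hw : w = 0 := hw
      subst hw
      exact ⟨a, by rw [hq, ha]; rfl⟩
    · rintro ⟨n, hn⟩
      have h1 := hp n (u, w)
      rw [hn] at h1
      have h2 : Function.Injective (D ^ n) := by
        rw [Module.End.coe_pow]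
        exact hD.iterate n
      exact h2 (by rw [map_zero]; exact h1.symm)

theorem card_injective_end [FiniteDimensional k V] :
    Nat.card {D : Module.End k V // Function.Injective D} = glCard k V :=
  Nat.card_congr
    { toFun := fun D => LinearEquiv.ofInjectiveEndo D.1 D.2
      invFun := fun e => ⟨e.toLinearMap, e.injective⟩
      left_inv := fun D => rfl
      right_inv := fun e => by ext; rfl }

theorem finsum_ite_eq_card {α : Type*} [Finite α] (p : α → Prop) [DecidablePred p] :
    ∑ᶠ a, (if p a then 1 else 0) = Nat.card {a // p a} := by
  cases nonempty_fintype α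
  rw [finsum_eq_sum_of_fintype, Finset.sum_boole, Nat.card_eq_fintype_card, Fintype.card_subtype]
  rfl

/-- Fitting's decomposition of the endomorphisms of `V` by the dimension of the nilpotent part. -/
theorem card_end_eq_sum {k : Type u} [Field k] [Finite k] {V : Type u} [AddCommGroup V]
    [Module k V] [Finite V] :
    (Nat.card (Module.End k V) : ℚ) / glCard k V =
      ∑ r ∈ Finset.range (Module.finrank k V + 1), (Weight.one k ℚ).nilMass (Fin r → k) := by
  classical
  have : FiniteDimensional k V := Module.Finite.of_finite
  set n := Module.finrank k V with hn
  -- The number of endomorphisms whose generalized kernel has dimension `r`, written as a sum over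
  -- subspaces so that `finsum_submodule` applies.
  let X : ℕ → ℕ := fun r => ∑ᶠ S : {S : Submodule k V // Module.finrank k S = r},
    ∑ᶠ A : Module.End k V, if S.1 = A.maxGenEigenspace 0 then 1 else 0
  have hX : Nat.card (Module.End k V) = ∑ r ∈ Finset.range (n + 1), X r := by
    have h1 : ∀ r, X r = ∑ᶠ A : Module.End k V,
        if Module.finrank k (A.maxGenEigenspace 0) = r then 1 else 0 := by
      intro r
      simp only [X]
      rw [finsum_swap]
      refine finsum_congr fun A => ?_
      rw [finsum_ite_eq_card]
      split_ifs with h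
      · rw [Nat.card_eq_one_iff_unique]
        exact ⟨⟨fun S T => Subtype.ext (Subtype.ext (S.2.trans T.2.symm))⟩, ⟨⟨⟨_, h⟩, rfl⟩⟩⟩
      · have : IsEmpty {S : {S : Submodule k V // Module.finrank k S = r} //
            S.1 = A.maxGenEigenspace 0} := ⟨fun S => h (S.2 ▸ S.1.2)⟩
        exact Nat.card_of_isEmpty
    simp_rw [h1]
    cases nonempty_fintype (Module.End k V)
    simp_rw [finsum_eq_sum_of_fintype]
    rw [Finset.sum_comm, Nat.card_eq_fintype_card, Fintype.card_eq_sum_ones]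
    refine Finset.sum_congr rfl fun A _ => ?_
    rw [Finset.sum_ite_eq, if_pos]
    rw [Finset.mem_range, Nat.lt_succ_iff]
    exact Submodule.finrank_le _
  rw [hX, Nat.cast_sum, Finset.sum_div]
  refine Finset.sum_congr rfl fun r hr => ?_
  have hX' : X r = ∑ᶠ S : {S : Submodule k V // Module.finrank k S =
    Module.finrank k (Fin r → k)}, ∑ᶠ A : Module.End k V,
      if S.1 = A.maxGenEigenspace 0 then 1 else 0 := by
    rw [Module.finrank_fin_fun]
  have hr' : r ≤ n := Nat.lt_succ_iff.1 (Finset.mem_range.1 hr)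
  have h := finsum_submodule (k := k) (V := V) (U := Fin r → k) (W := Fin (n - r) → k)
    (by simp [← hn, hr'])
    (fun S A => if S = A.maxGenEigenspace 0 then 1 else 0)
    (fun A => if LinearMap.ker (LinearMap.snd k _ _) = A.maxGenEigenspace 0 then 1 else 0) (by
      intro e S A hS
      have hpow : ∀ m x, (e.conj A ^ m) (e x) = e ((A ^ m) x) := by
        intro m x
        induction m with
        | zero => rfl
        | succ m ih =>
          rw [pow_succ', pow_succ', Module.End.mul_apply, ih, Module.End.mul_apply]
          simp [LinearEquiv.conj_apply]
      have : S = A.maxGenEigenspace 0 ↔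
          LinearMap.ker (LinearMap.snd k _ _) = (e.conj A).maxGenEigenspace 0 := by
        rw [SetLike.ext_iff, SetLike.ext_iff, e.surjective.forall]
        refine forall_congr' fun x => ?_
        rw [← hS, mem_maxGenEigenspace_zero, mem_maxGenEigenspace_zero]
        simp_rw [hpow, LinearEquiv.map_eq_zero_iff]
        rfl
      simp only [this])
  rw [finsum_end_prod] at h
  · simp_rw [ker_snd_eq_maxGenEigenspace, finsum_const_eq] at h
    -- Block by block: nilpotent on `U`, invertible on `W`, arbitrary off the diagonal. The last two
    -- factors cancel against the order of the parabolic subgroup.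
    have h2 : ∑ᶠ (A : Module.End k (Fin r → k)) (D : Module.End k (Fin (n - r) → k)),
        Nat.card ((Fin (n - r) → k) →ₗ[k] (Fin r → k)) •
          (if IsNilpotent A ∧ Function.Injective D then 1 else 0) =
        Nat.card ((Fin (n - r) → k) →ₗ[k] (Fin r → k)) *
          (Nat.card {A : Module.End k (Fin r → k) // IsNilpotent A} *
            glCard k (Fin (n - r) → k)) := by
      rw [← card_injective_end, ← finsum_ite_eq_card, ← finsum_ite_eq_card, finsum_mul_finsum,
        ← mul_finsum_of_finite]
      refine finsum_congr fun A => ?_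
      rw [← mul_finsum_of_finite]
      refine finsum_congr fun D => ?_
      by_cases hA : IsNilpotent A <;> by_cases hD : Function.Injective D <;> simp [hA, hD]
    have h3 : (Weight.one k ℚ).nilSum (Fin r → k) =
        Nat.card {A : Module.End k (Fin r → k) // IsNilpotent A} := by
      rw [← finsum_ite_eq_card, Weight.nilSum]
      cases nonempty_fintype (Module.End k (Fin r → k))
      rw [finsum_eq_sum_of_fintype, finsum_eq_sum_of_fintype, Nat.cast_sum]
      exact Finset.sum_congr rfl fun A _ => by split_ifs <;> simp [Weight.one]
    rw [h2] at h
    rw [Weight.nilMass, h3]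
    have h4 := congrArg (Nat.cast : ℕ → ℚ) h
    rw [← hX'] at h4
    simp only [smul_eq_mul, Nat.cast_mul] at h4
    have g1 : (glCard k (Fin r → k) : ℚ) ≠ 0 := Nat.cast_ne_zero.2 glCard_pos.ne'
    have g2 : (glCard k (Fin (n - r) → k) : ℚ) ≠ 0 := Nat.cast_ne_zero.2 glCard_pos.ne'
    have g3 : (glCard k V : ℚ) ≠ 0 := Nat.cast_ne_zero.2 glCard_pos.ne'
    have g4 : (Nat.card ((Fin (n - r) → k) →ₗ[k] (Fin r → k)) : ℚ) ≠ 0 :=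
      Nat.cast_ne_zero.2 Nat.card_pos.ne'
    rw [smul_eq_mul]
    field_simp
    refine mul_right_cancel₀ (mul_ne_zero g2 g4) ?_
    linear_combination h4
  · intro A hA
    rw [if_neg]
    intro hA'
    refine hA fun u => ?_
    have h1 : (u, (0 : Fin (n - r) → k)) ∈ LinearMap.ker (LinearMap.snd k _ _) := rfl
    rw [hA', mem_maxGenEigenspace_zero] at h1
    obtain ⟨m, hm⟩ := h1
    have h2 : A (u, 0) ∈ LinearMap.ker (LinearMap.snd k (Fin r → k) (Fin (n - r) → k)) := by
      rw [hA', mem_maxGenEigenspace_zero]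
      refine ⟨m, ?_⟩
      rw [← Module.End.mul_apply, ← pow_succ, pow_succ', Module.End.mul_apply, hm, map_zero]
    exact h2

theorem glCard_fin (k : Type*) [Field k] (n : ℕ) [Finite k] :
    glCard k (Fin n → k) = ∏ i : Fin n, (Nat.card k ^ n - Nat.card k ^ (i : ℕ)) := by
  classical
  cases nonempty_fintype k
  rw [Nat.card_eq_fintype_card, ← Matrix.card_GL_field, glCard]
  exact Nat.card_congr (Matrix.GeneralLinearGroup.toLin.trans
    (LinearMap.GeneralLinearGroup.generalLinearEquiv k (Fin n → k))).toEquiv.symm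

end Fitting

/-! ### The mass of nilpotent matrices and the flag weight -/

section Mass

/-- By Fitting's decomposition the partial sums of the masses are |End|/|GL|, for which a product
formula is known; the mass of size n + 1 is the difference of two consecutive ones. -/
theorem nilMass_one {k : Type u} [Field k] [Finite k] (n : ℕ) :
    (Weight.one k ℚ).nilMass (Fin n → k) =
      ∏ i ∈ Finset.range n, ((Nat.card k : ℚ) ^ i / ((Nat.card k : ℚ) ^ (i + 1) - 1)) := by
  set q : ℚ := (Nat.card k : ℚ) with hq
  have hq1 : 1 < q := by
    rw [hq]
    exact_mod_cast Finite.one_lt_card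
  have hne : ∀ i : ℕ, q ^ (i + 1) - 1 ≠ 0 := fun i =>
    (sub_pos.2 (one_lt_pow₀ hq1 (Nat.succ_ne_zero i))).ne'
  have hq0 : q ≠ 0 := by positivity
  let e : ℕ → ℚ := fun n => ∏ i ∈ Finset.range n, (q ^ (i + 1) / (q ^ (i + 1) - 1))
  have he : ∀ n, ∑ r ∈ Finset.range (n + 1), (Weight.one k ℚ).nilMass (Fin r → k) = e n := by
    intro n
    have h := card_end_eq_sum (k := k) (V := Fin n → k)
    rw [Module.finrank_fin_fun] at h
    rw [← h]
    have hE : (Nat.card (Module.End k (Fin n → k)) : ℚ) = ∏ i : Fin n, q ^ n := by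
      rw [Nat.card_congr (LinearMap.toMatrix' (R := k) (n := Fin n) (m := Fin n)).toEquiv]
      rw [Matrix, Nat.card_fun, Nat.card_fun]
      simp [hq]
    have hG : (glCard k (Fin n → k) : ℚ) = ∏ i : Fin n, (q ^ n - q ^ (i : ℕ)) := by
      rw [glCard_fin, Nat.cast_prod]
      refine Finset.prod_congr rfl fun i _ => ?_
      rw [Nat.cast_sub (Nat.pow_le_pow_right Nat.card_pos i.2.le)]
      simp [hq]
    -- Reversing the order of the factors turns `q ^ n / (q ^ n - q ^ i)` into `q ^ (i + 1) / (q ^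
    -- (i + 1) - 1)`, after cancelling a power of `q`; in this form the factors do not depend on
    -- `n`.
    rw [hE, hG, ← Finset.prod_div_distrib, Fin.prod_univ_eq_prod_range
      (fun i => q ^ n / (q ^ n - q ^ i)), ← Finset.prod_range_reflect]
    refine Finset.prod_congr rfl fun i hi => ?_
    have hi := Finset.mem_range.1 hi
    obtain ⟨m, rfl⟩ : ∃ m, n = i + 1 + m := ⟨n - (i + 1), by omega⟩
    rw [show i + 1 + m - 1 - i = m by omega, pow_add]
    have h1 : q ^ (i + 1) * q ^ m - q ^ m = (q ^ (i + 1) - 1) * q ^ m := by ring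
    rw [h1, mul_div_mul_right _ _ (pow_ne_zero _ hq0)]
  cases n with
  | zero =>
    have := he 0
    simpa [e] using this
  | succ n =>
    have h1 := he (n + 1)
    rw [Finset.sum_range_succ, he n] at h1
    have h2 : e (n + 1) = e n * (q ^ (n + 1) / (q ^ (n + 1) - 1)) := Finset.prod_range_succ _ _
    have h3 : (Weight.one k ℚ).nilMass (Fin (n + 1) → k) = e n * (1 / (q ^ (n + 1) - 1)) := by
      have := hne n
      rw [eq_sub_of_add_eq' h1, h2]
      field_simp
      ring
    rw [h3, Finset.prod_div_distrib, Finset.prod_range_succ', pow_zero, mul_one,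
      Finset.prod_range_succ (fun i => q ^ (i + 1) - 1)]
    simp only [e]
    rw [Finset.prod_div_distrib]
    field_simp

theorem flagCount_eq_zero {k V : Type*} [Field k] [AddCommGroup V] [Module k V]
    [FiniteDimensional k V] (α : ℕ →₀ ℕ) (A : Module.End k V)
    (h : α.degree ≠ Module.finrank k V) : flagCount α A = 0 := by
  have : IsEmpty {F : StableFlag A // F.HasType α} := by
    refine ⟨fun F => h ?_⟩
    obtain ⟨N, hN⟩ : ∃ N, ∀ i, N ≤ i → α i = 0 := by
      refine ⟨α.support.sup id + 1, fun i hi => ?_⟩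
      by_contra hn
      have := Finset.le_sup (f := id) (Finsupp.mem_support_iff.2 hn)
      simp at this
      omega
    rw [← F.2.sum_eq hN, Finsupp.degree_apply]
    refine Finset.sum_subset (fun i hi => ?_) fun i _ hi => Finsupp.notMem_support_iff.1 hi
    rw [Finset.mem_range]
    by_contra hn
    exact Finsupp.mem_support_iff.1 hi (hN i (by omega))
  exact Nat.card_of_isEmpty

/-- The generating series of the numbers of stable flags. -/
def flagSeries {k V : Type*} [Field k] [AddCommGroup V] [Module k V] (A : Module.End k V) :
    MvPowerSeries ℕ ℚ := fun α => (flagCount α A : ℚ)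

theorem coeff_flagSeries {k V : Type*} [Field k] [AddCommGroup V] [Module k V]
    (A : Module.End k V) (α : ℕ →₀ ℕ) :
    MvPowerSeries.coeff α (flagSeries A) = (flagCount α A : ℚ) := rfl

/-- The generating series of stable flags as a weight. -/
def flagWeight (k : Type u) [Field k] : Weight k (MvPowerSeries ℕ ℚ) where
  val := flagSeries
  of_subsingleton {V _ _ _} A := by
    classical
    ext α
    rw [coeff_flagSeries, MvPowerSeries.coeff_one]
    split_ifs with h
    · rw [h, flagCount_of_subsingleton, Nat.cast_one]
    · rw [flagCount_eq_zero, Nat.cast_zero]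
      rw [Module.finrank_zero_of_subsingleton]
      exact fun h' => h ((Finsupp.degree_eq_zero_iff α).1 h')
  conj e A A' h := by
    ext α
    rw [coeff_flagSeries, coeff_flagSeries, flagCount_conj e h]
  extension A D := by
    classical
    ext α
    rw [map_finsum_of_finite, map_nsmul, MvPowerSeries.coeff_mul]
    simp_rw [coeff_flagSeries]
    have h := congrArg (Nat.cast : ℕ → ℚ) (finsum_flagCount_triangular A D α)
    rw [Nat.cast_mul, Nat.cast_sum] at h
    rw [nsmul_eq_mul]
    simp only [Nat.cast_mul] at h
    rw [← h]
    exact (map_finsum_of_finite (Nat.castAddMonoidHom ℚ) _).symm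

end Mass

/-! ### Series in two sets of variables -/

section Box

variable {R : Type*} [CommRing R]

/-- The exponents of the `x`-variables. -/
def xPart (e : ℕ ⊕ ℕ →₀ ℕ) : ℕ →₀ ℕ := e.comapDomain Sum.inl Sum.inl_injective.injOn

/-- The exponents of the `y`-variables. -/
def yPart (e : ℕ ⊕ ℕ →₀ ℕ) : ℕ →₀ ℕ := e.comapDomain Sum.inr Sum.inr_injective.injOn

@[simp]
theorem xPart_apply (e : ℕ ⊕ ℕ →₀ ℕ) (i : ℕ) : xPart e i = e (Sum.inl i) := rfl

@[simp]
theorem yPart_apply (e : ℕ ⊕ ℕ →₀ ℕ) (i : ℕ) : yPart e i = e (Sum.inr i) := rfl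

theorem xPart_add (e e' : ℕ ⊕ ℕ →₀ ℕ) : xPart (e + e') = xPart e + xPart e' := by
  ext
  rfl

theorem yPart_add (e e' : ℕ ⊕ ℕ →₀ ℕ) : yPart (e + e') = yPart e + yPart e' := by
  ext
  rfl

theorem xPart_embDomain_add (a b : ℕ →₀ ℕ) :
    xPart (a.embDomain Function.Embedding.inl + b.embDomain Function.Embedding.inr) = a := by
  ext i
  have h1 : a.embDomain Function.Embedding.inl (Sum.inl i : ℕ ⊕ ℕ) = a i :=
    Finsupp.embDomain_apply_self _ _ _
  have h2 : b.embDomain Function.Embedding.inr (Sum.inl i : ℕ ⊕ ℕ) = 0 :=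
    Finsupp.embDomain_of_notMem_range _ _ _ (by rintro ⟨j, hj⟩; cases hj)
  rw [xPart_apply, Finsupp.add_apply, h1, h2, add_zero]

theorem yPart_embDomain_add (a b : ℕ →₀ ℕ) :
    yPart (a.embDomain Function.Embedding.inl + b.embDomain Function.Embedding.inr) = b := by
  ext i
  have h1 : b.embDomain Function.Embedding.inr (Sum.inr i : ℕ ⊕ ℕ) = b i :=
    Finsupp.embDomain_apply_self _ _ _
  have h2 : a.embDomain Function.Embedding.inl (Sum.inr i : ℕ ⊕ ℕ) = 0 :=
    Finsupp.embDomain_of_notMem_range _ _ _ (by rintro ⟨j, hj⟩; cases hj)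
  rw [yPart_apply, Finsupp.add_apply, h1, h2, zero_add]

theorem embDomain_xPart_add_yPart (e : ℕ ⊕ ℕ →₀ ℕ) :
    (xPart e).embDomain Function.Embedding.inl + (yPart e).embDomain Function.Embedding.inr = e :=
      by
  ext i
  cases i with
  | inl i => exact DFunLike.congr_fun (xPart_embDomain_add (xPart e) (yPart e)) i
  | inr i => exact DFunLike.congr_fun (yPart_embDomain_add (xPart e) (yPart e)) i

/-- The product `f(x) g(y)`. -/
def box (f g : MvPowerSeries ℕ R) : MvPowerSeries (ℕ ⊕ ℕ) R :=
  MvPowerSeries.rename (Function.Embedding.inl : ℕ ↪ ℕ ⊕ ℕ) f *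
    MvPowerSeries.rename (Function.Embedding.inr : ℕ ↪ ℕ ⊕ ℕ) g

theorem coeff_box (f g : MvPowerSeries ℕ R) (e : ℕ ⊕ ℕ →₀ ℕ) :
    MvPowerSeries.coeff e (box f g) =
      MvPowerSeries.coeff (xPart e) f * MvPowerSeries.coeff (yPart e) g := by
  classical
  rw [box, MvPowerSeries.coeff_mul, Finset.sum_eq_single
    ((xPart e).embDomain Function.Embedding.inl, (yPart e).embDomain Function.Embedding.inr)]
  · rw [MvPowerSeries.coeff_embDomain_rename, MvPowerSeries.coeff_embDomain_rename]
  · rintro ⟨a, b⟩ hab hne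
    have hab : a + b = e := Finset.HasAntidiagonal.mem_antidiagonal.1 hab
    by_contra h
    obtain ⟨a', rfl⟩ : a ∈ Set.range (Finsupp.mapDomain
        (Function.Embedding.inl : ℕ ↪ ℕ ⊕ ℕ)) := by
      by_contra h'
      exact left_ne_zero_of_mul h (MvPowerSeries.coeff_rename_eq_zero _ f h')
    obtain ⟨b', rfl⟩ : b ∈ Set.range (Finsupp.mapDomain
        (Function.Embedding.inr : ℕ ↪ ℕ ⊕ ℕ)) := by
      by_contra h'
      exact right_ne_zero_of_mul h (MvPowerSeries.coeff_rename_eq_zero _ g h')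
    rw [← Finsupp.embDomain_eq_mapDomain, ← Finsupp.embDomain_eq_mapDomain] at hab hne
    rw [← hab, xPart_embDomain_add, yPart_embDomain_add] at hne
    exact hne rfl
  · intro h
    exact absurd (Finset.HasAntidiagonal.mem_antidiagonal.2 (embDomain_xPart_add_yPart e)) h

theorem prod_box {ι : Type*} (s : Finset ι) (f g : ι → MvPowerSeries ℕ R) :
    ∏ i ∈ s, box (f i) (g i) = box (∏ i ∈ s, f i) (∏ i ∈ s, g i) := by
  simp only [box, map_prod, Finset.prod_mul_distrib]

end Box

/-! ### The contribution of a single degree: pairs of flags of a nilpotent matrix -/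

section Block

variable {R : Type*} [CommRing R]

/-- The part of degree `s` of the product of the series `∑ H m * y_j ^ m`. -/
def columnSeries (H : ℕ → R) (s : ℕ) : MvPowerSeries ℕ R := fun β =>
  if β.degree = s then β.prod fun _ m => H m else 0

theorem coeff_columnSeries (H : ℕ → R) (s : ℕ) (β : ℕ →₀ ℕ) :
    MvPowerSeries.coeff β (columnSeries H s) =
      if β.degree = s then β.prod (fun _ m => H m) else 0 := rfl

/-- The coefficient of `x ^ α` in the product of the series `∑ H m * (x_i y_j) ^ m`. -/
def rowSeries (H : ℕ → R) (α : ℕ →₀ ℕ) : MvPowerSeries ℕ R := α.prod fun _ m => columnSeries H m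

/-- The product of the series `∑ H m * (x_i y_j) ^ m` over all `i`, `j`. -/
def pairSeries (H : ℕ → R) : MvPowerSeries (ℕ ⊕ ℕ) R := fun e =>
  MvPowerSeries.coeff (yPart e) (rowSeries H (xPart e))

theorem coeff_pairSeries (H : ℕ → R) (e : ℕ ⊕ ℕ →₀ ℕ) : MvPowerSeries.coeff e (pairSeries H) =
    MvPowerSeries.coeff (yPart e) (rowSeries H (xPart e)) := rfl

/-- The part of degree `m` in `x` of `pairSeries`. -/
def blockSeries (H : ℕ → R) (m : ℕ) : MvPowerSeries (ℕ ⊕ ℕ) R := fun e =>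
  if (xPart e).degree = m then MvPowerSeries.coeff e (pairSeries H) else 0

theorem coeff_blockSeries (H : ℕ → R) (m : ℕ) (e : ℕ ⊕ ℕ →₀ ℕ) :
    MvPowerSeries.coeff e (blockSeries H m) =
      if (xPart e).degree = m then MvPowerSeries.coeff e (pairSeries H) else 0 := rfl

/-- Each factor is homogeneous of degree a i, so the product is homogeneous. Consequently
`pairSeries` only involves monomials with equal degrees in x and in y. -/
theorem coeff_prod_columnSeries_eq_zero (H : ℕ → R) {ι : Type*} (s : Finset ι) (a : ι → ℕ)
    (β : ℕ →₀ ℕ) (h : β.degree ≠ ∑ i ∈ s, a i) :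
    MvPowerSeries.coeff β (∏ i ∈ s, columnSeries H (a i)) = 0 := by
  classical
  induction s using Finset.induction_on generalizing β with
  | empty =>
    rw [Finset.prod_empty, MvPowerSeries.coeff_one, if_neg]
    rintro rfl
    simp at h
  | insert i s hi ih =>
    rw [Finset.prod_insert hi, MvPowerSeries.coeff_mul]
    rw [Finset.sum_insert hi] at h
    refine Finset.sum_eq_zero fun p hp => ?_
    have hp : p.1 + p.2 = β := Finset.HasAntidiagonal.mem_antidiagonal.1 hp
    rw [coeff_columnSeries]
    split_ifs with h1
    · rw [ih, mul_zero]
      intro h2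
      rw [← hp, map_add, h1, h2] at h
      exact h rfl
    · rw [zero_mul]

theorem coeff_pairSeries_eq_zero (H : ℕ → R) {e : ℕ ⊕ ℕ →₀ ℕ}
    (h : (yPart e).degree ≠ (xPart e).degree) : MvPowerSeries.coeff e (pairSeries H) = 0 :=
  coeff_prod_columnSeries_eq_zero H _ _ _ h

theorem map_columnSeries {S : Type*} [CommRing S] (φ : R →+* S) (H : ℕ → R) (s : ℕ) :
    MvPowerSeries.map φ (columnSeries H s) = columnSeries (φ ∘ H) s := by
  ext β
  rw [MvPowerSeries.coeff_map, coeff_columnSeries, coeff_columnSeries]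
  split_ifs
  · rw [map_finsuppProd]
    rfl
  · rw [map_zero]

theorem map_blockSeries {S : Type*} [CommRing S] (φ : R →+* S) (H : ℕ → R) (m : ℕ) :
    MvPowerSeries.map φ (blockSeries H m) = blockSeries (φ ∘ H) m := by
  ext e
  rw [MvPowerSeries.coeff_map, coeff_blockSeries, coeff_blockSeries]
  split_ifs
  · rw [coeff_pairSeries, coeff_pairSeries, ← MvPowerSeries.coeff_map, rowSeries, map_finsuppProd]
    simp_rw [map_columnSeries]
    rfl
  · rw [map_zero]

theorem degree_equivMapDomain {ι κ : Type*} (σ : ι ≃ κ) (β : ι →₀ ℕ) :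
    (β.equivMapDomain σ).degree = β.degree := by
  rw [Finsupp.equivMapDomain_eq_mapDomain]
  exact Finsupp.sum_mapDomain_index_inj (h := fun _ m => m) σ.injective

theorem prod_equivMapDomain {ι κ M : Type*} [CommMonoid M] (σ : ι ≃ κ) (β : ι →₀ ℕ) (f : ℕ → M) :
    (β.equivMapDomain σ).prod (fun _ m => f m) = β.prod fun _ m => f m := by
  rw [Finsupp.equivMapDomain_eq_mapDomain]
  exact Finsupp.prod_mapDomain_index_inj (h := fun _ m => f m) σ.injective

theorem coeff_renameEquiv {σ τ : Type*} (e : σ ≃ τ) (f : MvPowerSeries σ R) (β : σ →₀ ℕ) :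
    MvPowerSeries.coeff (β.equivMapDomain e) (MvPowerSeries.renameEquiv R e f) =
      MvPowerSeries.coeff β f := by
  have := MvPowerSeries.coeff_embDomain_rename (R := R) e.toEmbedding f β
  rw [Finsupp.embDomain_eq_mapDomain] at this
  rw [Finsupp.equivMapDomain_eq_mapDomain]
  exact this

theorem columnSeries_symm (H : ℕ → R) (s : ℕ) (σ : Equiv.Perm ℕ) :
    MvPowerSeries.renameEquiv R σ (columnSeries H s) = columnSeries H s := by
  ext β
  obtain ⟨β, rfl⟩ := (Finsupp.equivCongrLeft (M := ℕ) σ).surjective β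
  rw [Finsupp.equivCongrLeft_apply, coeff_renameEquiv, coeff_columnSeries, coeff_columnSeries,
    degree_equivMapDomain, prod_equivMapDomain]

theorem xPart_equivMapDomain (σ τ : Equiv.Perm ℕ) (e : ℕ ⊕ ℕ →₀ ℕ) :
    xPart (e.equivMapDomain (σ.sumCongr τ)) = (xPart e).equivMapDomain σ := by
  ext i
  simp [Finsupp.equivMapDomain_apply]

theorem yPart_equivMapDomain (σ τ : Equiv.Perm ℕ) (e : ℕ ⊕ ℕ →₀ ℕ) :
    yPart (e.equivMapDomain (σ.sumCongr τ)) = (yPart e).equivMapDomain τ := by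
  ext i
  simp [Finsupp.equivMapDomain_apply]

theorem rowSeries_symm (H : ℕ → R) (α : ℕ →₀ ℕ) (σ : Equiv.Perm ℕ) :
    MvPowerSeries.renameEquiv R σ (rowSeries H α) = rowSeries H α := by
  rw [rowSeries, map_finsuppProd]
  simp_rw [columnSeries_symm]

/-- Permutation of the variables in both sets. -/
def permuteVars (σ τ : Equiv.Perm ℕ) : MvPowerSeries (ℕ ⊕ ℕ) R ≃ₐ[R] MvPowerSeries (ℕ ⊕ ℕ) R :=
  MvPowerSeries.renameEquiv R (σ.sumCongr τ)

/-- Symmetry in x and y separately is what later permits an expansion in monomial symmetric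
functions. -/
theorem blockSeries_symm (H : ℕ → R) (m : ℕ) (σ τ : Equiv.Perm ℕ) :
    permuteVars σ τ (blockSeries H m) = blockSeries H m := by
  ext e
  obtain ⟨e, rfl⟩ := (Finsupp.equivCongrLeft (M := ℕ) (σ.sumCongr τ)).surjective e
  rw [Finsupp.equivCongrLeft_apply, permuteVars, coeff_renameEquiv, coeff_blockSeries,
    coeff_blockSeries, coeff_pairSeries, coeff_pairSeries, xPart_equivMapDomain,
    yPart_equivMapDomain, degree_equivMapDomain, ← coeff_renameEquiv τ (rowSeries H (xPart e)),
    rowSeries_symm]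
  congr 2
  exact (prod_equivMapDomain σ (xPart e) (columnSeries H)).symm

/-- The values `∏ q ^ i / (q ^ (i + 1) - 1)`. -/
def nilRatio {K : Type*} [Field K] (q : K) (m : ℕ) : K :=
  ∏ i ∈ Finset.range m, (q ^ i / (q ^ (i + 1) - 1))

-- The flag formula is used twice. With the weight 1 it identifies the mass of the flag weight in
-- dimension s with `columnSeries`; with the flag weight itself, whose values are series in y, it
-- makes the coefficient of x^α the product of these masses.
open scoped Classical in
theorem finsum_box_flagSeries {k : Type u} [Field k] [Finite k] (m : ℕ) :
    (glCard k (Fin m → k) : ℚ)⁻¹ • ∑ᶠ A : Module.End k (Fin m → k),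
      (if IsNilpotent A then box (flagSeries A) (flagSeries A) else 0) =
      blockSeries (nilRatio (Nat.card k : ℚ)) m := by
  have hcol : ∀ s, (flagWeight k).nilMass (Fin s → k) =
      columnSeries (nilRatio (Nat.card k : ℚ)) s := by
    intro s
    ext β
    have h1 : MvPowerSeries.coeff β ((flagWeight k).nilSum (Fin s → k)) =
        (Weight.one k ℚ).flagSum β (Fin s → k) := by
      rw [Weight.nilSum, map_finsum_of_finite]
      refine finsum_congr fun A => ?_
      split_ifs
      · simp [flagWeight, Weight.one, coeff_flagSeries]
      · rw [map_zero]
    have h2 : MvPowerSeries.coeff β ((flagWeight k).nilMass (Fin s → k)) =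
        (glCard k (Fin s → k) : ℚ)⁻¹ * (Weight.one k ℚ).flagSum β (Fin s → k) := by
      rw [← h1]
      rfl
    rw [h2, coeff_columnSeries]
    split_ifs with h
    · rw [Weight.flagSum_eq _ _ _ (by rw [Module.finrank_fin_fun, ← h]; rfl), nsmul_eq_mul,
        inv_mul_cancel_left₀ (Nat.cast_ne_zero.2 glCard_pos.ne')]
      simp_rw [nilMass_one]
      rfl
    · rw [Weight.flagSum, finsum_congr (g := fun _ => 0), finsum_zero, mul_zero]
      intro A
      rw [flagCount_eq_zero _ _ (by rwa [Module.finrank_fin_fun]), zero_smul, ite_self]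
  ext e
  have h1 : MvPowerSeries.coeff e ((glCard k (Fin m → k) : ℚ)⁻¹ •
      ∑ᶠ A : Module.End k (Fin m → k),
      (if IsNilpotent A then box (flagSeries A) (flagSeries A) else 0)) =
      (glCard k (Fin m → k) : ℚ)⁻¹ * MvPowerSeries.coeff (yPart e)
        ((flagWeight k).flagSum (xPart e) (Fin m → k)) := by
    rw [MvPowerSeries.coeff_smul, map_finsum_of_finite, Weight.flagSum, map_finsum_of_finite]
    congr 1
    refine finsum_congr fun A => ?_
    split_ifs
    · rw [coeff_box, map_nsmul, nsmul_eq_mul]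
      rfl
    · rw [map_zero, map_zero]
  rw [h1, coeff_blockSeries]
  split_ifs with h
  · rw [Weight.flagSum_eq _ _ _ (by rw [Module.finrank_fin_fun, ← h]; rfl), map_nsmul, nsmul_eq_mul,
      inv_mul_cancel_left₀ (Nat.cast_ne_zero.2 glCard_pos.ne')]
    simp_rw [hcol]
    rfl
  · rw [Weight.flagSum, finsum_congr (g := fun _ => 0), finsum_zero, map_zero, mul_zero]
    intro A
    rw [flagCount_eq_zero _ _ (by rwa [Module.finrank_fin_fun]), zero_smul, ite_self]

end Block

/-! ### Averaging the flag series over strictly block triangular matrices -/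

section MultiBlock

/-- The generating series of stable flags of a matrix. -/
def matrixSeries {k : Type*} [Field k] {ι : Type*} [Fintype ι] (A : Matrix ι ι k) :
    MvPowerSeries ℕ ℚ := flagSeries A.mulVecLin

theorem flagSeries_conj {k V V' : Type*} [Field k] [AddCommGroup V] [Module k V] [AddCommGroup V']
    [Module k V'] (e : V ≃ₗ[k] V') {A : Module.End k V} {A' : Module.End k V'}
    (h : ∀ v, e (A v) = A' (e v)) : flagSeries A = flagSeries A' := by
  ext α
  rw [coeff_flagSeries, coeff_flagSeries, flagCount_conj e h]

theorem matrixSeries_submatrix {k : Type*} [Field k] {ι κ : Type*} [Fintype ι] [Fintype κ]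
    (e : ι ≃ κ) (A : Matrix κ κ k) : matrixSeries (A.submatrix e e) = matrixSeries A := by
  refine flagSeries_conj (LinearEquiv.funCongrLeft k k e.symm) fun v => ?_
  funext i
  have h := congrFun (Matrix.submatrix_mulVec_equiv A v e e) (e.symm i)
  rw [Function.comp_apply, e.apply_symm_apply] at h
  exact h

/-- Strictly block triangular matrices with respect to a grading of the indices. -/
def strictBlocks (k : Type*) [Field k] {ι : Type*} (μ : ι → ℤ) : AddSubgroup (Matrix ι ι k) where
  carrier := {N | ∀ i j, μ i ≤ μ j → N i j = 0}
  add_mem' h h' i j hij := by rw [Matrix.add_apply, h i j hij, h' i j hij, add_zero]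
  zero_mem' _ _ _ := rfl
  neg_mem' h i j hij := by rw [Matrix.neg_apply, h i j hij, neg_zero]

instance {k : Type*} [Finite k] {ι κ : Type*} [Finite ι] [Finite κ] : Finite (Matrix ι κ k) :=
  inferInstanceAs (Finite (ι → κ → k))

/-- Functions on the index set as pairs of functions on a part and its complement. -/
def splitPi (k : Type*) [Field k] {ι : Type*} (p : ι → Prop) [DecidablePred p] :
    (ι → k) ≃ₗ[k] ({i // p i} → k) × ({i // ¬ p i} → k) :=
  { Equiv.piEquivPiSubtypeProd p (fun _ => k) with
    map_add' := fun _ _ => rfl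
    map_smul' := fun _ _ => rfl }

theorem matrixSeries_eq_triangular {k : Type*} [Field k] {ι : Type*} [Fintype ι] (p : ι → Prop)
    [DecidablePred p] (A : Matrix ι ι k) (h : ∀ i j, ¬ p i → p j → A i j = 0) :
    matrixSeries A = flagSeries (triangular
      (A.submatrix (Subtype.val : {i // p i} → ι) (Subtype.val : {i // p i} → ι)).mulVecLin
      (A.submatrix (Subtype.val : {i // p i} → ι) (Subtype.val : {i // ¬ p i} → ι)).mulVecLin
      (A.submatrix (Subtype.val : {i // ¬ p i} → ι) (Subtype.val : {i // ¬ p i} → ι)).mulVecLin) :=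
        by
  refine flagSeries_conj (splitPi k p) fun v => Prod.ext ?_ ?_
  · funext i
    exact (Fintype.sum_subtype_add_sum_subtype p (fun j => A i j * v j)).symm
  · funext i
    refine (Fintype.sum_subtype_add_sum_subtype p (fun j => A i j * v j)).symm.trans ?_
    rw [Finset.sum_eq_zero, zero_add]
    · rfl
    · intro j _
      rw [h i j i.2 j.2, zero_mul]

/-- Strictly block triangular matrices, split along the top degree. -/
def strictBlocksEquiv (k : Type*) [Field k] {ι : Type*} (μ : ι → ℤ) (v : ℤ) (hv : ∀ i, μ i ≤ v) :
    strictBlocks k μ ≃ Matrix {i // μ i = v} {i // ¬ μ i = v} k ×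
      strictBlocks k (fun i : {i // ¬ μ i = v} => μ i) where
  toFun N := (N.1.submatrix Subtype.val Subtype.val,
    ⟨N.1.submatrix Subtype.val Subtype.val, fun i j hij => N.2 i j hij⟩)
  invFun p := ⟨fun i j => if hj : μ j = v then 0 else if hi : μ i = v then p.1 ⟨i, hi⟩ ⟨j, hj⟩
    else p.2.1 ⟨i, hi⟩ ⟨j, hj⟩, by
      intro i j hij
      dsimp only
      split_ifs with h1 h2
      · rfl
      · exact absurd (le_antisymm (hv j) (h2 ▸ hij)) h1
      · exact p.2.2 _ _ hij⟩
  left_inv N := by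
    ext i j
    simp only [Matrix.submatrix_apply]
    split_ifs with h1 h2
    · exact (N.2 i j (h1 ▸ hv i)).symm
    · rfl
    · rfl
  right_inv p := by
    refine Prod.ext ?_ (Subtype.ext ?_)
    · ext i j
      exact (dif_neg j.2).trans (dif_pos i.2)
    · ext i j
      exact (dif_neg j.2).trans (dif_neg i.2)

/-- Induction on the size, splitting off the coordinates of the highest degree v. They span an
invariant subspace, and the average over the block that maps the other coordinates into it separates
the factor of v; the rest is the same problem with fewer coordinates. -/
theorem finsum_strictBlocks {k : Type u} [Field k] [Finite k] (c : ℕ) :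
    ∀ {ι : Type} [Fintype ι] [DecidableEq ι] (μ : ι → ℤ) (A : Matrix ι ι k),
    Fintype.card ι = c → (∀ i j, μ i < μ j → A i j = 0) →
    ∑ᶠ N : strictBlocks k μ, matrixSeries (A + N.1) = Nat.card (strictBlocks k μ) •
      ∏ v ∈ Finset.univ.image μ, matrixSeries
        (A.submatrix (Subtype.val : {i // μ i = v} → ι) (Subtype.val : {i // μ i = v} → ι)) := by
  classical
  induction c using Nat.strong_induction_on with
  | _ c ih =>
  intro ι _ _ μ A hc hA
  rcases isEmpty_or_nonempty ι with hι | hι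
  · rw [← finsum_const_eq]
    refine finsum_congr fun N => ?_
    rw [Finset.univ_eq_empty, Finset.image_empty, Finset.prod_empty]
    exact (flagWeight k).of_subsingleton _
  · obtain ⟨i₀, hi₀⟩ := Finite.exists_max μ
    set v := μ i₀ with hv
    let ν : {i // ¬ μ i = v} → ℤ := fun i => μ i
    let D : Matrix {i // ¬ μ i = v} {i // ¬ μ i = v} k := A.submatrix Subtype.val Subtype.val
    let B : Matrix {i // μ i = v} {i // μ i = v} k := A.submatrix Subtype.val Subtype.val
    have hD : ∑ᶠ N : strictBlocks k ν, matrixSeries (D + N.1) = Nat.card (strictBlocks k ν) •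
        ∏ w ∈ Finset.univ.image ν, matrixSeries
        (D.submatrix (Subtype.val : {i // ν i = w} → _) (Subtype.val : {i // ν i = w} → _)) := by
      refine ih _ ?_ ν D rfl fun i j hij => hA i j hij
      rw [← hc]
      exact Fintype.card_subtype_lt (x := i₀) (not_not.2 rfl)
    have hN : ∀ N : strictBlocks k μ, matrixSeries (A + N.1) = flagSeries (triangular B.mulVecLin
        (A.submatrix (Subtype.val : {i // μ i = v} → ι) (Subtype.val : {i // ¬ μ i = v} → ι) +
        (strictBlocksEquiv k μ v hi₀ N).1).mulVecLin
        (D + (strictBlocksEquiv k μ v hi₀ N).2.1).mulVecLin) := by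
      intro N
      rw [matrixSeries_eq_triangular (fun i => μ i = v)]
      · congr 2
        congr 1
        ext i j
        rw [Matrix.submatrix_apply, Matrix.add_apply, N.2 i j (by rw [i.2, j.2]), add_zero]
        rfl
      · intro i j hi hj
        rw [Matrix.add_apply, hA i j (hj ▸ lt_of_le_of_ne (hi₀ i) hi), N.2 i j (hj ▸ hi₀ i),
          add_zero]
    have himg : Finset.univ.image μ = insert v (Finset.univ.image ν) := by
      ext w
      simp only [Finset.mem_image, Finset.mem_univ, true_and, Finset.mem_insert]
      constructor
      · rintro ⟨i, rfl⟩
        by_cases hi : μ i = v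
        · exact Or.inl hi
        · exact Or.inr ⟨⟨i, hi⟩, rfl⟩
      · rintro (rfl | ⟨i, rfl⟩)
        · exact ⟨i₀, rfl⟩
        · exact ⟨i, rfl⟩
    have hnot : v ∉ Finset.univ.image ν := by
      intro h
      obtain ⟨i, -, hi⟩ := Finset.mem_image.1 h
      exact i.2 hi
    rw [himg, Finset.prod_insert hnot, finsum_congr hN, finsum_comp_equiv
      (strictBlocksEquiv k μ v hi₀) (f := fun p => flagSeries (triangular B.mulVecLin
        (A.submatrix (Subtype.val : {i // μ i = v} → ι) (Subtype.val : {i // ¬ μ i = v} → ι) +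
        p.1).mulVecLin (D + p.2.1).mulVecLin)), finsum_prod, finsum_swap,
      Nat.card_congr (strictBlocksEquiv k μ v hi₀), Nat.card_prod]
    have hC : ∀ N : strictBlocks k ν, ∑ᶠ C : Matrix {i // μ i = v} {i // ¬ μ i = v} k,
        flagSeries (triangular B.mulVecLin
        (A.submatrix (Subtype.val : {i // μ i = v} → ι) (Subtype.val : {i // ¬ μ i = v} → ι) +
        C).mulVecLin (D + N.1).mulVecLin) =
        (Nat.card (Matrix {i // μ i = v} {i // ¬ μ i = v} k) • matrixSeries B) *
          matrixSeries (D + N.1) := by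
      intro N
      -- Translation by the off-diagonal block of `A` does not affect a sum over all matrices.
      let e : Matrix {i // μ i = v} {i // ¬ μ i = v} k ≃
          (({i // ¬ μ i = v} → k) →ₗ[k] ({i // μ i = v} → k)) :=
        (Equiv.addLeft (A.submatrix (Subtype.val : {i // μ i = v} → ι)
          (Subtype.val : {i // ¬ μ i = v} → ι))).trans Matrix.toLin'.toEquiv
      have h1 := (flagWeight k).extension B.mulVecLin (D + N.1).mulVecLin
      rw [← finsum_comp_equiv e, ← Nat.card_congr e, ← smul_mul_assoc] at h1
      exact h1
    rw [finsum_congr hC, mul_finsum_of_finite, hD, mul_smul, smul_mul_assoc, mul_smul_comm]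
    congr 3
    refine Finset.prod_congr rfl fun w hw => ?_
    have hwv : w ≠ v := fun h => hnot (h ▸ hw)
    let e : {i : {i // ¬ μ i = v} // ν i = w} ≃ {i // μ i = w} :=
      { toFun := fun i => ⟨i.1.1, i.2⟩
        invFun := fun i => ⟨⟨i.1, fun h => hwv (i.2 ▸ h)⟩, i.2⟩
        left_inv := fun _ => rfl
        right_inv := fun _ => rfl }
    rw [← matrixSeries_submatrix e]
    rfl

end MultiBlock

/-! ### Ring homomorphisms with nil kernel -/

section NilKernel

variable {R S : Type*} [Ring R] [Ring S] (f : R →+* S)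

theorem isNilpotent_iff_of_nil_kernel (hker : ∀ x, f x = 0 → IsNilpotent x) (x : R) :
    IsNilpotent x ↔ IsNilpotent (f x) := by
  refine ⟨fun h => h.map f, fun ⟨n, hn⟩ => ?_⟩
  obtain ⟨m, hm⟩ := hker (x ^ n) (by rw [map_pow, hn])
  exact ⟨n * m, by rw [pow_mul, hm]⟩

theorem isUnit_iff_of_nil_kernel (hsurj : Function.Surjective f)
    (hker : ∀ x, f x = 0 → IsNilpotent x) (x : R) : IsUnit x ↔ IsUnit (f x) := by
  refine ⟨fun h => h.map f, fun h => ?_⟩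
  obtain ⟨⟨a, b, hab, hba⟩, rfl : a = f x⟩ := h
  obtain ⟨y, rfl⟩ := hsurj b
  -- Elements over 1 are unipotent, hence units; lifting an inverse of `f x` gives an element `y`
  -- with `x * y` and `y * x` of this kind.
  have key : ∀ z, f z = 1 → IsUnit z := by
    intro z hz
    have := (hker (z - 1) (by rw [map_sub, hz, map_one, sub_self])).isUnit_add_one
    rwa [sub_add_cancel] at this
  have h1 := key (x * y) (by rw [map_mul, hab])
  have h2 := key (y * x) (by rw [map_mul, hba])
  obtain ⟨u, hu⟩ := h1
  obtain ⟨w, hw⟩ := h2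
  rw [isUnit_iff_exists_and_exists]
  exact ⟨⟨y * u⁻¹, by rw [← mul_assoc, ← hu, Units.mul_inv]⟩,
    ⟨w⁻¹ * y, by rw [mul_assoc, ← hw, Units.inv_mul]⟩⟩

theorem card_fiber_addMonoidHom {A B : Type*} [AddGroup A] [AddGroup B] (f : A →+ B)
    (hf : Function.Surjective f) (b : B) : Nat.card {a // f a = b} = Nat.card f.ker := by
  obtain ⟨a₀, rfl⟩ := hf b
  exact Nat.card_congr
    { toFun := fun a => ⟨a.1 - a₀, by rw [AddMonoidHom.mem_ker, map_sub, a.2, sub_self]⟩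
      invFun := fun a => ⟨a.1 + a₀, by rw [map_add, AddMonoidHom.mem_ker.1 a.2, zero_add]⟩
      left_inv := fun a => by simp
      right_inv := fun a => by simp }

end NilKernel

/-! ### Global sections of the adjoint bundle of `E_μ` -/

section Sections

variable {k : Type*} [Field k]

/-- The coefficient of a polynomial at an integer. -/
def intCoeff (p : Polynomial k) (n : ℤ) : k := (res0 k p).coeff n

theorem intCoeff_natCast (p : Polynomial k) (n : ℕ) : intCoeff p n = p.coeff n := by
  change (Polynomial.toLaurent p).coeff _ = _
  rw [LaurentPolynomial.coeff_toLaurent]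
  exact Finsupp.mapDomain_apply Nat.cast_injective _ n

theorem intCoeff_of_neg (p : Polynomial k) {n : ℤ} (h : n < 0) : intCoeff p n = 0 := by
  change (Polynomial.toLaurent p).coeff _ = _
  rw [LaurentPolynomial.coeff_toLaurent]
  refine Finsupp.mapDomain_of_notMem_range _ _ ?_
  rintro ⟨m, hm⟩
  have : (m : ℤ) = n := hm
  omega

theorem intCoeff_ext {p q : Polynomial k} (h : ∀ n, intCoeff p n = intCoeff q n) : p = q := by
  ext n
  rw [← intCoeff_natCast, ← intCoeff_natCast, h]

theorem intCoeff_zero (n : ℤ) : intCoeff (0 : Polynomial k) n = 0 := by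
  rw [intCoeff, map_zero]
  rfl

theorem coeff_T_mul (f : k[T;T⁻¹]) (m n : ℤ) :
    (LaurentPolynomial.T m * f).coeff n = f.coeff (n - m) := by
  rw [LaurentPolynomial.T, AddMonoidAlgebra.coeff_single_mul_eq_mul_coeff (n - m), one_mul]
  intro a _
  omega

theorem coeff_resInf (p : Polynomial k) (n : ℤ) : (resInf k p).coeff n = intCoeff p (-n) :=
  LaurentPolynomial.invert_apply _ _

theorem coe_cocycleO1_zpow (m : ℤ) :
    ((cocycleO1 k ^ m : (k[T;T⁻¹])ˣ) : k[T;T⁻¹]) = LaurentPolynomial.T (-m) := by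
  have hT : ∀ a : ℕ, ((cocycleO1 k : (k[T;T⁻¹])ˣ) : k[T;T⁻¹]) ^ a =
      LaurentPolynomial.T (-(a : ℤ)) := by
    intro a
    change (LaurentPolynomial.T (-1) : k[T;T⁻¹]) ^ a = _
    rw [LaurentPolynomial.T_pow]
    simp
  have hT' : ∀ a : ℕ, (((cocycleO1 k)⁻¹ : (k[T;T⁻¹])ˣ) : k[T;T⁻¹]) ^ a =
      LaurentPolynomial.T (a : ℤ) := by
    intro a
    change (LaurentPolynomial.T 1 : k[T;T⁻¹]) ^ a = _
    rw [LaurentPolynomial.T_pow]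
    simp
  obtain ⟨a, rfl | rfl⟩ := m.eq_nat_or_neg
  · rw [zpow_natCast, Units.val_pow_eq_pow_val, hT]
  · rw [zpow_neg, zpow_natCast, ← inv_pow, Units.val_pow_eq_pow_val, hT', neg_neg]

variable {n : ℕ} {μ : Fin n → ℤ}

/-- The transition matrix is diagonal, so gluing is a condition on each entry: the (i, j) entry is a
section of 𝒪(μ_i − μ_j), with z^b on one chart corresponding to w^a on the other. Indexing
coefficients by ℤ encodes the degree bound, since negative indices give 0. -/
theorem mem_adSections_bundleOf
    (A : Matrix (Fin n) (Fin n) (Polynomial k) × Matrix (Fin n) (Fin n) (Polynomial k)) :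
    A ∈ (bundleOf k μ).adSections ↔
      ∀ i j a b, a + b = μ i - μ j → intCoeff (A.2 i j) a = intCoeff (A.1 i j) b := by
  have hg : ((bundleOf k μ).transition : Matrix (Fin n) (Fin n) k[T;T⁻¹]) =
      Matrix.diagonal fun i => LaurentPolynomial.T (-(μ i)) := by
    change (Matrix.diagonal fun i => ((cocycleO1 k ^ μ i : (k[T;T⁻¹])ˣ) : k[T;T⁻¹])) = _
    simp_rw [coe_cocycleO1_zpow]
  change A.2.map (resInf k) = (((bundleOf k μ).transition : Matrix (Fin n) (Fin n) k[T;T⁻¹]) *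
    A.1.map (res0 k)) * _ ↔ _
  rw [Units.eq_mul_inv_iff_mul_eq, hg, ← Matrix.ext_iff]
  refine forall_congr' fun i => forall_congr' fun j => ?_
  rw [Matrix.mul_diagonal, Matrix.diagonal_mul, Matrix.map_apply, Matrix.map_apply,
    ← LaurentPolynomial.T_mul]
  constructor
  · intro h a b hab
    have h1 := congrArg (fun f => AddMonoidAlgebra.coeff f (-μ j - a)) h
    simp only [coeff_T_mul, coeff_resInf] at h1
    rw [show -(-μ j - a - -μ j) = a by ring, show -μ j - a - -μ i = b by linarith] at h1
    exact h1
  · intro h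
    apply LaurentPolynomial.ext
    intro m
    rw [coeff_T_mul, coeff_T_mul, coeff_resInf]
    exact h _ _ (by ring)

variable (Ψ : (bundleOf k μ).adSections)

theorem section_intCoeff (i j : Fin n) {a b : ℤ} (h : a + b = μ i - μ j) :
    intCoeff (Ψ.1.2 i j) a = intCoeff (Ψ.1.1 i j) b :=
  (mem_adSections_bundleOf Ψ.1).1 Ψ.2 i j a b h

theorem section_eq_zero {i j : Fin n} (h : μ i < μ j) : Ψ.1.1 i j = 0 ∧ Ψ.1.2 i j = 0 := by
  constructor
  · refine intCoeff_ext fun b => ?_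
    rw [intCoeff_zero]
    rcases lt_or_ge b 0 with hb | hb
    · exact intCoeff_of_neg _ hb
    · rw [← section_intCoeff Ψ i j (a := μ i - μ j - b) (by ring), intCoeff_of_neg _ (by omega)]
  · refine intCoeff_ext fun a => ?_
    rw [intCoeff_zero]
    rcases lt_or_ge a 0 with ha | ha
    · exact intCoeff_of_neg _ ha
    · rw [section_intCoeff Ψ i j (b := μ i - μ j - a) (by ring), intCoeff_of_neg _ (by omega)]

theorem at0_apply (i j : Fin n) : (bundleOf k μ).at0 Ψ i j = intCoeff (Ψ.1.1 i j) 0 := by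
  have := intCoeff_natCast (Ψ.1.1 i j) 0
  rw [Nat.cast_zero] at this
  rw [this, Polynomial.coeff_zero_eq_eval_zero]
  rfl

theorem atInf_apply (i j : Fin n) : (bundleOf k μ).atInf Ψ i j = intCoeff (Ψ.1.2 i j) 0 := by
  have := intCoeff_natCast (Ψ.1.2 i j) 0
  rw [Nat.cast_zero] at this
  rw [this, Polynomial.coeff_zero_eq_eval_zero]
  rfl

theorem at0_eq_zero {i j : Fin n} (h : μ i < μ j) : (bundleOf k μ).at0 Ψ i j = 0 := by
  rw [at0_apply, (section_eq_zero Ψ h).1, intCoeff_zero]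

theorem atInf_eq_zero {i j : Fin n} (h : μ i < μ j) : (bundleOf k μ).atInf Ψ i j = 0 := by
  rw [atInf_apply, (section_eq_zero Ψ h).2, intCoeff_zero]

theorem atInf_eq_at0 {i j : Fin n} (h : μ i = μ j) :
    (bundleOf k μ).atInf Ψ i j = (bundleOf k μ).at0 Ψ i j := by
  rw [at0_apply, atInf_apply, section_intCoeff Ψ i j (b := 0) (by rw [h]; ring)]

/-- Between summands of equal degree a section is a constant, so its value at 0 determines it on
both charts. -/
theorem section_eq_zero_of_eq {i j : Fin n} (h : μ i = μ j) (h0 : (bundleOf k μ).at0 Ψ i j = 0) :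
    Ψ.1.1 i j = 0 ∧ Ψ.1.2 i j = 0 := by
  have hi := atInf_eq_at0 Ψ h
  rw [h0, atInf_apply] at hi
  rw [at0_apply] at h0
  constructor
  · refine intCoeff_ext fun b => ?_
    rw [intCoeff_zero]
    rcases lt_trichotomy b 0 with hb | rfl | hb
    · exact intCoeff_of_neg _ hb
    · exact h0
    · rw [← section_intCoeff Ψ i j (a := μ i - μ j - b) (by ring), intCoeff_of_neg _ (by omega)]
  · refine intCoeff_ext fun a => ?_
    rw [intCoeff_zero]
    rcases lt_trichotomy a 0 with ha | rfl | ha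
    · exact intCoeff_of_neg _ ha
    · exact hi
    · rw [section_intCoeff Ψ i j (b := μ i - μ j - a) (by ring), intCoeff_of_neg _ (by omega)]

theorem pow_eq_zero_of_strict {R : Type*} [CommRing R] {A : Matrix (Fin n) (Fin n) R}
    (h : ∀ i j, μ i ≤ μ j → A i j = 0) (m : ℕ) :
    ∀ i j, μ i < μ j + m → (A ^ m) i j = 0 := by
  induction m with
  | zero =>
    intro i j hij
    have : i ≠ j := by
      rintro rfl
      simp at hij
    rw [pow_zero, Matrix.one_apply_ne this]
  | succ m ih =>
    intro i j hij
    rw [pow_succ, Matrix.mul_apply]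
    refine Finset.sum_eq_zero fun l _ => ?_
    rcases le_or_gt (μ l) (μ j) with hl | hl
    · rw [h l j hl, mul_zero]
    · rw [ih i l (by push_cast at hij; omega), zero_mul]

theorem exists_forall_lt_add_natCast (μ : Fin n → ℤ) : ∃ m : ℕ, ∀ i j, μ i < μ j + m := by
  -- Any number above all differences of degrees will do; it bounds the nilpotency order and also
  -- the degrees of the polynomial entries.
  refine ⟨(∑ i, |μ i|).toNat + (∑ i, |μ i|).toNat + 1, fun i j => ?_⟩
  have hi := Finset.single_le_sum (f := fun i => |μ i|) (fun i _ => abs_nonneg _)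
    (Finset.mem_univ i)
  have hj := Finset.single_le_sum (f := fun i => |μ i|) (fun i _ => abs_nonneg _)
    (Finset.mem_univ j)
  have := le_abs_self (μ i)
  have := neg_abs_le (μ j)
  have := Int.self_le_toNat (∑ i, |μ i|)
  push_cast
  linarith

/-- If the constant blocks vanish, Ψ strictly raises the degree of the summands, so both chart
matrices are strictly triangular. -/
theorem isNilpotent_section (h : ∀ i j, μ i = μ j → (bundleOf k μ).at0 Ψ i j = 0) :
    IsNilpotent Ψ := by
  have h0 : ∀ i j, μ i ≤ μ j → Ψ.1.1 i j = 0 ∧ Ψ.1.2 i j = 0 := by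
    intro i j hij
    rcases hij.lt_or_eq with hlt | heq
    · exact section_eq_zero Ψ hlt
    · exact section_eq_zero_of_eq Ψ heq (h i j heq)
  obtain ⟨m, hm⟩ := exists_forall_lt_add_natCast μ
  refine ⟨m, Subtype.ext (Prod.ext ?_ ?_)⟩
  · ext1 i j
    exact pow_eq_zero_of_strict (fun i j hij => (h0 i j hij).1) m i j (hm i j)
  · ext1 i j
    exact pow_eq_zero_of_strict (fun i j hij => (h0 i j hij).2) m i j (hm i j)

instance [Finite k] : Finite (bundleOf k μ).adSections := by
  obtain ⟨m, hm⟩ := exists_forall_lt_add_natCast μ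
  refine Finite.of_injective (fun Ψ : (bundleOf k μ).adSections => fun i j (b : Fin m) =>
    (Ψ.1.1 i j).coeff b) ?_
  intro Ψ Φ h
  have h1 : ∀ i j (b : ℕ), (Ψ.1.1 i j).coeff b = (Φ.1.1 i j).coeff b := by
    intro i j b
    by_cases hb : b < m
    · exact congrFun (congrFun (congrFun h i) j) ⟨b, hb⟩
    · have := hm i j
      rw [← intCoeff_natCast, ← intCoeff_natCast,
        ← section_intCoeff Ψ i j (a := μ i - μ j - b) (by ring),
        ← section_intCoeff Φ i j (a := μ i - μ j - b) (by ring),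
        intCoeff_of_neg _ (by omega), intCoeff_of_neg _ (by omega)]
  have h2 : ∀ i j, Ψ.1.1 i j = Φ.1.1 i j := fun i j => Polynomial.ext (h1 i j)
  refine Subtype.ext (Prod.ext ?_ ?_)
  · ext1 i j
    exact h2 i j
  · ext1 i j
    refine intCoeff_ext fun a => ?_
    rw [section_intCoeff Ψ i j (b := μ i - μ j - a) (by ring),
      section_intCoeff Φ i j (b := μ i - μ j - a) (by ring), h2]

/-- A section of 𝒪(d) with d ≥ 1 can be given arbitrary values at 0 and ∞; this is the independence
of the two strictly triangular parts. For d = 0 the two values must agree, for d < 0 they must be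
zero. -/
theorem exists_section (a b : Matrix (Fin n) (Fin n) k)
    (h : ∀ i j, μ i ≤ μ j → a i j = b i j) (h0 : ∀ i j, μ i < μ j → a i j = 0) :
    ∃ Ψ : (bundleOf k μ).adSections, (bundleOf k μ).at0 Ψ = a ∧ (bundleOf k μ).atInf Ψ = b := by
  -- In degree d = μ i − μ j ≥ 1 the section is x + y z^d, which on the other chart reads y + x w^d;
  -- hence the roles of `a` and `b` are exchanged there.
  let p : Fin n → Fin n → k → k → Polynomial k := fun i j x y =>
    Polynomial.C x + if μ j < μ i then Polynomial.monomial (μ i - μ j).toNat y else 0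
  have hp0 : ∀ i j x y, (p i j x y).eval 0 = x := by
    intro i j x y
    simp only [p]
    split_ifs with hij
    · have : (μ i - μ j).toNat ≠ 0 := by omega
      simp [this]
    · simp
  have hp : ∀ i j x y (m : ℤ), μ j < μ i → intCoeff (p i j x y) m =
      (if m = 0 then x else 0) + if m = μ i - μ j then y else 0 := by
    intro i j x y m hij
    rcases lt_or_ge m 0 with hm | hm
    · rw [intCoeff_of_neg _ hm, if_neg (by omega), if_neg (by omega), add_zero]
    · lift m to ℕ using hm
      rw [intCoeff_natCast]
      simp only [p]
      rw [if_pos hij, Polynomial.coeff_add, Polynomial.coeff_C, Polynomial.coeff_monomial]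
      congr 1
      · simp
      · exact if_congr (by omega) rfl rfl
  have hp' : ∀ i j x y (m : ℤ), ¬ μ j < μ i → intCoeff (p i j x y) m = if m = 0 then x else 0 := by
    intro i j x y m hij
    rcases lt_or_ge m 0 with hm | hm
    · rw [intCoeff_of_neg _ hm, if_neg (by omega)]
    · lift m to ℕ using hm
      rw [intCoeff_natCast]
      simp only [p]
      rw [if_neg hij, add_zero, Polynomial.coeff_C]
      simp
  refine ⟨⟨(Matrix.of fun i j => p i j (a i j) (b i j), Matrix.of fun i j => p i j (b i j) (a i j)),
    ?_⟩, ?_, ?_⟩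
  · rw [mem_adSections_bundleOf]
    intro i j m l hml
    simp only [Matrix.of_apply]
    rcases lt_trichotomy (μ i) (μ j) with hij | hij | hij
    · rw [hp' _ _ _ _ _ (by omega), hp' _ _ _ _ _ (by omega), ← h i j hij.le, h0 i j hij]
      simp
    · rw [hp' _ _ _ _ _ (by omega), hp' _ _ _ _ _ (by omega), ← h i j hij.le]
      exact if_congr (by omega) rfl rfl
    · rw [hp _ _ _ _ _ hij, hp _ _ _ _ _ hij, add_comm]
      congr 1
      · exact if_congr (by omega) rfl rfl
      · exact if_congr (by omega) rfl rfl
  · ext i j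
    exact hp0 _ _ _ _
  · ext i j
    exact hp0 _ _ _ _

end Sections

/-! ### Factorization of the weighted count over the degrees of the summands -/

section Levi

variable {k : Type*} [Field k] {n : ℕ} (μ : Fin n → ℤ)

/-- Block diagonal matrices with respect to a grading of the indices. -/
abbrev Levi (k : Type*) [Field k] {n : ℕ} (μ : Fin n → ℤ) : Type _ :=
  (v : {v // v ∈ Finset.univ.image μ}) → Matrix {i // μ i = v.1} {i // μ i = v.1} k

instance [Finite k] : Finite (Levi k μ) := Pi.finite

variable {μ}

/-- The matrix with given diagonal blocks. -/
def leviMatrix (B : Levi k μ) : Matrix (Fin n) (Fin n) k := fun i j =>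
  if h : μ i = μ j then
    B ⟨μ j, Finset.mem_image_of_mem _ (Finset.mem_univ j)⟩ ⟨i, h⟩ ⟨j, rfl⟩ else 0

theorem leviMatrix_of_ne (B : Levi k μ) {i j : Fin n} (h : μ i ≠ μ j) : leviMatrix B i j = 0 :=
  dif_neg h

theorem leviMatrix_submatrix (B : Levi k μ) (v : {v // v ∈ Finset.univ.image μ}) :
    (leviMatrix B).submatrix (Subtype.val : {i // μ i = v.1} → Fin n) Subtype.val = B v := by
  have h : ∀ v (hv : v ∈ Finset.univ.image μ) (i j : Fin n) (hi : μ i = v) (hj : μ j = v),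
      leviMatrix B i j = B ⟨v, hv⟩ ⟨i, hi⟩ ⟨j, hj⟩ := by
    rintro _ _ i j hi rfl
    exact dif_pos hi
  ext i j
  exact h v.1 v.2 i j i.2 j.2

/-- The fibre at `0` as a ring homomorphism. -/
def at0Hom (E : Bundle k n) : E.adSections →+* Matrix (Fin n) (Fin n) k :=
  ((Polynomial.evalRingHom (0 : k)).mapMatrix).comp ((RingHom.fst _ _).comp
    E.adSections.val.toRingHom)

theorem at0Hom_apply (E : Bundle k n) (Ψ : E.adSections) : at0Hom E Ψ = E.at0 Ψ := rfl

/-- The fibre at `∞` as a ring homomorphism. -/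
def atInfHom (E : Bundle k n) : E.adSections →+* Matrix (Fin n) (Fin n) k :=
  ((Polynomial.evalRingHom (0 : k)).mapMatrix).comp ((RingHom.snd _ _).comp
    E.adSections.val.toRingHom)

/-- The diagonal blocks of a section of the adjoint bundle. -/
def leviHom (k : Type*) [Field k] (μ : Fin n → ℤ) : (bundleOf k μ).adSections →+* Levi k μ where
  toFun Ψ v := ((bundleOf k μ).at0 Ψ).submatrix Subtype.val Subtype.val
  map_one' := by
    funext v
    rw [← at0Hom_apply, map_one]
    exact Matrix.submatrix_one _ Subtype.val_injective
  map_zero' := by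
    funext v
    rw [← at0Hom_apply, map_zero]
    rfl
  map_add' Ψ Φ := by
    funext v
    rw [← at0Hom_apply, map_add]
    rfl
  map_mul' Ψ Φ := by
    funext v
    ext i j
    have h : (bundleOf k μ).at0 (Ψ * Φ) = (bundleOf k μ).at0 Ψ * (bundleOf k μ).at0 Φ :=
      map_mul (at0Hom _) Ψ Φ
    change (bundleOf k μ).at0 (Ψ * Φ) i j = ∑ l : {l // μ l = v.1},
      (bundleOf k μ).at0 Ψ i l * (bundleOf k μ).at0 Φ l j
    -- A path from degree v back to v through another degree would have to lower the degree at one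
    -- of its two steps, where sections vanish; so taking diagonal blocks is multiplicative.
    rw [h, Matrix.mul_apply, ← Fintype.sum_subtype_add_sum_subtype (fun l => μ l = v.1)]
    refine add_eq_left.2 (Finset.sum_eq_zero fun l _ => ?_)
    rcases lt_or_gt_of_ne l.2 with h | h
    · rw [at0_eq_zero Φ (by rwa [j.2]), mul_zero]
    · rw [at0_eq_zero Ψ (by rwa [i.2]), zero_mul]

theorem isNilpotent_of_leviHom_eq_zero (Ψ : (bundleOf k μ).adSections) (h : leviHom k μ Ψ = 0) :
    IsNilpotent Ψ := by
  refine isNilpotent_section Ψ fun i j hij => ?_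
  have := congrFun h ⟨μ j, Finset.mem_image_of_mem _ (Finset.mem_univ j)⟩
  exact congrFun (congrFun this ⟨i, hij⟩) ⟨j, rfl⟩

/-- The strictly block triangular part of a matrix. -/
def strictPart (k : Type*) [Field k] (μ : Fin n → ℤ) :
    Matrix (Fin n) (Fin n) k →+ strictBlocks k μ where
  toFun M := ⟨fun i j => if μ i ≤ μ j then 0 else M i j, fun i j h => if_pos h⟩
  map_zero' := by
    ext i j
    exact ite_self (c := μ i ≤ μ j) (0 : k)
  map_add' M N := by
    ext i j
    change (if μ i ≤ μ j then 0 else M i j + N i j) =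
      (if μ i ≤ μ j then 0 else M i j) + (if μ i ≤ μ j then 0 else N i j)
    split_ifs
    · rw [add_zero]
    · rfl

theorem strictPart_apply (M : Matrix (Fin n) (Fin n) k) (i j : Fin n) :
    (strictPart k μ M).1 i j = if μ i ≤ μ j then 0 else M i j := rfl

/-- The diagonal blocks of a section together with its strictly block triangular parts at the
two points. -/
def fibreParts (k : Type*) [Field k] (μ : Fin n → ℤ) :
    (bundleOf k μ).adSections →+ Levi k μ × (strictBlocks k μ × strictBlocks k μ) :=
  (leviHom k μ).toAddMonoidHom.prod
    (((strictPart k μ).comp (at0Hom _).toAddMonoidHom).prod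
      ((strictPart k μ).comp (atInfHom _).toAddMonoidHom))

theorem at0_eq_leviMatrix_add (Ψ : (bundleOf k μ).adSections) :
    (bundleOf k μ).at0 Ψ = leviMatrix (fibreParts k μ Ψ).1 + (fibreParts k μ Ψ).2.1.1 := by
  ext i j
  have h1 : (fibreParts k μ Ψ).2.1.1 i j = if μ i ≤ μ j then 0 else (bundleOf k μ).at0 Ψ i j := rfl
  have h2 : leviMatrix (fibreParts k μ Ψ).1 i j =
    if μ i = μ j then (bundleOf k μ).at0 Ψ i j else 0 := rfl
  rw [Matrix.add_apply, h1, h2]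
  rcases lt_trichotomy (μ i) (μ j) with h | h | h
  · rw [at0_eq_zero Ψ h]
    simp
  · rw [if_pos h, if_pos h.le, add_zero]
  · rw [if_neg h.ne', if_neg h.not_ge, zero_add]

theorem atInf_eq_leviMatrix_add (Ψ : (bundleOf k μ).adSections) :
    (bundleOf k μ).atInf Ψ = leviMatrix (fibreParts k μ Ψ).1 + (fibreParts k μ Ψ).2.2.1 := by
  ext i j
  have h1 : (fibreParts k μ Ψ).2.2.1 i j =
    if μ i ≤ μ j then 0 else (bundleOf k μ).atInf Ψ i j := rfl
  have h2 : leviMatrix (fibreParts k μ Ψ).1 i j =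
    if μ i = μ j then (bundleOf k μ).at0 Ψ i j else 0 := rfl
  rw [Matrix.add_apply, h1, h2]
  rcases lt_trichotomy (μ i) (μ j) with h | h | h
  · rw [at0_eq_zero Ψ h, atInf_eq_zero Ψ h]
    simp
  · rw [if_pos h, if_pos h.le, add_zero, atInf_eq_at0 Ψ h]
  · rw [if_neg h.ne', if_neg h.not_ge, zero_add]

theorem fibreParts_surjective (k : Type*) [Field k] (μ : Fin n → ℤ) :
    Function.Surjective (fibreParts k μ) := by
  rintro ⟨B, N, N'⟩
  obtain ⟨Ψ, h0, hinf⟩ := exists_section (μ := μ) (leviMatrix B + N.1) (leviMatrix B + N'.1)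
    (fun i j hij => by rw [Matrix.add_apply, Matrix.add_apply, N.2 i j hij, N'.2 i j hij])
    (fun i j hij => by
      rw [Matrix.add_apply, N.2 i j hij.le, add_zero, leviMatrix_of_ne B hij.ne])
  have key : ∀ N : strictBlocks k μ, strictPart k μ (leviMatrix B + N.1) = N := by
    intro N
    ext i j
    rw [strictPart_apply]
    split_ifs with h
    · exact (N.2 i j h).symm
    · rw [Matrix.add_apply, leviMatrix_of_ne B (by omega), zero_add]
  refine ⟨Ψ, Prod.ext ?_ (Prod.ext ?_ ?_)⟩
  · funext v
    change ((bundleOf k μ).at0 Ψ).submatrix Subtype.val Subtype.val = B v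
    rw [h0]
    rw [← leviMatrix_submatrix B v]
    ext i j
    rw [Matrix.submatrix_apply, Matrix.add_apply, N.2 _ _ (by rw [i.2, j.2]), add_zero]
    rfl
  · change strictPart k μ ((bundleOf k μ).at0 Ψ) = N
    rw [h0, key]
  · change strictPart k μ ((bundleOf k μ).atInf Ψ) = N'
    rw [hinf, key]

theorem leviHom_surjective (k : Type*) [Field k] (μ : Fin n → ℤ) :
    Function.Surjective (leviHom k μ) := fun B => by
  obtain ⟨Ψ, h⟩ := fibreParts_surjective k μ (B, 0, 0)
  exact ⟨Ψ, congrArg Prod.fst h⟩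

variable [Finite k]

/-- The additive map to Levi and triangular parts is onto with fibres of constant size, so sums over
sections become three independent sums. -/
theorem finsum_sections {M : Type*} [AddCommMonoid M]
    (f : Levi k μ → strictBlocks k μ → strictBlocks k μ → M) :
    ∑ᶠ Ψ, f (fibreParts k μ Ψ).1 (fibreParts k μ Ψ).2.1 (fibreParts k μ Ψ).2.2 =
      Nat.card (fibreParts k μ).ker • ∑ᶠ B, ∑ᶠ N, ∑ᶠ N', f B N N' := by
  have h := finsum_comp_of_card_fiber (fibreParts k μ)
    (fun p => f p.1 p.2.1 p.2.2)
    (fun b => card_fiber_addMonoidHom (fibreParts k μ) (fibreParts_surjective k μ) b)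
  rw [h, finsum_prod]
  congr 1
  exact finsum_congr fun B => finsum_prod _

theorem card_units (R : Type*) [Monoid R] : Nat.card Rˣ = Nat.card {a : R // IsUnit a} :=
  Nat.card_congr
    { toFun := fun u => ⟨u, u.isUnit⟩
      invFun := fun a => a.2.unit
      left_inv := fun _ => Units.ext rfl
      right_inv := fun _ => rfl }

theorem card_matrix_units (k : Type*) [Field k] (ι : Type*) [Fintype ι] [DecidableEq ι] :
    Nat.card (Matrix ι ι k)ˣ = glCard k (ι → k) :=
  Nat.card_congr (Matrix.GeneralLinearGroup.toLin.trans
    (LinearMap.GeneralLinearGroup.generalLinearEquiv k (ι → k))).toEquiv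

/-- Invertibility depends on the Levi part only, so the same three sums count automorphisms. The
factors from the kernel and from the triangular parts are those of the nilpotent count and will
cancel. -/
theorem card_aut (k : Type*) [Field k] [Finite k] (μ : Fin n → ℤ) :
    Nat.card (bundleOf k μ).Aut = Nat.card (fibreParts k μ).ker *
      (Nat.card (strictBlocks k μ) * Nat.card (strictBlocks k μ)) *
        ∏ v ∈ Finset.univ.image μ, glCard k ({i // μ i = v} → k) := by
  classical
  have hu : Nat.card (Levi k μ)ˣ =
      ∏ v ∈ Finset.univ.image μ, glCard k ({i // μ i = v} → k) := by
    rw [Nat.card_congr MulEquiv.piUnits.toEquiv, Nat.card_pi,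
      ← Finset.prod_coe_sort (Finset.univ.image μ)]
    exact Finset.prod_congr rfl fun v _ => card_matrix_units _ _
  have h : ∀ Ψ : (bundleOf k μ).adSections, (if IsUnit Ψ then 1 else 0) =
      (fun (B : Levi k μ) (_ _ : strictBlocks k μ) => if IsUnit B then 1 else 0)
        (fibreParts k μ Ψ).1 (fibreParts k μ Ψ).2.1 (fibreParts k μ Ψ).2.2 := fun Ψ =>
    if_congr (isUnit_iff_of_nil_kernel (leviHom k μ) (leviHom_surjective k μ)
      isNilpotent_of_leviHom_eq_zero Ψ) rfl rfl
  have h2 := finsum_ite_eq_card (fun Ψ : (bundleOf k μ).adSections => IsUnit Ψ)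
  rw [finsum_congr h, finsum_sections
    (fun (B : Levi k μ) (_ _ : strictBlocks k μ) => if IsUnit B then 1 else 0)] at h2
  rw [card_units, ← h2, ← hu, card_units]
  simp only [finsum_const_eq, smul_eq_mul]
  rw [mul_finsum_of_finite, mul_finsum_of_finite, finsum_ite_eq_card]
  simp only [mul_assoc]

open scoped Classical in
/-- The generating series of pairs of stable flags of a nilpotent matrix. -/
def nilBox {k : Type*} [Field k] {ι : Type*} [Fintype ι] [DecidableEq ι] (B : Matrix ι ι k) :
    MvPowerSeries (ℕ ⊕ ℕ) ℚ :=
  if IsNilpotent B then box (matrixSeries B) (matrixSeries B) else 0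

theorem finsum_nilBox {k : Type u} [Field k] [Finite k] (ι : Type) [Fintype ι] [DecidableEq ι] :
    ∑ᶠ B : Matrix ι ι k, nilBox B =
      (glCard k (ι → k) : ℚ) • blockSeries (nilRatio (Nat.card k : ℚ)) (Fintype.card ι) := by
  let e := Fintype.equivFin ι
  let E : Matrix ι ι k ≃ₐ[k] Module.End k (Fin (Fintype.card ι) → k) :=
    (Matrix.reindexAlgEquiv k k e).trans Matrix.toLinAlgEquiv'
  have hpos : (glCard k (Fin (Fintype.card ι) → k) : ℚ) ≠ 0 := by
    exact_mod_cast (glCard_pos (k := k)).ne'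
  rw [← finsum_box_flagSeries, glCard_congr (LinearEquiv.funCongrLeft k k e.symm),
    smul_inv_smul₀ hpos, ← finsum_comp_equiv E.toEquiv]
  refine finsum_congr fun B => ?_
  have h1 : IsNilpotent (E.toEquiv B) ↔ IsNilpotent B :=
    IsNilpotent.map_iff (f := E) E.injective
  have h2 : flagSeries (E.toEquiv B) = matrixSeries B := matrixSeries_submatrix e.symm B
  rw [h2]
  classical
  exact if_congr h1.symm rfl rfl

theorem finsum_box {α β : Type*} [Finite α] [Finite β] {R : Type*} [CommRing R]
    (f : α → MvPowerSeries ℕ R) (g : β → MvPowerSeries ℕ R) :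
    ∑ᶠ a, ∑ᶠ b, box (f a) (g b) = box (∑ᶠ a, f a) (∑ᶠ b, g b) := by
  simp only [box]
  simp_rw [mul_finsum_of_finite, ← map_finsum_of_finite]
  rw [finsum_mul_of_finite, ← map_finsum_of_finite]

theorem nsmul_box_nsmul {R : Type*} [CommRing R] (m : ℕ) (f g : MvPowerSeries ℕ R) :
    box (m • f) (m • g) = (m * m) • box f g := by
  simp only [box, map_nsmul, smul_mul_smul_comm]

theorem finsum_prod_pi {ι : Type*} [Fintype ι] [DecidableEq ι] {α : ι → Type*} [∀ i, Finite (α i)]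
    {R : Type*} [CommSemiring R] (f : (i : ι) → α i → R) :
    ∑ᶠ a : (i : ι) → α i, ∏ i, f i (a i) = ∏ i, ∑ᶠ x, f i x := by
  have := fun i => Fintype.ofFinite (α i)
  simp only [finsum_eq_sum_of_fintype]
  rw [Finset.prod_univ_sum, Fintype.piFinset_univ]

open scoped Classical in
theorem finsum_strictBlocks_levi (k : Type u) [Field k] [Finite k] (μ : Fin n → ℤ) (B : Levi k μ) :
  (∑ᶠ (N : strictBlocks k μ) (N' : strictBlocks k μ),
    (if IsNilpotent B then
      box (matrixSeries (leviMatrix B + N.1)) (matrixSeries (leviMatrix B + N'.1)) else 0)) =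
    (Nat.card (strictBlocks k μ) * Nat.card (strictBlocks k μ)) •
      ∏ v, nilBox (B v) := by
  by_cases hB : IsNilpotent B
  · simp only [if_pos hB]
    rw [finsum_box, finsum_strictBlocks _ μ _ rfl fun i j hij => leviMatrix_of_ne B hij.ne,
      nsmul_box_nsmul, ← prod_box, ← Finset.prod_coe_sort (Finset.univ.image μ)]
    congr 1
    refine Finset.prod_congr rfl fun v _ => ?_
    have hv : IsNilpotent (B v) :=
      hB.map (Pi.evalRingHom (fun v : {v // v ∈ Finset.univ.image μ} =>
        Matrix {i // μ i = v.1} {i // μ i = v.1} k) v)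
    have hs := leviMatrix_submatrix B v
    rw [nilBox, if_pos hv, ← hs]
  · simp only [if_neg hB, finsum_zero]
    obtain ⟨v, hv⟩ : ∃ v, ¬ IsNilpotent (B v) := by
      by_contra! hcon
      choose m hm using hcon
      -- The sum of the exponents annihilates all of the finitely many blocks at once.
      refine hB ⟨∑ v, m v, funext fun v => ?_⟩
      exact pow_eq_zero_of_le (Finset.single_le_sum (fun _ _ => Nat.zero_le _)
        (Finset.mem_univ v)) (hm v)
    rw [Finset.prod_eq_zero (Finset.mem_univ v) (if_neg hv), smul_zero]

theorem finsum_levi (k : Type u) [Field k] [Finite k] (μ : Fin n → ℤ) :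
    ∑ᶠ B : Levi k μ, ∏ v, nilBox (B v) =
      ((∏ v ∈ Finset.univ.image μ, glCard k ({i // μ i = v} → k) : ℕ) : ℚ) •
        ∏ v ∈ Finset.univ.image μ,
          blockSeries (nilRatio (Nat.card k : ℚ)) (Fintype.card {i // μ i = v}) := by
  have hp : ∑ᶠ B : Levi k μ, ∏ v, nilBox (B v) =
      ∏ v : {v // v ∈ Finset.univ.image μ},
        (∑ᶠ B : Matrix {i // μ i = v.1} {i // μ i = v.1} k, nilBox B) :=
    finsum_prod_pi fun (v : {v // v ∈ Finset.univ.image μ})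
      (B : Matrix {i // μ i = v.1} {i // μ i = v.1} k) => nilBox B
  have hq : ∀ v : {v // v ∈ Finset.univ.image μ},
      ∑ᶠ B : Matrix {i // μ i = v.1} {i // μ i = v.1} k, nilBox B =
      (glCard k ({i // μ i = v.1} → k) : ℚ) •
        blockSeries (nilRatio (Nat.card k : ℚ)) (Fintype.card {i // μ i = v.1}) := fun v =>
    finsum_nilBox _
  have hr : ∏ v : {v // v ∈ Finset.univ.image μ},
      (∑ᶠ B : Matrix {i // μ i = v.1} {i // μ i = v.1} k, nilBox B) =
      ((∏ v ∈ Finset.univ.image μ, glCard k ({i // μ i = v} → k) : ℕ) : ℚ) •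
        ∏ v ∈ Finset.univ.image μ,
          blockSeries (nilRatio (Nat.card k : ℚ)) (Fintype.card {i // μ i = v}) := by
    rw [← Finset.prod_coe_sort (Finset.univ.image μ) fun v =>
        blockSeries (nilRatio (Nat.card k : ℚ)) (Fintype.card {i // μ i = v}), Nat.cast_prod,
      ← Finset.prod_coe_sort (Finset.univ.image μ) fun v => (glCard k ({i // μ i = v} → k) : ℚ),
      ← Finset.prod_smul]
    exact Finset.prod_congr rfl fun v _ => hq v
  exact hp.trans hr

open scoped Classical in
/-- The weighted count of nilpotent sections of the adjoint bundle with stable flags at the two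
points is a product over the degrees of the summands. -/
theorem finsum_nilpotent_sections (k : Type u) [Field k] [Finite k] (μ : Fin n → ℤ) :
    ∑ᶠ Ψ : (bundleOf k μ).adSections, (if IsNilpotent Ψ then
      box (matrixSeries ((bundleOf k μ).at0 Ψ)) (matrixSeries ((bundleOf k μ).atInf Ψ)) else 0) =
    (Nat.card (bundleOf k μ).Aut : ℚ) • ∏ v ∈ Finset.univ.image μ,
      blockSeries (nilRatio (Nat.card k : ℚ)) (Fintype.card {i // μ i = v}) := by
  have h : ∀ Ψ : (bundleOf k μ).adSections, (if IsNilpotent Ψ then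
      box (matrixSeries ((bundleOf k μ).at0 Ψ)) (matrixSeries ((bundleOf k μ).atInf Ψ)) else 0) =
      (fun (B : Levi k μ) (N N' : strictBlocks k μ) => if IsNilpotent B then
        box (matrixSeries (leviMatrix B + N.1)) (matrixSeries (leviMatrix B + N'.1)) else 0)
        (fibreParts k μ Ψ).1 (fibreParts k μ Ψ).2.1 (fibreParts k μ Ψ).2.2 := by
    intro Ψ
    rw [at0_eq_leviMatrix_add, atInf_eq_leviMatrix_add]
    exact if_congr (isNilpotent_iff_of_nil_kernel (leviHom k μ) isNilpotent_of_leviHom_eq_zero Ψ)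
      rfl rfl
  rw [finsum_congr h, finsum_sections (fun (B : Levi k μ) (N N' : strictBlocks k μ) =>
    if IsNilpotent B then
      box (matrixSeries (leviMatrix B + N.1)) (matrixSeries (leviMatrix B + N'.1)) else 0)]
  -- The kernel, the two averages over triangular parts and the groups of the Levi blocks multiply
  -- up to exactly the order of `Aut`.
  rw [finsum_congr fun B => finsum_strictBlocks_levi k μ B, ← smul_finsum' _ (Set.toFinite _),
    finsum_levi, card_aut, smul_smul, ← Nat.cast_smul_eq_nsmul ℚ, smul_smul, ← Nat.cast_mul]

end Levi

/-! ### Partitions as exponent vectors -/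

section Partitions

variable {n : ℕ}

/-- The parts of a partition, in decreasing order, as an exponent vector. -/
def partVec (ν : n.Partition) : ℕ →₀ ℕ := (partList ν).toFinsupp

theorem partVec_apply (ν : n.Partition) (i : ℕ) : partVec ν i = (partList ν).getD i 0 := rfl

theorem partVec_of_le (ν : n.Partition) {i : ℕ} (h : (partList ν).length ≤ i) : partVec ν i = 0 :=
  List.getD_eq_default _ _ h

theorem coe_partList (ν : n.Partition) : (partList ν : Multiset ℕ) = ν.parts :=
  Multiset.sort_eq _ _

theorem sum_partList (ν : n.Partition) : (partList ν).sum = n := by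
  rw [← Multiset.sum_coe, coe_partList, ν.parts_sum]

theorem sum_take_partList (ν : n.Partition) (i : ℕ) :
    ((partList ν).take i).sum = ∑ j ∈ Finset.range i, partVec ν j := by
  induction i with
  | zero => simp
  | succ i ih =>
    rw [Finset.sum_range_succ, ← ih, List.take_add_one, List.sum_append, partVec_apply]
    congr 1
    rw [List.getD_eq_getElem?_getD]
    cases (partList ν)[i]? <;> simp

theorem support_partVec (ν : n.Partition) :
    (partVec ν).support = Finset.range (partList ν).length := by
  ext i
  rw [Finsupp.mem_support_iff, Finset.mem_range, partVec_apply]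
  constructor
  · intro h
    by_contra hi
    exact h (List.getD_eq_default _ _ (not_lt.1 hi))
  · intro h
    rw [List.getD_eq_getElem _ _ h]
    refine (ν.parts_pos ?_).ne'
    rw [← coe_partList]
    exact List.getElem_mem h

theorem map_partVec (ν : n.Partition) :
    (partVec ν).support.val.map (partVec ν) = ν.parts := by
  rw [support_partVec, ← coe_partList]
  change Multiset.map _ (List.range _ : Multiset ℕ) = _
  rw [Multiset.map_coe]
  congr 1
  refine List.ext_getElem (by simp) fun i h1 h2 => ?_
  rw [List.getElem_map, List.getElem_range, partVec_apply, List.getD_eq_getElem]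

end Partitions

/-! ### From parabolic structures and triples to coefficients of the product of blocks -/

section Flags

variable {k : Type*} [Field k] {n : ℕ}

/-- Parabolic structures compatible with a matrix are stable flags. -/
def flagEquiv (ν : n.Partition) (A : Matrix (Fin n) (Fin n) k) :
    {P : Flag k ν // P.Preserves A} ≃ {F : StableFlag A.mulVecLin // F.HasType (partVec ν)} where
  toFun P :=
    have hs : ∀ i : ℕ, Module.finrank k (P.1.space ⟨min i (partList ν).length, by omega⟩) =
        ∑ j ∈ Finset.range i, partVec ν j := by
      intro i
      rw [P.1.finrank_eq, ← sum_take_partList]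
      change (List.take (min i _) _).sum = _
      rw [← List.take_eq_take_min]
    ⟨{ space := fun i => P.1.space ⟨min i (partList ν).length, by omega⟩
       mono := fun i j hij => P.1.mono (by
        rw [Fin.mk_le_mk]
        omega)
       zero := by
        have := hs 0
        rwa [Finset.sum_range_zero, Submodule.finrank_eq_zero] at this
       top := by
        refine ⟨(partList ν).length, Submodule.eq_top_of_finrank_eq ?_⟩
        rw [hs, ← sum_take_partList, List.take_length, sum_partList, Module.finrank_fin_fun]
       stable := fun i v hv => P.2 _ v hv },
      StableFlag.hasType_of_finrank_eq hs⟩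
  invFun F := ⟨{
    space := fun i => F.1.space i
    mono := fun i j hij => F.1.mono hij
    finrank_eq := fun i => by rw [F.2.finrank_eq, sum_take_partList] }, fun i v hv =>
      F.1.stable i v hv⟩
  left_inv P := by
    obtain ⟨⟨s, hm, hf⟩, hP⟩ := P
    refine Subtype.ext ?_
    change Flag.mk _ _ _ = Flag.mk _ _ _
    congr 1
    funext i
    change s _ = s i
    congr 1
    ext
    change min (i : ℕ) _ = i
    omega
  right_inv F := by
    obtain ⟨⟨s, hm, h0, ht, hst⟩, hF⟩ := F
    refine Subtype.ext ?_
    change StableFlag.mk _ _ _ _ _ = StableFlag.mk _ _ _ _ _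
    congr 1
    funext i
    change s (min i (partList ν).length) = s i
    rcases le_total i (partList ν).length with h | h
    · rw [min_eq_left h]
    · rw [min_eq_right h]
      have h1 := hF.space_eq_top (fun i hi => partVec_of_le ν hi) le_rfl
      have h2 := hF.space_eq_top (fun i hi => partVec_of_le ν hi) h
      exact h1.trans h2.symm

theorem card_preserves (ν : n.Partition) (A : Matrix (Fin n) (Fin n) k) :
    (Nat.card {P : Flag k ν // P.Preserves A} : ℚ) =
      MvPowerSeries.coeff (partVec ν) (matrixSeries A) := by
  rw [Nat.card_congr (flagEquiv ν A)]
  rfl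

/-- Triples as nilpotent sections with a pair of parabolic structures. -/
def tripEquiv (E : Bundle k n) (ν0 νinf : n.Partition) :
    Trip E ν0 νinf ≃ Σ Ψ : {Ψ : E.adSections // IsNilpotent Ψ},
      {P : Flag k ν0 // P.Preserves (E.at0 Ψ.1)} × {P : Flag k νinf // P.Preserves (E.atInf Ψ.1)}
        where
  toFun T := ⟨⟨T.Psi, T.nilpotent⟩, ⟨T.P0, T.compat0⟩, ⟨T.Pinf, T.compatInf⟩⟩
  invFun T := ⟨T.2.1.1, T.2.2.1, T.1.1, T.1.2, T.2.1.2, T.2.2.2⟩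
  left_inv _ := rfl
  right_inv _ := rfl

/-- The exponent vector with given `x`-part and `y`-part. -/
def pairVec (α β : ℕ →₀ ℕ) : ℕ ⊕ ℕ →₀ ℕ :=
  α.embDomain Function.Embedding.inl + β.embDomain Function.Embedding.inr

theorem xPart_pairVec (α β : ℕ →₀ ℕ) : xPart (pairVec α β) = α := xPart_embDomain_add α β

theorem yPart_pairVec (α β : ℕ →₀ ℕ) : yPart (pairVec α β) = β := yPart_embDomain_add α β

/-- For a fixed Ψ the pairs of compatible flags are counted by one coefficient of `box`; summing
over nilpotent Ψ and dividing by |Aut| extracts that coefficient from the product of blocks. -/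
theorem card_trip {k : Type u} [Field k] [Finite k] (μ : Fin n → ℤ) (ν0 νinf : n.Partition) :
    (Nat.card (Trip (bundleOf k μ) ν0 νinf) : ℚ) / (Nat.card (bundleOf k μ).Aut : ℚ) =
      MvPowerSeries.coeff (pairVec (partVec ν0) (partVec νinf)) (∏ v ∈ Finset.univ.image μ,
        blockSeries (nilRatio (Nat.card k : ℚ)) (Fintype.card {i // μ i = v})) := by
  classical
  have hf : ∀ (ν : n.Partition) (A : Matrix (Fin n) (Fin n) k),
      Finite {P : Flag k ν // P.Preserves A} := fun ν A => Finite.of_equiv _ (flagEquiv ν A).symm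
  have haut : (Nat.card (bundleOf k μ).Aut : ℚ) ≠ 0 := by
    exact_mod_cast Nat.card_pos.ne'
  have h := congrArg (MvPowerSeries.coeff (pairVec (partVec ν0) (partVec νinf)))
    (finsum_nilpotent_sections k μ)
  rw [MvPowerSeries.coeff_smul] at h
  rw [div_eq_iff haut, mul_comm, ← smul_eq_mul, smul_eq_mul, ← h, Nat.card_congr (tripEquiv _ _ _),
    card_sigma_eq_finsum, map_finsum_of_finite]
  have hΨ : ∀ Ψ : (bundleOf k μ).adSections,
      MvPowerSeries.coeff (pairVec (partVec ν0) (partVec νinf)) (if IsNilpotent Ψ then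
        box (matrixSeries ((bundleOf k μ).at0 Ψ)) (matrixSeries ((bundleOf k μ).atInf Ψ)) else 0) =
      if IsNilpotent Ψ then ((Nat.card ({P : Flag k ν0 // P.Preserves ((bundleOf k μ).at0 Ψ)} ×
        {P : Flag k νinf // P.Preserves ((bundleOf k μ).atInf Ψ)}) : ℕ) : ℚ) else 0 := by
    intro Ψ
    split_ifs
    · rw [coeff_box, xPart_pairVec, yPart_pairVec, Nat.card_prod, Nat.cast_mul, card_preserves,
        card_preserves]
    · rw [map_zero]
  rw [finsum_congr hΨ]
  cases nonempty_fintype (bundleOf k μ).adSections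
  rw [finsum_eq_sum_of_fintype, finsum_eq_sum_of_fintype, ← Finset.sum_filter,
    Nat.cast_sum]
  exact (Finset.sum_subtype _ (fun Ψ => by rw [Finset.mem_filter, and_iff_right (Finset.mem_univ
    Ψ)])
    fun Ψ => ((Nat.card ({P : Flag k ν0 // P.Preserves ((bundleOf k μ).at0 Ψ)} ×
        {P : Flag k νinf // P.Preserves ((bundleOf k μ).atInf Ψ)}) : ℕ) : ℚ)).symm

end Flags

/-! ### Rational functions with the prescribed values -/

section Values

variable {q : ℚ}

theorem denom_eval_mul {a b : RatFunc ℚ} (ha : a.denom.eval q ≠ 0) (hb : b.denom.eval q ≠ 0) :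
    (a * b).denom.eval q ≠ 0 := by
  obtain ⟨c, hc⟩ := RatFunc.denom_mul_dvd a b
  intro h
  have := congrArg (Polynomial.eval q) hc
  rw [Polynomial.eval_mul, Polynomial.eval_mul, h, zero_mul] at this
  exact mul_ne_zero ha hb this

theorem denom_eval_add {a b : RatFunc ℚ} (ha : a.denom.eval q ≠ 0) (hb : b.denom.eval q ≠ 0) :
    (a + b).denom.eval q ≠ 0 := by
  obtain ⟨c, hc⟩ := RatFunc.denom_add_dvd a b
  intro h
  have := congrArg (Polynomial.eval q) hc
  rw [Polynomial.eval_mul, Polynomial.eval_mul, h, zero_mul] at this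
  exact mul_ne_zero ha hb this

theorem eval_mul_of_denom {a b : RatFunc ℚ} (ha : a.denom.eval q ≠ 0) (hb : b.denom.eval q ≠ 0) :
    (a * b).eval (RingHom.id ℚ) q = a.eval (RingHom.id ℚ) q * b.eval (RingHom.id ℚ) q :=
  RatFunc.eval_mul (RingHom.id ℚ) q ha hb

theorem eval_add_of_denom {a b : RatFunc ℚ} (ha : a.denom.eval q ≠ 0) (hb : b.denom.eval q ≠ 0) :
    (a + b).eval (RingHom.id ℚ) q = a.eval (RingHom.id ℚ) q + b.eval (RingHom.id ℚ) q :=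
  RatFunc.eval_add (RingHom.id ℚ) q ha hb

/-- Rational functions that are defined at `q`, together with their values. -/
def valuePairs (q : ℚ) : Subring (RatFunc ℚ × ℚ) where
  carrier := {p | p.1.denom.eval q ≠ 0 ∧ p.1.eval (RingHom.id ℚ) q = p.2}
  mul_mem' := fun ⟨ha, ha'⟩ ⟨hb, hb'⟩ =>
    ⟨denom_eval_mul ha hb, (eval_mul_of_denom ha hb).trans (congrArg₂ _ ha' hb')⟩
  add_mem' := fun ⟨ha, ha'⟩ ⟨hb, hb'⟩ =>
    ⟨denom_eval_add ha hb, (eval_add_of_denom ha hb).trans (congrArg₂ _ ha' hb')⟩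
  one_mem' := ⟨by simp, by simp⟩
  zero_mem' := ⟨by simp, by simp⟩
  neg_mem' := by
    intro p hp
    have h1 : (RatFunc.C (-1 : ℚ)).denom.eval q ≠ 0 := by
      rw [RatFunc.denom_C]
      simp
    have h : (-p).1 = RatFunc.C (-1) * p.1 := by simp
    constructor
    · rw [h]
      exact denom_eval_mul h1 hp.1
    · rw [h, eval_mul_of_denom h1 hp.1, hp.2, RatFunc.eval_C]
      simp

theorem mem_valuePairs {p : RatFunc ℚ × ℚ} : p ∈ valuePairs q ↔
    p.1.denom.eval q ≠ 0 ∧ p.1.eval (RingHom.id ℚ) q = p.2 := Iff.rfl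

theorem algebraMap_mem_valuePairs (p : Polynomial ℚ) :
    (algebraMap (Polynomial ℚ) (RatFunc ℚ) p, p.eval q) ∈ valuePairs q := by
  rw [mem_valuePairs]
  constructor
  · simp
  · simp [Polynomial.eval₂_id]

theorem div_mem_valuePairs (p r : Polynomial ℚ) (hr : r.eval q ≠ 0) :
    (algebraMap (Polynomial ℚ) (RatFunc ℚ) p / algebraMap (Polynomial ℚ) (RatFunc ℚ) r,
      p.eval q / r.eval q) ∈ valuePairs q := by
  have hr0 : r ≠ 0 := by
    rintro rfl
    simp at hr
  have hr1 : algebraMap (Polynomial ℚ) (RatFunc ℚ) r ≠ 0 := RatFunc.algebraMap_ne_zero hr0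
  have hd : (algebraMap (Polynomial ℚ) (RatFunc ℚ) p /
      algebraMap (Polynomial ℚ) (RatFunc ℚ) r).denom.eval q ≠ 0 := by
    obtain ⟨c, hc⟩ := RatFunc.denom_div_dvd p r
    intro h
    rw [hc, Polynomial.eval_mul, h, zero_mul] at hr
    exact hr rfl
  refine mem_valuePairs.2 ⟨hd, ?_⟩
  have hmem := algebraMap_mem_valuePairs (q := q) r
  have h := eval_mul_of_denom hd hmem.1
  rw [div_mul_cancel₀ _ hr1, (algebraMap_mem_valuePairs (q := q) p).2, hmem.2] at h
  rw [eq_div_iff hr]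
  exact h.symm

theorem nilRatio_mem_valuePairs (hq : 1 < q) (m : ℕ) :
    (nilRatio (RatFunc.X : RatFunc ℚ) m, nilRatio q m) ∈ valuePairs q := by
  have h : (nilRatio (RatFunc.X : RatFunc ℚ) m, nilRatio q m) = ∏ i ∈ Finset.range m,
      ((RatFunc.X ^ i / (RatFunc.X ^ (i + 1) - 1), q ^ i / (q ^ (i + 1) - 1)) : RatFunc ℚ × ℚ) := by
    refine Prod.ext ?_ ?_
    · rw [Prod.fst_prod]
      rfl
    · rw [Prod.snd_prod]
      rfl
  rw [h]
  refine prod_mem fun i _ => ?_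
  have := div_mem_valuePairs (q := q) (Polynomial.X ^ i) (Polynomial.X ^ (i + 1) - 1) (by
    simpa using (sub_pos.2 (one_lt_pow₀ hq (Nat.succ_ne_zero i))).ne')
  simpa using this

end Values

/-- The rational functions counting triples. -/
def countFamily : CountFamily := fun _ μ ν0 νinf =>
  MvPowerSeries.coeff (pairVec (partVec ν0) (partVec νinf)) (∏ v ∈ Finset.univ.image μ.1,
    blockSeries (nilRatio (RatFunc.X : Qq)) (Fintype.card {i // μ.1 i = v}))

/-- Evaluation at q is not a ring homomorphism on all of ℚ(q). The coefficient is therefore computed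
inside the ring of pairs of a rational function regular at q and its value; the two projections give
the rational function and the point count. -/
theorem isPointCount_countFamily : IsPointCount.{u} countFamily := by
  intro n μ ν0 νinf k _ _
  rw [card_trip]
  set q : ℚ := (Nat.card k : ℚ) with hq
  have hq1 : 1 < q := by
    rw [hq]
    exact_mod_cast Finite.one_lt_card
  let H : ℕ → valuePairs q := fun m => ⟨_, nilRatio_mem_valuePairs hq1 m⟩
  let c : valuePairs q := MvPowerSeries.coeff (pairVec (partVec ν0) (partVec νinf))
    (∏ v ∈ Finset.univ.image μ.1, blockSeries H (Fintype.card {i // μ.1 i = v}))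
  have h1 : c.1.1 = countFamily n μ ν0 νinf := by
    change ((RingHom.fst (RatFunc ℚ) ℚ).comp (valuePairs q).subtype) c = _
    rw [← MvPowerSeries.coeff_map, map_prod]
    simp_rw [map_blockSeries]
    rfl
  have h2 : c.1.2 = MvPowerSeries.coeff (pairVec (partVec ν0) (partVec νinf))
      (∏ v ∈ Finset.univ.image μ.1,
        blockSeries (nilRatio q) (Fintype.card {i // μ.1 i = v})) := by
    change ((RingHom.snd (RatFunc ℚ) ℚ).comp (valuePairs q).subtype) c = _
    rw [← MvPowerSeries.coeff_map, map_prod]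
    simp_rw [map_blockSeries]
    rfl
  rw [← h1, ← h2]
  exact c.2

theorem RatFunc.eq_of_infinite_eval_eq {f g : RatFunc ℚ} {s : Set ℚ} (hs : s.Infinite)
    (hf : ∀ a ∈ s, f.denom.eval a ≠ 0) (hg : ∀ a ∈ s, g.denom.eval a ≠ 0)
    (h : ∀ a ∈ s, f.eval (RingHom.id ℚ) a = g.eval (RingHom.id ℚ) a) : f = g := by
  rw [← RatFunc.num_div_denom f, ← RatFunc.num_div_denom g,
    div_eq_div_iff (RatFunc.algebraMap_ne_zero f.denom_ne_zero)
      (RatFunc.algebraMap_ne_zero g.denom_ne_zero), ← map_mul, ← map_mul]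
  congr 1
  refine Polynomial.eq_of_infinite_eval_eq _ _ (hs.mono fun a ha => ?_)
  have := h a ha
  rw [RatFunc.eval, RatFunc.eval, Polynomial.eval₂_id, Polynomial.eval₂_id, Polynomial.eval₂_id,
    Polynomial.eval₂_id, div_eq_div_iff (hf a ha) (hg a ha)] at this
  rw [Set.mem_ofPred_eq, Polynomial.eval_mul, Polynomial.eval_mul]
  exact this

theorem IsPointCount.eq_countFamily {C : CountFamily} (hC : IsPointCount.{u} C) :
    C = countFamily := by
  funext n μ ν0 νinf
  have hs : ((fun p : ℕ => (p : ℚ)) '' {p | p.Prime}).Infinite :=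
    Nat.infinite_setOfPred_prime.image Nat.cast_injective.injOn
  have key : ∀ p : ℕ, p.Prime →
      (C n μ ν0 νinf).denom.eval (p : ℚ) ≠ 0 ∧ (countFamily n μ ν0 νinf).denom.eval (p : ℚ) ≠ 0 ∧
      (C n μ ν0 νinf).eval (RingHom.id ℚ) p = (countFamily n μ ν0 νinf).eval (RingHom.id ℚ) p := by
    intro p hp
    have : Fact p.Prime := ⟨hp⟩
    -- The prime field is lifted to the universe over which the point counts range.
    have h1 := hC n μ ν0 νinf (ULift.{u} (ZMod p))
    have h2 := isPointCount_countFamily n μ ν0 νinf (ULift.{u} (ZMod p))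
    rw [Nat.card_congr Equiv.ulift, Nat.card_zmod] at h1 h2
    exact ⟨h1.1, h2.1, h1.2.trans h2.2.symm⟩
  refine RatFunc.eq_of_infinite_eval_eq hs ?_ ?_ ?_
  · rintro _ ⟨p, hp, rfl⟩
    exact (key p hp).1
  · rintro _ ⟨p, hp, rfl⟩
    exact (key p hp).2.1
  · rintro _ ⟨p, hp, rfl⟩
    exact (key p hp).2.2

/-! ### The Euler derivation and the exponential -/

section Euler

variable {σ R : Type*} [CommRing R]

/-- The Euler derivation, multiplying a homogeneous series by its degree. -/
def euler (σ R : Type*) [CommRing R] :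
    Derivation R (MvPowerSeries σ R) (MvPowerSeries σ R) :=
  Derivation.mk'
    { toFun := fun f e => e.degree • MvPowerSeries.coeff e f
      map_add' := fun f g => by
        ext e
        change e.degree • MvPowerSeries.coeff e (f + g) = e.degree • MvPowerSeries.coeff e f +
          e.degree • MvPowerSeries.coeff e g
        rw [map_add, smul_add]
      map_smul' := fun r f => by
        ext e
        change e.degree • MvPowerSeries.coeff e (r • f) =
          r * (e.degree • MvPowerSeries.coeff e f)
        rw [map_smul, smul_eq_mul, mul_smul_comm] }
    (fun f g => by
      classical
      ext e
      change e.degree • MvPowerSeries.coeff e (f * g) = _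
      rw [smul_eq_mul, smul_eq_mul, map_add, mul_comm g, MvPowerSeries.coeff_mul,
        MvPowerSeries.coeff_mul, MvPowerSeries.coeff_mul, Finset.smul_sum,
        ← Finset.sum_add_distrib]
      refine Finset.sum_congr rfl fun p hp => ?_
      rw [Finset.HasAntidiagonal.mem_antidiagonal] at hp
      change _ = MvPowerSeries.coeff p.1 f * (p.2.degree • MvPowerSeries.coeff p.2 g) +
        (p.1.degree • MvPowerSeries.coeff p.1 f) * MvPowerSeries.coeff p.2 g
      rw [← hp, map_add, add_smul, mul_smul_comm, smul_mul_assoc, add_comm])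

theorem coeff_euler (f : MvPowerSeries σ R) (e : σ →₀ ℕ) :
    MvPowerSeries.coeff e (euler σ R f) = e.degree • MvPowerSeries.coeff e f := rfl

theorem constantCoeff_euler (f : MvPowerSeries σ R) :
    MvPowerSeries.constantCoeff (euler σ R f) = 0 := by
  rw [← MvPowerSeries.coeff_zero_eq_constantCoeff_apply, coeff_euler, map_zero, zero_smul]

theorem smul_left_injective_of_rat [Algebra ℚ R] {n : ℕ} (hn : n ≠ 0) {a b : R}
    (h : n • a = n • b) : a = b := by
  have := congrArg (fun x => ((n : ℚ)⁻¹) • x) h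
  simp only [← Nat.cast_smul_eq_nsmul ℚ] at this
  rwa [inv_smul_smul₀ (by exact_mod_cast hn), inv_smul_smul₀ (by exact_mod_cast hn)] at this

/-- A linear differential equation for the Euler derivation has at most one solution with given
constant coefficient. -/
theorem eq_of_euler_eq_mul [Algebra ℚ R] {g y y' : MvPowerSeries σ R}
    (hg : MvPowerSeries.constantCoeff g = 0) (hy : euler σ R y = g * y)
    (hy' : euler σ R y' = g * y')
    (h0 : MvPowerSeries.constantCoeff y = MvPowerSeries.constantCoeff y') : y = y' := by
  classical
  ext e
  induction hd : e.degree using Nat.strong_induction_on generalizing e with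
  | _ d ih =>
  rcases Nat.eq_zero_or_pos d with rfl | hpos
  · rw [Finsupp.degree_eq_zero_iff] at hd
    subst hd
    exact h0
  · refine smul_left_injective_of_rat hpos.ne' ?_
    rw [← hd, ← coeff_euler, ← coeff_euler, hy, hy', MvPowerSeries.coeff_mul,
      MvPowerSeries.coeff_mul]
    refine Finset.sum_congr rfl fun p hp => ?_
    rw [Finset.HasAntidiagonal.mem_antidiagonal] at hp
    rcases eq_or_ne p.1 0 with h | h
    · rw [h, MvPowerSeries.coeff_zero_eq_constantCoeff_apply, hg, zero_mul, zero_mul]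
    · rw [ih p.2.degree _ p.2 rfl]
      have h1 : p.1.degree ≠ 0 := fun h2 => h (p.1.degree_eq_zero_iff.1 h2)
      rw [← hd, ← hp, map_add]
      omega

/-- The exponential of a series without constant coefficient. -/
def expSeries [Algebra ℚ R] (s : MvPowerSeries σ R) : MvPowerSeries σ R := fun e =>
  ∑ j ∈ Finset.range (e.degree + 1), ((j.factorial : ℚ)⁻¹) • MvPowerSeries.coeff e (s ^ j)

theorem coeff_pow_eq_zero {s : MvPowerSeries σ R} (hs : MvPowerSeries.constantCoeff s = 0)
    {e : σ →₀ ℕ} {j : ℕ} (h : e.degree < j) : MvPowerSeries.coeff e (s ^ j) = 0 :=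
  MvPowerSeries.coeff_eq_zero_of_constantCoeff_nilpotent (m := 1) (by rw [hs, pow_one]) (by omega)

variable [Algebra ℚ R] {s : MvPowerSeries σ R}

theorem coeff_expSeries (hs : MvPowerSeries.constantCoeff s = 0) {e : σ →₀ ℕ} {N : ℕ} (h : e.degree
    < N) :
    MvPowerSeries.coeff e (expSeries s) =
      ∑ j ∈ Finset.range N, ((j.factorial : ℚ)⁻¹) • MvPowerSeries.coeff e (s ^ j) := by
  change ∑ j ∈ Finset.range (e.degree + 1), _ = _
  refine Finset.sum_subset (Finset.range_subset_range.2 h) fun j _ hj => ?_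
  rw [coeff_pow_eq_zero hs (by simpa using hj), smul_zero]

theorem constantCoeff_expSeries : MvPowerSeries.constantCoeff (expSeries s) = 1 := by
  change ∑ j ∈ Finset.range ((0 : σ →₀ ℕ).degree + 1), _ = _
  simp

/-- The usual D(exp s) = D(s) exp s, by the Leibniz rule on each power of s. Because s has no
constant term, the truncated sums suffice. -/
theorem euler_expSeries (hs : MvPowerSeries.constantCoeff s = 0) :
    euler σ R (expSeries s) = euler σ R s * expSeries s := by
  classical
  ext e
  have h1 : MvPowerSeries.coeff e (euler σ R s * expSeries s) =
      ∑ j ∈ Finset.range (e.degree + 1), ((j.factorial : ℚ)⁻¹) •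
        MvPowerSeries.coeff e (euler σ R s * s ^ j) := by
    simp only [MvPowerSeries.coeff_mul, Finset.smul_sum]
    rw [Finset.sum_comm]
    refine Finset.sum_congr rfl fun p hp => ?_
    rw [Finset.HasAntidiagonal.mem_antidiagonal] at hp
    rw [coeff_expSeries hs (N := e.degree + 1), Finset.mul_sum]
    · exact Finset.sum_congr rfl fun j _ => (mul_smul_comm _ _ _)
    · rw [← hp, map_add]
      omega
  rw [h1, coeff_euler, coeff_expSeries hs (Nat.lt_succ_self _), Finset.smul_sum,
    Finset.sum_range_succ', Finset.sum_range_succ]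
  -- Differentiation shifts the index of the sum by one, which leaves over a top term; it vanishes
  -- because its order exceeds the degree of `e`.
  have h2 : MvPowerSeries.coeff e (euler σ R s * s ^ e.degree) = 0 := by
    rw [MvPowerSeries.coeff_mul]
    refine Finset.sum_eq_zero fun p hp => ?_
    rw [Finset.HasAntidiagonal.mem_antidiagonal] at hp
    rcases eq_or_ne p.1 0 with h | h
    · rw [h, MvPowerSeries.coeff_zero_eq_constantCoeff_apply, constantCoeff_euler, zero_mul]
    · have h1 : p.1.degree ≠ 0 := fun h2 => h (p.1.degree_eq_zero_iff.1 h2)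
      rw [coeff_pow_eq_zero hs, mul_zero]
      rw [← hp, map_add]
      omega
  have h3 : e.degree • ((Nat.factorial 0 : ℚ)⁻¹) • MvPowerSeries.coeff e (s ^ 0) = 0 := by
    rw [smul_comm, ← coeff_euler, pow_zero, Derivation.map_one_eq_zero, map_zero, smul_zero]
  rw [h2, h3, smul_zero]
  congr 1
  refine Finset.sum_congr rfl fun j _ => ?_
  rw [smul_comm, ← coeff_euler, Derivation.leibniz_pow, Nat.add_sub_cancel, smul_eq_mul, map_nsmul,
    ← Nat.cast_smul_eq_nsmul ℚ, smul_smul, mul_comm (s ^ j), Nat.factorial_succ]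
  congr 1
  have := Nat.factorial_ne_zero j
  push_cast
  field_simp

end Euler

/-! ### Logarithmic derivatives of the products over variables -/

section LogDerivative

variable {R : Type*} [CommRing R]

theorem coeff_mul_congr {σ : Type*} {f f' : MvPowerSeries σ R} {e : σ →₀ ℕ}
    (h : ∀ a ≤ e, MvPowerSeries.coeff a f = MvPowerSeries.coeff a f') (g : MvPowerSeries σ R) :
    MvPowerSeries.coeff e (f * g) = MvPowerSeries.coeff e (f' * g) := by
  classical
  rw [MvPowerSeries.coeff_mul, MvPowerSeries.coeff_mul]
  refine Finset.sum_congr rfl fun p hp => ?_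
  rw [Finset.HasAntidiagonal.mem_antidiagonal] at hp
  rw [h p.1 (hp ▸ le_self_add)]

/-- Multiplication by a series whose support below `e` is indexed by a finite set. -/
theorem coeff_mul_eq_sum {σ ι : Type*} (I : Finset ι) (v : ι → σ →₀ ℕ) (w : ι → R)
    {f : MvPowerSeries σ R} {e : σ →₀ ℕ} (hv : Set.InjOn v I)
    (hw : ∀ i ∈ I, MvPowerSeries.coeff (v i) f = w i)
    (hf : ∀ a ≤ e, MvPowerSeries.coeff a f ≠ 0 → ∃ i ∈ I, v i = a) (g : MvPowerSeries σ R) :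
    MvPowerSeries.coeff e (f * g) =
      ∑ i ∈ I, if v i ≤ e then w i * MvPowerSeries.coeff (e - v i) g else 0 := by
  classical
  rw [coeff_mul_congr (f' := ∑ i ∈ I, MvPowerSeries.monomial (v i) (w i)), Finset.sum_mul, map_sum]
  · exact Finset.sum_congr rfl fun i _ => MvPowerSeries.coeff_monomial_mul _ _ _ _
  · intro a ha
    rw [map_sum]
    simp only [MvPowerSeries.coeff_monomial]
    by_cases h : ∃ i ∈ I, v i = a
    · obtain ⟨i, hi, rfl⟩ := h
      rw [hw i hi, Finset.sum_eq_single i, if_pos rfl]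
      · intro j hj hji
        rw [if_neg fun h => hji (hv hj hi h.symm)]
      · exact fun h => absurd hi h
    · rw [Finset.sum_eq_zero]
      · by_contra h1
        exact h (hf a ha h1)
      · intro i hi
        rw [if_neg]
        rintro rfl
        exact h ⟨i, hi, rfl⟩

/-- The recursion for the coefficients of a series with logarithmic derivative `∑ c m * z ^ m`. -/
def HasLogDeriv (h c : ℕ → R) : Prop :=
  h 0 = 1 ∧ ∀ s : ℕ, (s : R) * h s = ∑ m ∈ Finset.Icc 1 s, c m * h (s - m)

/-- Coefficient form of the logarithmic derivative of ∏_i h(x_i): the degree is the sum of the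
exponents, and the recursion for h is applied to one factor at a time. -/
theorem HasLogDeriv.prod {h c : ℕ → R} (hc : HasLogDeriv h c) {σ : Type*} (α : σ →₀ ℕ) :
    (α.degree : R) * α.prod (fun _ m => h m) = ∑ i ∈ α.support, ∑ m ∈ Finset.Icc 1 (α i),
      c m * (α - Finsupp.single i m).prod fun _ m => h m := by
  classical
  rw [Finsupp.degree_apply, Nat.cast_sum, Finset.sum_mul]
  refine Finset.sum_congr rfl fun i hi => ?_
  rw [Finsupp.prod, ← Finset.mul_prod_erase _ _ hi, ← mul_assoc, hc.2, Finset.sum_mul]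
  refine Finset.sum_congr rfl fun m _ => ?_
  rw [mul_assoc]
  congr 1
  have hsub : (α - Finsupp.single i m).support ⊆ α.support := by
    intro j hj
    rw [Finsupp.mem_support_iff, Finsupp.tsub_apply] at hj
    rw [Finsupp.mem_support_iff]
    omega
  rw [Finsupp.prod_of_support_subset _ hsub _ fun _ _ => hc.1, ← Finset.mul_prod_erase _ _ hi,
    Finsupp.tsub_apply, Finsupp.single_eq_same]
  congr 1
  refine Finset.prod_congr rfl fun j hj => ?_
  rw [Finsupp.tsub_apply, Finsupp.single_eq_of_ne (Finset.ne_of_mem_erase hj), Nat.sub_zero]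

open scoped Classical in
/-- The power sum of degree `m` with coefficient `c m`. -/
def rowPower (c : ℕ → R) (m : ℕ) : MvPowerSeries ℕ R := fun β =>
  if ∃ j, β = Finsupp.single j m then c m else 0

theorem coeff_rowPower_single (c : ℕ → R) (m j : ℕ) :
    MvPowerSeries.coeff (Finsupp.single j m) (rowPower c m) = c m := if_pos ⟨j, rfl⟩

theorem coeff_rowPower_mul (c : ℕ → R) {m : ℕ} (hm : 1 ≤ m) (g : MvPowerSeries ℕ R) (β : ℕ →₀ ℕ) :
    MvPowerSeries.coeff β (rowPower c m * g) = ∑ j ∈ β.support,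
      if Finsupp.single j m ≤ β then c m * MvPowerSeries.coeff (β - Finsupp.single j m) g else 0 :=
        by
  refine coeff_mul_eq_sum β.support (fun j => Finsupp.single j m) (fun _ => c m) ?_ ?_ ?_ g
  · intro i _ j _ hij
    exact Finsupp.single_left_injective (by omega) hij
  · intro j _
    exact coeff_rowPower_single c m j
  · intro a ha h
    by_cases h1 : ∃ j, a = Finsupp.single j m
    · obtain ⟨j, rfl⟩ := h1
      refine ⟨j, ?_, rfl⟩
      have := ha j
      rw [Finsupp.single_eq_same] at this
      rw [Finsupp.mem_support_iff]
      omega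
    · exact absurd (if_neg h1) h

theorem columnSeries_zero {h : ℕ → R} : columnSeries h 0 = 1 := by
  classical
  ext β
  rw [coeff_columnSeries, MvPowerSeries.coeff_one]
  refine if_ctx_congr (Finsupp.degree_eq_zero_iff β) (fun hβ => ?_) fun _ => rfl
  rw [hβ, Finsupp.prod_zero_index]

/-- The series ∑ z^s `columnSeries h s` is ∏_j h(z y_j), whose logarithmic derivative in z has the
power sums c_m ∑_j y_j^m as coefficients. So the hypothesis is inherited with coefficients in series
in y, and `HasLogDeriv.prod` can be used again for the x-variables. -/
theorem HasLogDeriv.columnSeries {h c : ℕ → R} (hc : HasLogDeriv h c) :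
    HasLogDeriv (columnSeries h) (rowPower c) := by
  refine ⟨columnSeries_zero, fun s => ?_⟩
  ext β
  rw [← nsmul_eq_mul, map_nsmul, coeff_columnSeries, map_sum]
  have h1 : ∀ m ∈ Finset.Icc 1 s, MvPowerSeries.coeff β (rowPower c m * TwoPoint.columnSeries h (s
      - m)) =
      ∑ j ∈ β.support, if m ≤ β j ∧ β.degree = s then
        c m * (β - Finsupp.single j m).prod (fun _ m => h m) else 0 := by
    intro m hm
    rw [Finset.mem_Icc] at hm
    rw [coeff_rowPower_mul c hm.1]
    refine Finset.sum_congr rfl fun j _ => ?_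
    rw [if_congr Finsupp.single_le_iff rfl rfl, ite_and]
    split_ifs with h1 h2
    · rw [coeff_columnSeries, if_pos]
      have h3 : (β - Finsupp.single j m) + Finsupp.single j m = β :=
        tsub_add_cancel_of_le (Finsupp.single_le_iff.2 h1)
      have h4 := congrArg Finsupp.degree h3
      rw [map_add, Finsupp.degree_single] at h4
      omega
    · rw [coeff_columnSeries, if_neg, mul_zero]
      have h3 : (β - Finsupp.single j m) + Finsupp.single j m = β :=
        tsub_add_cancel_of_le (Finsupp.single_le_iff.2 h1)
      have h4 := congrArg Finsupp.degree h3
      rw [map_add, Finsupp.degree_single] at h4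
      omega
    · rfl
  rw [Finset.sum_congr rfl h1, Finset.sum_comm]
  split_ifs with hβ
  · rw [nsmul_eq_mul, ← hβ, hc.prod]
    refine Finset.sum_congr rfl fun j _ => ?_
    simp only [and_true]
    rw [← Finset.sum_filter]
    refine Finset.sum_congr ?_ fun _ _ => rfl
    ext m
    rw [Finset.mem_filter, Finset.mem_Icc, Finset.mem_Icc]
    have := Finsupp.le_degree j β
    omega
  · rw [smul_zero]
    exact (Finset.sum_eq_zero fun j _ => Finset.sum_eq_zero fun m _ => if_neg fun h => hβ h.2).symm

theorem degree_xPart_add_degree_yPart (e : ℕ ⊕ ℕ →₀ ℕ) :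
    (xPart e).degree + (yPart e).degree = e.degree := by
  conv_rhs => rw [← embDomain_xPart_add_yPart e]
  rw [map_add, Finsupp.embDomain_eq_mapDomain, Finsupp.embDomain_eq_mapDomain]
  congr 1
  · exact (Finsupp.sum_mapDomain_index_inj (h := fun _ m => m)
      Function.Embedding.inl.injective).symm
  · exact (Finsupp.sum_mapDomain_index_inj (h := fun _ m => m)
      Function.Embedding.inr.injective).symm

open scoped Classical in
/-- The series `∑ c m * (x_i y_j) ^ m` over all `i`, `j` and `m ≥ 1`. -/
def powerSum (c : ℕ → R) : MvPowerSeries (ℕ ⊕ ℕ) R := fun e =>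
  if ∃ i j m, 1 ≤ m ∧ e = pairVec (Finsupp.single i m) (Finsupp.single j m) then
    c (xPart e).degree else 0

theorem coeff_powerSum_pairVec (c : ℕ → R) (i j : ℕ) {m : ℕ} (hm : 1 ≤ m) :
    MvPowerSeries.coeff (pairVec (Finsupp.single i m) (Finsupp.single j m)) (powerSum c) = c m := by
  refine (if_pos ⟨i, j, m, hm, rfl⟩).trans ?_
  rw [xPart_pairVec, Finsupp.degree_single]

theorem exists_of_coeff_powerSum_ne_zero {c : ℕ → R} {e : ℕ ⊕ ℕ →₀ ℕ}
    (h : MvPowerSeries.coeff e (powerSum c) ≠ 0) :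
    ∃ i j m, 1 ≤ m ∧ e = pairVec (Finsupp.single i m) (Finsupp.single j m) := by
  by_contra h1
  exact h (if_neg h1)

theorem pairVec_le_iff (α β : ℕ →₀ ℕ) (e : ℕ ⊕ ℕ →₀ ℕ) :
    pairVec α β ≤ e ↔ α ≤ xPart e ∧ β ≤ yPart e := by
  constructor
  · intro h
    have h1 : xPart (pairVec α β) ≤ xPart e := fun i => h (Sum.inl i)
    have h2 : yPart (pairVec α β) ≤ yPart e := fun i => h (Sum.inr i)
    rw [xPart_pairVec] at h1
    rw [yPart_pairVec] at h2
    exact ⟨h1, h2⟩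
  · rintro ⟨h1, h2⟩ i
    rw [← xPart_pairVec α β] at h1
    rw [← yPart_pairVec α β] at h2
    cases i with
    | inl i => exact h1 i
    | inr i => exact h2 i

theorem xPart_sub (e e' : ℕ ⊕ ℕ →₀ ℕ) : xPart (e - e') = xPart e - xPart e' := by
  ext i
  rfl

theorem yPart_sub (e e' : ℕ ⊕ ℕ →₀ ℕ) : yPart (e - e') = yPart e - yPart e' := by
  ext i
  rfl

theorem coeff_powerSum_mul (c : ℕ → R) (g : MvPowerSeries (ℕ ⊕ ℕ) R) (e : ℕ ⊕ ℕ →₀ ℕ) :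
    MvPowerSeries.coeff e (powerSum c * g) = ∑ i ∈ (xPart e).support,
      ∑ m ∈ Finset.Icc 1 (xPart e i), ∑ j ∈ (yPart e).support,
        if Finsupp.single j m ≤ yPart e then c m * MvPowerSeries.coeff
          (e - pairVec (Finsupp.single i m) (Finsupp.single j m)) g else 0 := by
  rw [coeff_mul_eq_sum ((xPart e).support.sigma fun i => Finset.Icc 1 (xPart e i) ×ˢ (yPart
    e).support)
    (fun p => pairVec (Finsupp.single p.1 p.2.1) (Finsupp.single p.2.2 p.2.1))
    (fun p => c p.2.1)]
  · rw [Finset.sum_sigma]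
    refine Finset.sum_congr rfl fun i _ => ?_
    rw [Finset.sum_product]
    refine Finset.sum_congr rfl fun m hm => Finset.sum_congr rfl fun j _ => ?_
    refine if_congr ?_ rfl rfl
    rw [pairVec_le_iff, Finsupp.single_le_iff]
    exact and_iff_right (Finset.mem_Icc.1 hm).2
  · rintro ⟨i, m, j⟩ h ⟨i', m', j'⟩ h' heq
    rw [Finset.mem_coe, Finset.mem_sigma, Finset.mem_product, Finset.mem_Icc] at h h'
    have h1 := congrArg xPart heq
    have h2 := congrArg yPart heq
    rw [xPart_pairVec, xPart_pairVec] at h1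
    rw [yPart_pairVec, yPart_pairVec] at h2
    have hm : m ≠ 0 := by have := h.2.1.1; dsimp only at this; omega
    obtain ⟨rfl, rfl⟩ | h3 := Finsupp.single_eq_single_iff _ _ _ _ |>.1 h1
    · obtain ⟨rfl, -⟩ | h3 := Finsupp.single_eq_single_iff _ _ _ _ |>.1 h2
      · rfl
      · exact absurd h3.1 hm
    · exact absurd h3.1 hm
  · rintro ⟨i, m, j⟩ h
    rw [Finset.mem_sigma, Finset.mem_product, Finset.mem_Icc] at h
    exact coeff_powerSum_pairVec c i j h.2.1.1
  · intro a ha h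
    obtain ⟨i, j, m, hm, rfl⟩ := exists_of_coeff_powerSum_ne_zero h
    rw [pairVec_le_iff, Finsupp.single_le_iff, Finsupp.single_le_iff] at ha
    refine ⟨⟨i, m, j⟩, ?_, rfl⟩
    rw [Finset.mem_sigma, Finset.mem_product, Finset.mem_Icc, Finsupp.mem_support_iff,
      Finsupp.mem_support_iff]
    dsimp only
    omega

/-- Grading by the x-degree alone would give the factor c_m. The total degree is twice the x-degree
on the support of `pairSeries`, whence the factor 2. -/
theorem HasLogDeriv.euler_pairSeries {h c : ℕ → R} (hc : HasLogDeriv h c) :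
    euler _ R (pairSeries h) = powerSum (fun m => 2 * c m) * pairSeries h := by
  ext e
  have h1 := congrArg (MvPowerSeries.coeff (yPart e)) (hc.columnSeries.prod (xPart e))
  rw [← nsmul_eq_mul, map_nsmul, map_sum] at h1
  have h2 : (2 : R) * ((xPart e).degree • MvPowerSeries.coeff e (pairSeries h)) =
      MvPowerSeries.coeff e (powerSum (fun m => 2 * c m) * pairSeries h) := by
    rw [coeff_powerSum_mul, coeff_pairSeries, rowSeries, h1, Finset.mul_sum]
    refine Finset.sum_congr rfl fun i _ => ?_
    rw [map_sum, Finset.mul_sum]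
    refine Finset.sum_congr rfl fun m hm => ?_
    rw [coeff_rowPower_mul c (Finset.mem_Icc.1 hm).1, Finset.mul_sum]
    refine Finset.sum_congr rfl fun j _ => ?_
    rw [mul_ite, mul_zero, coeff_pairSeries, xPart_sub, yPart_sub, xPart_pairVec, yPart_pairVec,
      rowSeries, mul_assoc]
  rw [coeff_euler, ← h2, ← degree_xPart_add_degree_yPart]
  by_cases hd : (yPart e).degree = (xPart e).degree
  · rw [hd, add_smul, two_mul]
  · rw [coeff_pairSeries_eq_zero h hd, smul_zero, smul_zero, mul_zero]

theorem nilRatio_succ {K : Type*} [Field K] {q : K} (hq : ∀ m : ℕ, q ^ (m + 1) ≠ 1) (m : ℕ) :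
    (q ^ (m + 1) - 1) * nilRatio q (m + 1) = q ^ m * nilRatio q m := by
  rw [nilRatio, Finset.prod_range_succ, nilRatio]
  have := sub_ne_zero.2 (hq m)
  field_simp

/-- The q-difference equation h(z) = (1 − z) h(qz), read as h(z)/(1 − z) = h(qz). -/
theorem sum_range_nilRatio {K : Type*} [Field K] {q : K} (hq : ∀ m : ℕ, q ^ (m + 1) ≠ 1) (n : ℕ) :
    ∑ b ∈ Finset.range (n + 1), nilRatio q b = q ^ n * nilRatio q n := by
  induction n with
  | zero => simp
  | succ n ih =>
    rw [Finset.sum_range_succ, ih, ← nilRatio_succ hq]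
    ring

/-- Multiply by q^(n+1) − 1 = (q^a − 1) + q^a (q^b − 1) with a + b = n + 1. The first part cancels
the inverse and leaves a partial sum of h; the second lowers b by one and gives the statement for n.
The term a = 0 is zero since the inverse of 0 is 0. -/
theorem sum_antidiagonal_nilRatio {K : Type*} [Field K] {q : K} (hq : ∀ m : ℕ, q ^ (m + 1) ≠ 1)
    (n : ℕ) : ∑ p ∈ Finset.HasAntidiagonal.antidiagonal n, (q ^ p.1 - 1)⁻¹ * nilRatio q p.2 =
      n * nilRatio q n := by
  induction n with
  | zero => simp
  | succ n ih =>
    refine mul_left_cancel₀ (sub_ne_zero.2 (hq n)) ?_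
    have h1 : ∀ p ∈ Finset.HasAntidiagonal.antidiagonal (n + 1), (q ^ (n + 1) - 1) *
        ((q ^ p.1 - 1)⁻¹ * nilRatio q p.2) = (q ^ p.1 - 1) * (q ^ p.1 - 1)⁻¹ * nilRatio q p.2 +
          q ^ p.1 * (q ^ p.1 - 1)⁻¹ * ((q ^ p.2 - 1) * nilRatio q p.2) := by
      intro p hp
      rw [Finset.HasAntidiagonal.mem_antidiagonal] at hp
      rw [← hp]
      ring
    rw [Finset.mul_sum, Finset.sum_congr rfl h1, Finset.sum_add_distrib,
      Finset.Nat.sum_antidiagonal_succ, Finset.Nat.sum_antidiagonal_succ']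
    have h2 : ∀ p ∈ Finset.HasAntidiagonal.antidiagonal n, q ^ p.1 * (q ^ p.1 - 1)⁻¹ *
        ((q ^ (p.2 + 1) - 1) * nilRatio q (p.2 + 1)) =
        q ^ n * ((q ^ p.1 - 1)⁻¹ * nilRatio q p.2) := by
      intro p hp
      rw [Finset.HasAntidiagonal.mem_antidiagonal] at hp
      rw [nilRatio_succ hq, ← hp]
      ring
    have h3 : ∀ p ∈ Finset.HasAntidiagonal.antidiagonal n, (q ^ (p.1 + 1) - 1) *
        (q ^ (p.1 + 1) - 1)⁻¹ * nilRatio q p.2 = nilRatio q p.2 := by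
      intro p _
      rw [mul_inv_cancel₀ (sub_ne_zero.2 (hq _)), one_mul]
    rw [Finset.sum_congr rfl h2, Finset.sum_congr rfl h3, ← Finset.mul_sum, ih]
    have h4 : ∑ p ∈ Finset.HasAntidiagonal.antidiagonal n, nilRatio q p.2 =
        q ^ n * nilRatio q n := by
      refine (Finset.Nat.sum_antidiagonal_swap (f := fun p : ℕ × ℕ => nilRatio q p.1)).trans ?_
      rw [Finset.Nat.sum_antidiagonal_eq_sum_range_succ (fun a _ => nilRatio q a)]
      exact sum_range_nilRatio hq n
    rw [h4]
    simp only [pow_zero, sub_self, zero_mul, mul_zero, zero_add]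
    push_cast
    linear_combination -(1 + (n : K)) * nilRatio_succ hq n

theorem hasLogDeriv_nilRatio {K : Type*} [Field K] {q : K} (hq : ∀ m : ℕ, q ^ (m + 1) ≠ 1) :
    HasLogDeriv (nilRatio q) (fun m => (q ^ m - 1)⁻¹) := by
  refine ⟨Finset.prod_range_zero _, fun n => ?_⟩
  rw [← sum_antidiagonal_nilRatio hq, Finset.Nat.sum_antidiagonal_eq_sum_range_succ
    (fun a b => (q ^ a - 1)⁻¹ * nilRatio q b)]
  refine (Finset.sum_subset (fun m hm => ?_) fun m hm hm' => ?_).symm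
  · rw [Finset.mem_Icc] at hm
    rw [Finset.mem_range]
    omega
  · rw [Finset.mem_range] at hm
    rw [Finset.mem_Icc] at hm'
    obtain rfl : m = 0 := by omega
    simp

theorem HasLogDeriv.map {S : Type*} [CommRing S] {h c : ℕ → R} (hc : HasLogDeriv h c) (φ : R →+* S)
    :
    HasLogDeriv (φ ∘ h) (φ ∘ c) := by
  refine ⟨by rw [Function.comp_apply, hc.1, map_one], fun s => ?_⟩
  have := congrArg φ (hc.2 s)
  rw [map_mul, map_natCast, map_sum] at this
  simp_rw [map_mul] at this
  exact this

end LogDerivative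

/-! ### The substitution of t x for x and the functional equation of the exponential -/

section Twist

variable {R : Type*} [CommRing R]

/-- The substitution `x_i ↦ t * x_i`. -/
def twist (t : R) : MvPowerSeries (ℕ ⊕ ℕ) R →+* MvPowerSeries (ℕ ⊕ ℕ) R :=
  MvPowerSeries.rescale (Sum.elim (fun _ => t) 1)

theorem coeff_twist (t : R) (f : MvPowerSeries (ℕ ⊕ ℕ) R) (e : ℕ ⊕ ℕ →₀ ℕ) :
    MvPowerSeries.coeff e (twist t f) = t ^ (xPart e).degree * MvPowerSeries.coeff e f := by
  rw [twist, MvPowerSeries.coeff_rescale]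
  congr 1
  conv_lhs => rw [← embDomain_xPart_add_yPart e]
  rw [Finsupp.prod_add_index' (fun _ => pow_zero _) (fun _ _ _ => pow_add _ _ _),
    Finsupp.prod_embDomain, Finsupp.prod_embDomain]
  change (xPart e).prod (fun _ m => t ^ m) * (yPart e).prod (fun _ m => (1 : R) ^ m) = _
  simp only [one_pow]
  rw [Finsupp.prod_fun_one, mul_one, Finsupp.prod, Finset.prod_pow_eq_pow_sum, Finsupp.degree_apply]

theorem twist_twist (t u : R) (f : MvPowerSeries (ℕ ⊕ ℕ) R) :
    twist t (twist u f) = twist (t * u) f := by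
  ext e
  rw [coeff_twist, coeff_twist, coeff_twist, mul_pow, mul_assoc]

theorem twist_one (f : MvPowerSeries (ℕ ⊕ ℕ) R) : twist 1 f = f := by
  ext e
  rw [coeff_twist, one_pow, one_mul]

theorem euler_twist (t : R) (f : MvPowerSeries (ℕ ⊕ ℕ) R) :
    euler _ R (twist t f) = twist t (euler _ R f) := by
  ext e
  rw [coeff_euler, coeff_twist, coeff_twist, coeff_euler, mul_smul_comm]

theorem powerSum_congr {c c' : ℕ → R} (h : ∀ m, 1 ≤ m → c m = c' m) : powerSum c = powerSum c' := by
  classical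
  ext e
  refine if_ctx_congr Iff.rfl ?_ fun _ => rfl
  rintro ⟨i, j, m, hm, rfl⟩
  rw [xPart_pairVec, Finsupp.degree_single]
  exact h m hm

theorem powerSum_add (c c' : ℕ → R) : powerSum c + powerSum c' = powerSum (c + c') := by
  classical
  ext e
  rw [map_add]
  by_cases h : ∃ i j m, 1 ≤ m ∧ e = pairVec (Finsupp.single i m) (Finsupp.single j m)
  · obtain ⟨i, j, m, hm, rfl⟩ := h
    rw [coeff_powerSum_pairVec _ _ _ hm, coeff_powerSum_pairVec _ _ _ hm,
      coeff_powerSum_pairVec _ _ _ hm]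
    rfl
  · have h0 : ∀ c : ℕ → R, MvPowerSeries.coeff e (powerSum c) = 0 := fun _ => if_neg h
    rw [h0, h0, h0, add_zero]

theorem twist_powerSum (t : R) (c : ℕ → R) :
    twist t (powerSum c) = powerSum fun m => t ^ m * c m := by
  classical
  ext e
  rw [coeff_twist]
  by_cases h : ∃ i j m, 1 ≤ m ∧ e = pairVec (Finsupp.single i m) (Finsupp.single j m)
  · obtain ⟨i, j, m, hm, rfl⟩ := h
    rw [coeff_powerSum_pairVec _ _ _ hm, coeff_powerSum_pairVec _ _ _ hm, xPart_pairVec,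
      Finsupp.degree_single]
  · have h0 : ∀ c : ℕ → R, MvPowerSeries.coeff e (powerSum c) = 0 := fun _ => if_neg h
    rw [h0, h0, mul_zero]

theorem euler_powerSum (c : ℕ → R) :
    euler _ R (powerSum c) = powerSum fun m => (2 * m) • c m := by
  classical
  ext e
  rw [coeff_euler]
  by_cases h : ∃ i j m, 1 ≤ m ∧ e = pairVec (Finsupp.single i m) (Finsupp.single j m)
  · obtain ⟨i, j, m, hm, rfl⟩ := h
    rw [coeff_powerSum_pairVec _ _ _ hm, coeff_powerSum_pairVec _ _ _ hm,
      ← degree_xPart_add_degree_yPart, xPart_pairVec, yPart_pairVec,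
      Finsupp.degree_single, Finsupp.degree_single, two_mul]
  · have h0 : ∀ c : ℕ → R, MvPowerSeries.coeff e (powerSum c) = 0 := fun _ => if_neg h
    rw [h0, h0, smul_zero]

theorem xPart_zero : xPart 0 = 0 := by
  ext i
  rfl

theorem yPart_zero : yPart 0 = 0 := by
  ext i
  rfl

theorem coeff_powerSum_of_xPart_eq_zero (c : ℕ → R) {e : ℕ ⊕ ℕ →₀ ℕ} (h : xPart e = 0) :
    MvPowerSeries.coeff e (powerSum c) = 0 := by
  by_contra h1
  obtain ⟨i, j, m, hm, rfl⟩ := exists_of_coeff_powerSum_ne_zero h1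
  rw [xPart_pairVec, Finsupp.single_eq_zero] at h
  omega

theorem constantCoeff_powerSum (c : ℕ → R) : MvPowerSeries.constantCoeff (powerSum c) = 0 :=
  coeff_powerSum_of_xPart_eq_zero c (e := 0) xPart_zero

theorem eq_prod_mul_twist {A y : MvPowerSeries (ℕ ⊕ ℕ) R} {t : R} (h : y = A * twist t y) (N : ℕ) :
    y = (∏ i ∈ Finset.range N, twist (t ^ i) A) * twist (t ^ N) y := by
  induction N with
  | zero => rw [Finset.prod_range_zero, one_mul, pow_zero, twist_one]
  | succ N ih =>
    conv_lhs => rw [ih, h]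
    rw [map_mul, twist_twist, ← pow_succ, Finset.prod_range_succ, mul_assoc]

variable [Algebra ℚ R]

theorem coeff_expSeries_powerSum_of_xPart_eq_zero (c : ℕ → R) {e : ℕ ⊕ ℕ →₀ ℕ} (h : xPart e = 0) :
    MvPowerSeries.coeff e (expSeries (powerSum c)) = MvPowerSeries.coeff e 1 := by
  classical
  rw [coeff_expSeries (constantCoeff_powerSum c) (Nat.lt_succ_self _), Finset.sum_range_succ',
    Finset.sum_eq_zero, zero_add, pow_zero, Nat.factorial_zero, Nat.cast_one, inv_one, one_smul]
  intro j _
  rw [pow_succ', MvPowerSeries.coeff_mul, Finset.sum_eq_zero, smul_zero]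
  intro p hp
  rw [Finset.HasAntidiagonal.mem_antidiagonal] at hp
  rw [coeff_powerSum_of_xPart_eq_zero, zero_mul]
  rw [← hp, xPart_add] at h
  exact (add_eq_zero.1 h).1

/-- The hypothesis says g_m = c_m/(1 − t^m) without dividing. Both sides have constant term 1 and
logarithmic Euler derivative 2 ∑ g_m (x_i y_j)^m: on the right it splits into the part of c_m and
the twisted part t^m g_m. -/
theorem expSeries_eq_mul_twist {h c g : ℕ → R} (hc : HasLogDeriv h c) (t : R)
    (hg : ∀ m, 1 ≤ m → g m = c m + t ^ m * g m) :
    expSeries (powerSum fun m => (m : ℚ)⁻¹ • g m) =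
      pairSeries h * twist t (expSeries (powerSum fun m => (m : ℚ)⁻¹ • g m)) := by
  have he : euler _ R (powerSum fun m => (m : ℚ)⁻¹ • g m) = powerSum fun m => 2 * g m := by
    rw [euler_powerSum]
    refine powerSum_congr fun m hm => ?_
    have : (m : ℚ) ≠ 0 := by exact_mod_cast (by omega : m ≠ 0)
    rw [mul_smul, ← Nat.cast_smul_eq_nsmul ℚ m, smul_inv_smul₀ this, nsmul_eq_mul, Nat.cast_two]
  have hexp := euler_expSeries (constantCoeff_powerSum fun m => (m : ℚ)⁻¹ • g m)
  rw [he] at hexp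
  refine eq_of_euler_eq_mul (g := powerSum fun m => 2 * g m) (constantCoeff_powerSum _) hexp ?_ ?_
  · rw [Derivation.leibniz, hc.euler_pairSeries, euler_twist, hexp, map_mul, twist_powerSum,
      smul_eq_mul, smul_eq_mul]
    have : (powerSum fun m => 2 * g m) =
        (powerSum fun m => 2 * c m) + powerSum fun m => t ^ m * (2 * g m) := by
      rw [powerSum_add]
      refine powerSum_congr fun m hm => ?_
      rw [Pi.add_apply]
      conv_lhs => rw [hg m hm]
      ring
    conv_rhs => rw [this]
    ring
  · rw [map_mul, constantCoeff_expSeries]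
    have h1 : MvPowerSeries.constantCoeff (pairSeries h) = 1 := by
      rw [← MvPowerSeries.coeff_zero_eq_constantCoeff_apply, coeff_pairSeries,
        xPart_zero, yPart_zero, rowSeries, Finsupp.prod_zero_index, MvPowerSeries.coeff_zero_one]
    rw [h1, one_mul, ← MvPowerSeries.coeff_zero_eq_constantCoeff_apply, coeff_twist,
      MvPowerSeries.coeff_zero_eq_constantCoeff_apply, constantCoeff_expSeries,
      xPart_zero, map_zero, pow_zero, one_mul]

end Twist

/-! ### Expansion of the finite products over twists -/

section Product

variable {R : Type*} [CommRing R]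

theorem blockSeries_zero (H : ℕ → R) : blockSeries H 0 = 1 := by
  classical
  ext e
  rw [coeff_blockSeries, MvPowerSeries.coeff_one]
  by_cases he : e = 0
  · subst he
    rw [if_pos (by rw [xPart_zero, map_zero]), if_pos rfl, coeff_pairSeries, xPart_zero,
      yPart_zero, rowSeries, Finsupp.prod_zero_index, MvPowerSeries.coeff_zero_one]
  · rw [if_neg he]
    split_ifs with h
    · refine coeff_pairSeries_eq_zero H fun h1 => he ?_
      rw [← Finsupp.degree_eq_zero_iff, ← degree_xPart_add_degree_yPart, h1, h, add_zero]
    · rfl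

/-- The product of the blocks with given multiplicities. -/
def blockProd (H : ℕ → R) (m : ℕ →₀ ℕ) : MvPowerSeries (ℕ ⊕ ℕ) R := m.prod fun _ c => blockSeries H
  c

/-- The total degree `∑ i * m i`. -/
def weight (m : ℕ →₀ ℕ) : ℕ := m.sum fun i c => i * c

theorem degree_xPart_sum {ι : Type*} (s : Finset ι) (l : ι → ℕ ⊕ ℕ →₀ ℕ) :
    (xPart (∑ i ∈ s, l i)).degree = ∑ i ∈ s, (xPart (l i)).degree := by
  classical
  induction s using Finset.induction_on with
  | empty => rw [Finset.sum_empty, Finset.sum_empty, xPart_zero, map_zero]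
  | insert a s ha ih => rw [Finset.sum_insert ha, Finset.sum_insert ha, xPart_add, map_add, ih]

theorem coeff_blockProd (H : ℕ → R) {m : ℕ →₀ ℕ} {N : ℕ} (hm : m.support ⊆ Finset.range N)
    (e : ℕ ⊕ ℕ →₀ ℕ) : MvPowerSeries.coeff e (blockProd H m) =
      ∑ l ∈ Finset.finsuppAntidiag (Finset.range N) e,
        if ∀ i ∈ Finset.range N, (xPart (l i)).degree = m i then
          ∏ i ∈ Finset.range N, MvPowerSeries.coeff (l i) (pairSeries H) else 0 := by
  classical
  rw [blockProd, Finsupp.prod_of_support_subset _ hm _ fun _ _ => blockSeries_zero H,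
    MvPowerSeries.coeff_prod]
  refine Finset.sum_congr rfl fun l _ => ?_
  simp only [coeff_blockSeries]
  rw [Finset.prod_ite_zero]

/-- Distribute e among the factors and group by the x-degree m_i received by the i-th one. That
factor contributes t^(i m_i), so the exponent of t is `weight m`, and each group is a coefficient of
`blockProd H m`. -/
theorem coeff_coeff_prod_twist (H : ℕ → R) (N d : ℕ) (e : ℕ ⊕ ℕ →₀ ℕ) :
    PowerSeries.coeff d (MvPowerSeries.coeff e (∏ i ∈ Finset.range N,
      twist ((PowerSeries.X : PowerSeries R) ^ i) (pairSeries (PowerSeries.C ∘ H)))) =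
    ∑ m ∈ Finset.finsuppAntidiag (Finset.range N) (xPart e).degree,
      if weight m = d then MvPowerSeries.coeff e (blockProd H m) else 0 := by
  classical
  have hpair : pairSeries (PowerSeries.C ∘ H) = MvPowerSeries.map PowerSeries.C (pairSeries H) := by
    ext1 e
    have := congrArg (MvPowerSeries.coeff e) (map_blockSeries (PowerSeries.C (R := R)) H (xPart
        e).degree)
    rw [MvPowerSeries.coeff_map, coeff_blockSeries, coeff_blockSeries, if_pos rfl,
      if_pos rfl] at this
    rw [MvPowerSeries.coeff_map, this]
  have h1 : ∀ l : ℕ →₀ (ℕ ⊕ ℕ →₀ ℕ), ∏ i ∈ Finset.range N, MvPowerSeries.coeff (l i)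
      (twist ((PowerSeries.X : PowerSeries R) ^ i) (pairSeries (PowerSeries.C ∘ H))) =
      PowerSeries.X ^ (∑ i ∈ Finset.range N, i * (xPart (l i)).degree) *
        PowerSeries.C (∏ i ∈ Finset.range N, MvPowerSeries.coeff (l i) (pairSeries H)) := by
    intro l
    rw [map_prod, ← Finset.prod_pow_eq_pow_sum, ← Finset.prod_mul_distrib]
    refine Finset.prod_congr rfl fun i _ => ?_
    rw [coeff_twist, hpair, MvPowerSeries.coeff_map, pow_mul]
  have h2 : ∀ l : ℕ →₀ (ℕ ⊕ ℕ →₀ ℕ), PowerSeries.coeff d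
      (PowerSeries.X ^ (∑ i ∈ Finset.range N, i * (xPart (l i)).degree) *
        PowerSeries.C (∏ i ∈ Finset.range N, MvPowerSeries.coeff (l i) (pairSeries H))) =
      if (∑ i ∈ Finset.range N, i * (xPart (l i)).degree) = d then
        ∏ i ∈ Finset.range N, MvPowerSeries.coeff (l i) (pairSeries H) else 0 := by
    intro l
    rw [mul_comm, PowerSeries.coeff_C_mul, PowerSeries.coeff_X_pow, mul_ite, mul_one, mul_zero]
    exact if_congr eq_comm rfl rfl
  rw [MvPowerSeries.coeff_prod, map_sum]
  simp only [h1, h2]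
  have h3 : ∀ m ∈ Finset.finsuppAntidiag (Finset.range N) (xPart e).degree,
      (if weight m = d then MvPowerSeries.coeff e (blockProd H m) else 0) =
      ∑ l ∈ Finset.finsuppAntidiag (Finset.range N) e, if weight m = d then
        (if ∀ i ∈ Finset.range N, (xPart (l i)).degree = m i then
          ∏ i ∈ Finset.range N, MvPowerSeries.coeff (l i) (pairSeries H) else 0) else 0 := by
    intro m hm
    rw [Finset.mem_finsuppAntidiag] at hm
    split_ifs
    · exact coeff_blockProd H hm.2 e
    · exact Finset.sum_const_zero.symm
  rw [Finset.sum_congr rfl h3, Finset.sum_comm]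
  refine Finset.sum_congr rfl fun l hl => ?_
  rw [Finset.mem_finsuppAntidiag] at hl
  have hm0 : (fun x => (xPart x).degree) (0 : ℕ ⊕ ℕ →₀ ℕ) = 0 := by
    change (xPart 0).degree = 0
    rw [xPart_zero, map_zero]
  set m₀ : ℕ →₀ ℕ := l.mapRange (fun x => (xPart x).degree) hm0 with hm₀
  have hw : weight m₀ = ∑ i ∈ Finset.range N, i * (xPart (l i)).degree := by
    rw [weight, Finsupp.sum_of_support_subset _ (Finsupp.support_mapRange.trans hl.2) _
      fun _ _ => mul_zero _]
    rfl
  have hmem : m₀ ∈ Finset.finsuppAntidiag (Finset.range N) (xPart e).degree := by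
    rw [Finset.mem_finsuppAntidiag]
    refine ⟨?_, Finsupp.support_mapRange.trans hl.2⟩
    rw [← hl.1, degree_xPart_sum]
    rfl
  rw [Finset.sum_eq_single m₀, ← hw]
  · rw [if_pos (c := ∀ i ∈ Finset.range N, (xPart (l i)).degree = m₀ i) fun _ _ => rfl]
  · intro m hm hne
    rw [Finset.mem_finsuppAntidiag] at hm
    rw [if_neg (c := ∀ i ∈ Finset.range N, (xPart (l i)).degree = m i), ite_self]
    intro h
    refine hne (Finsupp.ext fun i => ?_)
    by_cases hi : i ∈ Finset.range N
    · exact (h i hi).symm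
    · rw [Finsupp.notMem_support_iff.1 fun h => hi (hm.2 h),
        Finsupp.notMem_support_iff.1 fun h => hi ((Finset.mem_finsuppAntidiag.1 hmem).2 h)]
  · exact fun h => absurd hmem h

end Product

/-! ### The exponential of the logarithm, coefficient by coefficient -/

section Exponential

/-- The coefficient of `(x_i y_j) ^ m` in the logarithm of the generating function, up to a factor
of `m`. -/
def logCoeff (m : ℕ) : Coeffs :=
  PowerSeries.C ((RatFunc.X ^ m - 1 : Qq)⁻¹) * (1 - PowerSeries.X ^ m : Coeffs)⁻¹

theorem X_pow_ne_one (m : ℕ) : (RatFunc.X : Qq) ^ (m + 1) ≠ 1 := by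
  intro h
  have h1 : algebraMap (Polynomial ℚ) (RatFunc ℚ) (Polynomial.X ^ (m + 1)) =
      algebraMap (Polynomial ℚ) (RatFunc ℚ) 1 := by simpa using h
  have h2 := congrArg Polynomial.natDegree (RatFunc.algebraMap_injective ℚ h1)
  rw [Polynomial.natDegree_X_pow, Polynomial.natDegree_one] at h2
  omega

theorem one_sub_X_pow_mul_inv {m : ℕ} (hm : 1 ≤ m) :
    (1 - PowerSeries.X ^ m : Coeffs) * (1 - PowerSeries.X ^ m : Coeffs)⁻¹ = 1 := by
  refine PowerSeries.mul_inv_cancel _ ?_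
  rw [map_sub, map_pow, PowerSeries.constantCoeff_X, zero_pow (by omega), map_one, sub_zero]
  exact one_ne_zero

theorem logCoeff_eq_add {m : ℕ} (hm : 1 ≤ m) :
    logCoeff m = PowerSeries.C ((RatFunc.X ^ m - 1 : Qq)⁻¹) + PowerSeries.X ^ m * logCoeff m := by
  have := one_sub_X_pow_mul_inv hm
  rw [logCoeff]
  linear_combination PowerSeries.C ((RatFunc.X ^ m - 1 : Qq)⁻¹) * this

/-- The logarithm of the generating function. -/
def logSeries : Series := powerSum fun m => (m : ℚ)⁻¹ • logCoeff m

/-- After N iterations of the functional equation the remaining factor is Z(t^N X), which is 1 up to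
multiples of t^N and so invisible in the coefficient of t^d for d < N. -/
theorem fullCoeff_expSeries_logSeries {N d : ℕ} (hd : d < N) (e : ℕ ⊕ ℕ →₀ ℕ) :
    fullCoeff e d (expSeries logSeries) =
      ∑ m ∈ Finset.finsuppAntidiag (Finset.range N) (xPart e).degree,
        if weight m = d then MvPowerSeries.coeff e (blockProd (nilRatio (RatFunc.X : Qq)) m)
          else 0 := by
  classical
  have h := eq_prod_mul_twist (expSeries_eq_mul_twist
    ((hasLogDeriv_nilRatio X_pow_ne_one).map PowerSeries.C) PowerSeries.X
    fun m hm => logCoeff_eq_add hm) N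
  rw [← coeff_coeff_prod_twist, fullCoeff, logSeries]
  conv_lhs => rw [h]
  rw [MvPowerSeries.coeff_mul, map_sum, Finset.sum_eq_single (e, 0)]
  · rw [coeff_twist, xPart_zero, map_zero, pow_zero, one_mul,
      coeff_expSeries_powerSum_of_xPart_eq_zero _ xPart_zero, MvPowerSeries.coeff_zero_one, mul_one]
  · intro p hp hne
    rw [Finset.HasAntidiagonal.mem_antidiagonal] at hp
    rw [coeff_twist]
    by_cases hx : xPart p.2 = 0
    · rw [coeff_expSeries_powerSum_of_xPart_eq_zero _ hx, MvPowerSeries.coeff_one, if_neg, mul_zero,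
        mul_zero, map_zero]
      intro h2
      refine hne (Prod.ext ?_ h2)
      rw [← hp, h2, add_zero]
    · rw [← pow_mul, mul_left_comm, PowerSeries.coeff_X_pow_mul', if_neg]
      have : (xPart p.2).degree ≠ 0 := fun h => hx ((Finsupp.degree_eq_zero_iff _).1 h)
      have := Nat.le_mul_of_pos_right N (Nat.pos_of_ne_zero this)
      omega
  · intro h
    exact absurd (Finset.HasAntidiagonal.mem_antidiagonal.2 (add_zero e)) h

end Exponential

/-! ### Adams operations and the plethystic exponential -/

section Plethysm

theorem adamsQq_X (m : ℕ+) : adamsQq m RatFunc.X = RatFunc.X ^ (m : ℕ) := by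
  have h := RatFunc.map_apply_div (φ := Polynomial.expand ℚ (m : ℕ))
    (nonZeroDivisors_le_comap_expand m) Polynomial.X 1
  rw [map_one, div_one, RatFunc.algebraMap_X, map_one, map_one, div_one, Polynomial.expand_X,
    map_pow, RatFunc.algebraMap_X] at h
  exact h

theorem adamsCoeffs_C (m : ℕ+) (a : Qq) :
    adamsCoeffs m (PowerSeries.C a) = PowerSeries.C (adamsQq m a) := by
  change PowerSeries.expand (m : ℕ) m.ne_zero (PowerSeries.map (adamsQq m) (PowerSeries.C a)) = _
  rw [PowerSeries.map_C, PowerSeries.expand_C]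

theorem adamsCoeffs_X (m : ℕ+) :
    adamsCoeffs m PowerSeries.X = PowerSeries.X ^ (m : ℕ) := by
  change PowerSeries.expand (m : ℕ) m.ne_zero (PowerSeries.map (adamsQq m) PowerSeries.X) = _
  rw [PowerSeries.map_X, PowerSeries.expand_X]

theorem adamsCoeffs_logCoeff_one (m : ℕ+) :
    adamsCoeffs m (PowerSeries.C ((RatFunc.X - 1 : Qq)⁻¹) * (1 - PowerSeries.X : Coeffs)⁻¹) =
      logCoeff m := by
  have h1 := congrArg (adamsCoeffs m) (one_sub_X_pow_mul_inv (m := 1) le_rfl)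
  rw [map_mul, map_sub, map_one, pow_one, adamsCoeffs_X] at h1
  have h2 := one_sub_X_pow_mul_inv (m := (m : ℕ)) m.pos
  -- Inverses are unique: both sides are inverse to 1 − t^m.
  have h3 : adamsCoeffs m (1 - PowerSeries.X : Coeffs)⁻¹ =
      (1 - PowerSeries.X ^ (m : ℕ) : Coeffs)⁻¹ := by
    linear_combination (1 - PowerSeries.X ^ (m : ℕ) : Coeffs)⁻¹ * h1 -
      adamsCoeffs m (1 - PowerSeries.X : Coeffs)⁻¹ * h2
  rw [map_mul, h3, adamsCoeffs_C, map_inv₀, map_sub, map_one, adamsQq_X, logCoeff]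

theorem nsmul_pairVec_single (m i j : ℕ) :
    m • (Finsupp.single (Sum.inl i) 1 + Finsupp.single (Sum.inr j) 1 : ℕ ⊕ ℕ →₀ ℕ) =
      pairVec (Finsupp.single i m) (Finsupp.single j m) := by
  rw [pairVec, Finsupp.embDomain_single, Finsupp.embDomain_single, smul_add, Finsupp.smul_single,
    Finsupp.smul_single, smul_eq_mul, mul_one]
  rfl

open scoped Classical in
theorem coeff_adams_expArgument (m : ℕ+) (e : ℕ ⊕ ℕ →₀ ℕ) :
    MvPowerSeries.coeff e (adams m expArgument) =
      if ∃ i j, e = pairVec (Finsupp.single i (m : ℕ)) (Finsupp.single j (m : ℕ)) then logCoeff m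
        else 0 := by
  change MvPowerSeries.coeff e (MvPowerSeries.expand (m : ℕ) m.ne_zero
    (MvPowerSeries.map (adamsCoeffs m) expArgument)) = _
  by_cases h : ∀ i, (m : ℕ) ∣ e i
  · obtain ⟨e, rfl⟩ : ∃ e', e = (m : ℕ) • e' := by
      refine ⟨e.mapRange (· / (m : ℕ)) (Nat.zero_div _), Finsupp.ext fun i => ?_⟩
      exact (Nat.mul_div_cancel' (h i)).symm
    have hXY : MvPowerSeries.coeff e XY = if ∃ p : ℕ × ℕ, e = Finsupp.single (Sum.inl p.1) 1 +
        Finsupp.single (Sum.inr p.2) 1 then 1 else 0 := rfl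
    have hiff : (∃ p : ℕ × ℕ, e = Finsupp.single (Sum.inl p.1) 1 + Finsupp.single (Sum.inr p.2) 1) ↔
        ∃ i j, (m : ℕ) • e = pairVec (Finsupp.single i (m : ℕ)) (Finsupp.single j (m : ℕ)) := by
      constructor
      · rintro ⟨p, rfl⟩
        exact ⟨p.1, p.2, nsmul_pairVec_single _ _ _⟩
      · rintro ⟨i, j, hij⟩
        rw [← nsmul_pairVec_single] at hij
        exact ⟨(i, j), nsmul_right_injective m.ne_zero hij⟩
    rw [MvPowerSeries.coeff_expand_smul, MvPowerSeries.coeff_map, expArgument, mul_comm XY,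
      MvPowerSeries.coeff_C_mul, map_mul, adamsCoeffs_logCoeff_one, hXY, if_congr hiff rfl rfl]
    split_ifs
    · rw [map_one, mul_one]
    · rw [map_zero, mul_zero]
  · push Not at h
    obtain ⟨a, ha⟩ := h
    rw [MvPowerSeries.coeff_expand_of_not_dvd _ _ _ ha, if_neg]
    rintro ⟨i, j, rfl⟩
    rw [← nsmul_pairVec_single] at ha
    exact ha (Dvd.intro _ rfl)

theorem constQq_natCast_inv (n : ℕ) :
    constQq ((n : Qq)⁻¹) = MvPowerSeries.C (algebraMap ℚ Coeffs (n : ℚ)⁻¹) := by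
  have h : PowerSeries.C ((n : Qq)⁻¹) = algebraMap ℚ Coeffs (n : ℚ)⁻¹ := by
    rw [PowerSeries.algebraMap_apply, map_inv₀ (algebraMap ℚ Qq), map_natCast]
  rw [← h]
  rfl

theorem coeff_constQq_natCast_inv_mul (n : ℕ) (f : Series) (e : ℕ ⊕ ℕ →₀ ℕ) :
    MvPowerSeries.coeff e (constQq ((n : Qq)⁻¹) * f) = (n : ℚ)⁻¹ • MvPowerSeries.coeff e f := by
  rw [constQq_natCast_inv, MvPowerSeries.coeff_C_mul, Algebra.smul_def]

/-- A monomial (x_i y_j)^m occurs only in the m-th term, because its x-degree is m; convergence is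
then immediate. -/
theorem hasFormalSum_logSeries :
    HasFormalSum (fun m : ℕ+ => constQq ((m : Qq)⁻¹) * adams m expArgument) logSeries := by
  classical
  have hc : ∀ (m : ℕ+) e, MvPowerSeries.coeff e (constQq ((m : Qq)⁻¹) * adams m expArgument) =
      if ∃ i j, e = pairVec (Finsupp.single i (m : ℕ)) (Finsupp.single j (m : ℕ)) then
        (m : ℚ)⁻¹ • logCoeff m else 0 := by
    intro m e
    rw [coeff_constQq_natCast_inv_mul, coeff_adams_expArgument, smul_ite, smul_zero]
  intro e d
  by_cases h : ∃ i j m, 1 ≤ m ∧ e = pairVec (Finsupp.single i m) (Finsupp.single j m)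
  · obtain ⟨i, j, m, hm, rfl⟩ := h
    let m' : ℕ+ := ⟨m, hm⟩
    have h0 : ∀ k : ℕ+, k ≠ m' → fullCoeff (pairVec (Finsupp.single i m) (Finsupp.single j m)) d
        (constQq ((k : Qq)⁻¹) * adams k expArgument) = 0 := by
      intro k hk
      rw [fullCoeff, hc, if_neg, map_zero]
      rintro ⟨i', j', h⟩
      have := congrArg (fun e => (xPart e).degree) h
      simp only [xPart_pairVec, Finsupp.degree_single] at this
      exact hk (PNat.eq this.symm)
    refine ⟨(Set.finite_singleton m').subset fun k hk => ?_, ?_⟩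
    · by_contra hne
      exact hk (h0 k hne)
    · rw [finsum_eq_single _ m' h0, fullCoeff, fullCoeff, hc, if_pos ⟨i, j, rfl⟩, logSeries,
        coeff_powerSum_pairVec _ _ _ hm]
      rfl
  · have h0 : ∀ k : ℕ+, fullCoeff e d (constQq ((k : Qq)⁻¹) * adams k expArgument) = 0 := by
      intro k
      rw [fullCoeff, hc, if_neg, map_zero]
      rintro ⟨i, j, rfl⟩
      exact h ⟨i, j, k, k.pos, rfl⟩
    have hs : fullCoeff e d logSeries = 0 := by
      have : MvPowerSeries.coeff e logSeries = 0 := if_neg h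
      rw [fullCoeff, this, map_zero]
    refine ⟨?_, ?_⟩
    · rw [Function.support_eq_empty_iff.2 (funext h0)]
      exact Set.finite_empty
    · rw [hs, finsum_congr h0, finsum_zero]

theorem hasFormalSum_expSeries {s : Series} (hs : MvPowerSeries.constantCoeff s = 0) :
    HasFormalSum (fun j : ℕ => constQq ((j.factorial : Qq)⁻¹) * s ^ j) (expSeries s) := by
  intro e d
  have hc : ∀ j, fullCoeff e d (constQq ((j.factorial : Qq)⁻¹) * s ^ j) =
      PowerSeries.coeff d (((j.factorial : ℚ)⁻¹) • MvPowerSeries.coeff e (s ^ j)) := fun j => by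
    rw [fullCoeff, coeff_constQq_natCast_inv_mul]
  have hsupp : (Function.support fun j : ℕ =>
      fullCoeff e d (constQq ((j.factorial : Qq)⁻¹) * s ^ j)) ⊆
      Finset.range (e.degree + 1) := by
    intro j hj
    rw [Finset.coe_range, Set.mem_Iio]
    by_contra hlt
    refine hj ?_
    dsimp only
    rw [hc, coeff_pow_eq_zero hs (by omega), smul_zero, map_zero]
  refine ⟨(Finset.finite_toSet _).subset hsupp, ?_⟩
  rw [finsum_eq_sum_of_support_subset _ hsupp, fullCoeff, coeff_expSeries hs (Nat.lt_succ_self _),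
    map_sum]
  exact Finset.sum_congr rfl fun j _ => (hc j).symm

theorem hasPlethysticExp_expArgument : HasPlethysticExp expArgument (expSeries logSeries) :=
  ⟨logSeries, hasFormalSum_logSeries, hasFormalSum_expSeries (constantCoeff_powerSum _)⟩

end Plethysm

/-! ### Expansion in monomial symmetric functions -/

section Symmetry

theorem card_fiber_eq_count (α : ℕ →₀ ℕ) {c : ℕ} (hc : c ≠ 0) :
    Nat.card {i // α i = c} = (α.support.val.map α).count c := by
  classical
  rw [Multiset.count_map]
  refine Nat.subtype_card (α.support.filter fun i => c = α i) fun i => ?_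
  rw [Finset.mem_filter, Finsupp.mem_support_iff]
  constructor
  · exact fun h => h.2.symm
  · rintro rfl
    exact ⟨hc, rfl⟩

/-- Exponent vectors with the same nonzero exponents differ by a permutation. -/
theorem exists_perm_of_map_support_eq {α β : ℕ →₀ ℕ}
    (h : α.support.val.map α = β.support.val.map β) :
    ∃ σ : Equiv.Perm ℕ, α.equivMapDomain σ = β := by
  have hinf : ∀ γ : ℕ →₀ ℕ, Infinite {i // γ i = 0} := by
    intro γ
    have h1 := γ.support.finite_toSet.infinite_compl
    have h2 : ((γ.support : Set ℕ)ᶜ) = {i | γ i = 0} := by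
      ext i
      simp
    rw [h2] at h1
    exact h1.to_subtype
  have hfin : ∀ (γ : ℕ →₀ ℕ) (c : ℕ), c ≠ 0 → Finite {i // γ i = c} := by
    intro γ c hc
    have : {i | γ i = c} ⊆ γ.support := by
      rintro i rfl
      simpa using hc
    exact (γ.support.finite_toSet.subset this).to_subtype
  -- Fibres over nonzero exponents are finite of equal size; the fibres over 0 are both countably
  -- infinite, so they too can be matched.
  have he : ∀ c, Nonempty ({i // α i = c} ≃ {i // β i = c}) := by
    intro c
    rcases eq_or_ne c 0 with rfl | hc
    · have := hinf α
      have := hinf β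
      exact nonempty_equiv_of_countable
    · have := hfin α c hc
      have := hfin β c hc
      exact Finite.card_eq.1 (by rw [card_fiber_eq_count α hc, card_fiber_eq_count β hc, h])
  have e := fun c => Classical.choice (he c)
  let σ : Equiv.Perm ℕ := (Equiv.sigmaFiberEquiv α).symm.trans
    ((Equiv.sigmaCongrRight e).trans (Equiv.sigmaFiberEquiv β))
  have hσ : ∀ i, β (σ i) = α i := fun i => (e (α i) ⟨i, rfl⟩).2
  refine ⟨σ, Finsupp.ext fun i => ?_⟩
  rw [Finsupp.equivMapDomain_apply, ← hσ, σ.apply_symm_apply]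

variable {R : Type*} [CommRing R]

theorem blockProd_symm (H : ℕ → R) (m : ℕ →₀ ℕ) (σ τ : Equiv.Perm ℕ) :
    permuteVars σ τ (blockProd H m) = blockProd H m := by
  rw [blockProd, map_finsuppProd]
  simp_rw [blockSeries_symm]

theorem eq_pairVec (e : ℕ ⊕ ℕ →₀ ℕ) : e = pairVec (xPart e) (yPart e) :=
  (embDomain_xPart_add_yPart e).symm

theorem coeff_blockProd_congr (H : ℕ → R) (m : ℕ →₀ ℕ) {α β α' β' : ℕ →₀ ℕ}
    (hα : α.support.val.map α = α'.support.val.map α')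
    (hβ : β.support.val.map β = β'.support.val.map β') :
    MvPowerSeries.coeff (pairVec α β) (blockProd H m) =
      MvPowerSeries.coeff (pairVec α' β') (blockProd H m) := by
  obtain ⟨σ, rfl⟩ := exists_perm_of_map_support_eq hα
  obtain ⟨τ, rfl⟩ := exists_perm_of_map_support_eq hβ
  have h := coeff_renameEquiv (σ.sumCongr τ) (blockProd H m) (pairVec α β)
  rw [eq_pairVec ((pairVec α β).equivMapDomain (σ.sumCongr τ)), xPart_equivMapDomain,
    yPart_equivMapDomain, xPart_pairVec, yPart_pairVec] at h
  rw [← h]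
  exact congrArg _ (blockProd_symm H m σ τ)

theorem degree_yPart_sum {ι : Type*} (s : Finset ι) (l : ι → ℕ ⊕ ℕ →₀ ℕ) :
    (yPart (∑ i ∈ s, l i)).degree = ∑ i ∈ s, (yPart (l i)).degree := by
  classical
  induction s using Finset.induction_on with
  | empty => rw [Finset.sum_empty, Finset.sum_empty, yPart_zero, map_zero]
  | insert a s ha ih => rw [Finset.sum_insert ha, Finset.sum_insert ha, yPart_add, map_add, ih]

theorem degree_of_coeff_blockProd_ne_zero {H : ℕ → R} {m : ℕ →₀ ℕ} {e : ℕ ⊕ ℕ →₀ ℕ}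
    (h : MvPowerSeries.coeff e (blockProd H m) ≠ 0) :
    (xPart e).degree = m.degree ∧ (yPart e).degree = m.degree := by
  classical
  rw [blockProd, Finsupp.prod, MvPowerSeries.coeff_prod] at h
  obtain ⟨l, hl, hne⟩ := Finset.exists_ne_zero_of_sum_ne_zero h
  rw [Finset.mem_finsuppAntidiag] at hl
  have h1 : ∀ i ∈ m.support, (xPart (l i)).degree = m i ∧ (yPart (l i)).degree = m i := by
    intro i hi
    have hi' : MvPowerSeries.coeff (l i) (blockSeries H (m i)) ≠ 0 := fun h0 =>
      hne (Finset.prod_eq_zero hi h0)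
    rw [coeff_blockSeries] at hi'
    split_ifs at hi' with hx
    · refine ⟨hx, ?_⟩
      by_contra hy
      exact hi' (coeff_pairSeries_eq_zero H (by rwa [hx]))
    · exact absurd rfl hi'
  rw [← hl.1]
  constructor
  · rw [degree_xPart_sum, Finset.sum_congr rfl fun i hi => (h1 i hi).1, Finsupp.degree_apply]
  · rw [degree_yPart_sum, Finset.sum_congr rfl fun i hi => (h1 i hi).2, Finsupp.degree_apply]

/-- The nonzero exponents of an exponent vector of degree `n`, as a partition of `n`. -/
def expPartition {n : ℕ} (α : ℕ →₀ ℕ) (h : α.degree = n) : n.Partition where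
  parts := α.support.val.map α
  parts_pos := by
    intro i hi
    obtain ⟨j, hj, rfl⟩ := Multiset.mem_map.1 hi
    exact Nat.pos_of_ne_zero (Finsupp.mem_support_iff.1 hj)
  parts_sum := h

theorem coeff_monomialSymm {n : ℕ} (ν : n.Partition) (α : ℕ →₀ ℕ) (h : α.degree = n) :
    MvPowerSeries.coeff α (monomialSymm ν) = if ν = expPartition α h then 1 else 0 := by
  classical
  refine if_congr ?_ rfl rfl
  rw [Nat.Partition.ext_iff, eq_comm]
  rfl

theorem coeff_monomialSymm_of_ne {n : ℕ} (ν : n.Partition) {α : ℕ →₀ ℕ} (h : α.degree ≠ n) :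
    MvPowerSeries.coeff α (monomialSymm ν) = 0 := by
  classical
  refine if_neg fun h1 => h ?_
  rw [← ν.parts_sum, ← h1]
  rfl

theorem coeff_constQq_mul_box {n : ℕ} (c : Qq) (ν0 νinf : n.Partition) (e : ℕ ⊕ ℕ →₀ ℕ) :
    MvPowerSeries.coeff e (constQq c * (inX (monomialSymm ν0) * inY (monomialSymm νinf))) =
      PowerSeries.C c * (MvPowerSeries.coeff (xPart e) (monomialSymm ν0) *
        MvPowerSeries.coeff (yPart e) (monomialSymm νinf)) := by
  rw [← coeff_box]
  exact MvPowerSeries.coeff_C_mul _ _ _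

/-- A symmetric series is a combination of products of monomial symmetric functions. -/
theorem sum_monomialSymm_blockProd {n : ℕ} {m : ℕ →₀ ℕ} (hm : m.degree = n) (H : ℕ → Qq) :
    ∑ ν0 : n.Partition, ∑ νinf : n.Partition,
      constQq (MvPowerSeries.coeff (pairVec (partVec ν0) (partVec νinf)) (blockProd H m)) *
        (inX (monomialSymm ν0) * inY (monomialSymm νinf)) =
      MvPowerSeries.map PowerSeries.C (blockProd H m) := by
  classical
  ext1 e
  rw [MvPowerSeries.coeff_map, map_sum]
  simp_rw [map_sum, coeff_constQq_mul_box]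
  by_cases hx : (xPart e).degree = n
  · by_cases hy : (yPart e).degree = n
    · simp_rw [coeff_monomialSymm _ _ hx, coeff_monomialSymm _ _ hy]
      rw [Finset.sum_eq_single (expPartition _ hx), Finset.sum_eq_single (expPartition _ hy),
        if_pos rfl, if_pos rfl, mul_one, mul_one, coeff_blockProd_congr H m (map_partVec _)
          (map_partVec _), ← eq_pairVec]
      · intro ν _ hν
        rw [if_neg hν, mul_zero, mul_zero]
      · exact fun h => absurd (Finset.mem_univ _) h
      · intro ν _ hν
        refine Finset.sum_eq_zero fun ν' _ => ?_
        rw [if_neg hν, zero_mul, mul_zero]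
      · exact fun h => absurd (Finset.mem_univ _) h
    · simp_rw [coeff_monomialSymm_of_ne _ hy, mul_zero, Finset.sum_const_zero]
      by_contra h0
      refine hy ((degree_of_coeff_blockProd_ne_zero (H := H) (m := m) fun h => h0 ?_).2.trans hm)
      rw [h, map_zero]
  · simp_rw [coeff_monomialSymm_of_ne _ hx, zero_mul, mul_zero, Finset.sum_const_zero]
    by_contra h0
    refine hx ((degree_of_coeff_blockProd_ne_zero (H := H) (m := m) fun h => h0 ?_).1.trans hm)
    rw [h, map_zero]

end Symmetry

/-! ### Cocharacters μ ≤ 0 as multiplicities of the degrees -/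

section Multiplicities

variable {n : ℕ}

/-- The multiset of the degrees `-μ i`. -/
def degrees (μ : NonposAntidominant n) : Multiset ℕ :=
  Finset.univ.val.map fun i => (-(μ.1.1 i)).toNat

/-- The multiplicities of the summands. -/
def multiplicity (μ : NonposAntidominant n) : ℕ →₀ ℕ := Multiset.toFinsupp (degrees μ)

theorem card_degrees (μ : NonposAntidominant n) : Multiset.card (degrees μ) = n := by
  rw [degrees, Multiset.card_map, Finset.card_val, Finset.card_univ, Fintype.card_fin]

theorem degree_toFinsupp (s : Multiset ℕ) : (Multiset.toFinsupp s).degree = Multiset.card s :=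
  Multiset.toFinsupp_sum_eq s

theorem weight_toFinsupp (s : Multiset ℕ) : weight (Multiset.toFinsupp s) = s.sum := by
  rw [weight, Finsupp.sum, Multiset.toFinsupp_support, Finset.sum_multiset_count]
  refine Finset.sum_congr rfl fun i _ => ?_
  rw [Multiset.toFinsupp_apply, smul_eq_mul, mul_comm]

theorem degree_multiplicity (μ : NonposAntidominant n) : (multiplicity μ).degree = n :=
  (degree_toFinsupp _).trans (card_degrees μ)

theorem weight_multiplicity (μ : NonposAntidominant n) :
    weight (multiplicity μ) = (-μ.1.deg).toNat := by
  rw [multiplicity, weight_toFinsupp]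
  have h1 : (degrees μ).sum = ∑ i, (-(μ.1.1 i)).toNat := rfl
  have h2 : μ.1.deg = ∑ i, μ.1.1 i := rfl
  refine Nat.cast_injective (R := ℤ) ?_
  rw [h1, h2, Int.toNat_of_nonneg (neg_nonneg.2 (Finset.sum_nonpos fun i _ => μ.2 i)),
    Nat.cast_sum, ← Finset.sum_neg_distrib]
  exact Finset.sum_congr rfl fun i _ => Int.toNat_of_nonneg (neg_nonneg.2 (μ.2 i))

theorem monotone_of_antidominant (μ : Antidominant n) : Monotone μ.1 := by
  intro i j hij
  rcases hij.lt_or_eq with h | rfl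
  · exact sub_nonpos.1 (μ.2 i j h)
  · exact le_rfl

/-- Anti-dominance means that μ is sorted, so it is recovered from the multiset of its entries. -/
theorem multiplicity_injective : Function.Injective (multiplicity (n := n)) := by
  intro μ μ' h
  have h1 : degrees μ = degrees μ' := Multiset.toFinsupp.injective h
  have h2 : ∀ μ : NonposAntidominant n, (degrees μ).map (fun d : ℕ => -(d : ℤ)) =
      (List.ofFn μ.1.1 : Multiset ℤ) := by
    intro μ
    rw [degrees, Multiset.map_map, ← Fin.univ_val_map]
    refine Multiset.map_congr rfl fun i _ => ?_
    have := μ.2 i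
    rw [Function.comp_apply]
    omega
  have h3 : (List.ofFn μ.1.1).Perm (List.ofFn μ'.1.1) := by
    rw [← Multiset.coe_eq_coe, ← h2, ← h2, h1]
  refine Subtype.ext (Subtype.ext (List.ofFn_injective ?_))
  exact h3.eq_of_pairwise' (monotone_of_antidominant μ.1).sortedLE_ofFn.pairwise
    (monotone_of_antidominant μ'.1).sortedLE_ofFn.pairwise

theorem exists_multiplicity_eq {m : ℕ →₀ ℕ} (hm : m.degree = n) :
    ∃ μ : NonposAntidominant n, multiplicity μ = m := by
  obtain ⟨s, rfl⟩ := Multiset.toFinsupp.surjective m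
  rw [degree_toFinsupp] at hm
  obtain ⟨l, rfl⟩ := Quot.exists_rep s
  change l.length = n at hm
  subst hm
  let f : Fin l.length → ℤ := fun i => -(l.get i : ℤ)
  -- Sorting the negated entries increasingly gives the anti-dominant representative.
  let σ := Tuple.sort f
  refine ⟨⟨⟨f ∘ σ, fun i j hij => sub_nonpos.2 (Tuple.monotone_sort f hij.le)⟩, fun i =>
    neg_nonpos.2 (Int.natCast_nonneg _)⟩, ?_⟩
  refine congrArg Multiset.toFinsupp ?_
  have h1 : ∀ i, (-((f ∘ σ) i)).toNat = l.get (σ i) := by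
    intro i
    change (- -(l.get (σ i) : ℤ)).toNat = _
    rw [neg_neg, Int.toNat_natCast]
  change Multiset.map (fun i => (-((f ∘ σ) i)).toNat) Finset.univ.val = (l : Multiset ℕ)
  rw [Multiset.map_congr rfl fun i _ => h1 i]
  change Multiset.map (l.get ∘ σ) _ = _
  rw [← Multiset.map_map]
  have h2 : Multiset.map σ Finset.univ.val = (Finset.univ : Finset (Fin l.length)).val :=
    congrArg Finset.val (Finset.map_univ_equiv σ)
  rw [h2, Fin.univ_val_map, List.ofFn_get]

theorem prod_blockSeries_eq_blockProd {R : Type*} [CommRing R] (H : ℕ → R)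
    (μ : NonposAntidominant n) : ∏ v ∈ Finset.univ.image μ.1.1,
      blockSeries H (Fintype.card {i // μ.1.1 i = v}) = blockProd H (multiplicity μ) := by
  classical
  rw [blockProd, Finsupp.prod, multiplicity, Multiset.toFinsupp_support]
  have h1 : (degrees μ).toFinset = (Finset.univ.image μ.1.1).image fun v => (-v).toNat := by
    ext d
    simp [degrees]
  have hinj : Set.InjOn (fun v : ℤ => (-v).toNat) ↑(Finset.univ.image μ.1.1) := by
    intro v hv w hw h
    obtain ⟨i, -, rfl⟩ := Finset.mem_image.1 (Finset.mem_coe.1 hv)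
    obtain ⟨j, -, rfl⟩ := Finset.mem_image.1 (Finset.mem_coe.1 hw)
    have := μ.2 i
    have := μ.2 j
    dsimp only at h
    omega
  rw [h1, Finset.prod_image hinj]
  · refine Finset.prod_congr rfl fun v hv => ?_
    obtain ⟨j, -, rfl⟩ := Finset.mem_image.1 hv
    congr 1
    rw [Multiset.toFinsupp_apply, degrees, Multiset.count_map, Fintype.card_subtype]
    refine congrArg Multiset.card (congrArg Finset.val (Finset.filter_congr fun i _ => ?_))
    have := μ.2 i
    have := μ.2 j
    omega

theorem countSeries_countFamily (μ : NonposAntidominant n) :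
    countSeries countFamily μ.1 =
      MvPowerSeries.map PowerSeries.C (blockProd (nilRatio (RatFunc.X : Qq)) (multiplicity μ)) := by
  rw [← sum_monomialSymm_blockProd (degree_multiplicity μ), countSeries]
  refine Finset.sum_congr rfl fun ν0 _ => Finset.sum_congr rfl fun νinf _ => ?_
  rw [countFamily, prod_blockSeries_eq_blockProd]

theorem fullCoeff_omegaTerm (μ : NonposAntidominant n) (e : ℕ ⊕ ℕ →₀ ℕ) (d : ℕ) :
    fullCoeff e d (omegaTerm countFamily μ) = if weight (multiplicity μ) = d then
      MvPowerSeries.coeff e (blockProd (nilRatio (RatFunc.X : Qq)) (multiplicity μ)) else 0 := by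
  rw [fullCoeff, omegaTerm, countSeries_countFamily, MvPowerSeries.coeff_C_mul,
    MvPowerSeries.coeff_map, ← weight_multiplicity, mul_comm, PowerSeries.coeff_C_mul,
    PowerSeries.coeff_X_pow, mul_ite, mul_one, mul_zero]
  exact if_congr eq_comm rfl rfl

end Multiplicities

/-! ### Summation over all cocharacters and all ranks -/

section Total

/-- The part of a series of degree `n` in `x`. -/
def xHomogeneous (n : ℕ) (f : Series) : Series := fun e =>
  if (xPart e).degree = n then MvPowerSeries.coeff e f else 0

theorem fullCoeff_xHomogeneous (n : ℕ) (f : Series) (e : ℕ ⊕ ℕ →₀ ℕ) (d : ℕ) :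
    fullCoeff e d (xHomogeneous n f) = if (xPart e).degree = n then fullCoeff e d f else 0 := by
  change PowerSeries.coeff d (if (xPart e).degree = n then MvPowerSeries.coeff e f else 0) = _
  split_ifs
  · rfl
  · rw [map_zero]

theorem hasFormalSum_xHomogeneous (f : Series) : HasFormalSum (fun n => xHomogeneous n f) f := by
  intro e d
  have h0 : ∀ n, n ≠ (xPart e).degree → fullCoeff e d (xHomogeneous n f) = 0 := fun n hn => by
    rw [fullCoeff_xHomogeneous, if_neg hn.symm]
  refine ⟨(Set.finite_singleton (xPart e).degree).subset fun n hn => ?_, ?_⟩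
  · by_contra hne
    exact hn (h0 n hne)
  · rw [finsum_eq_single _ _ h0, fullCoeff_xHomogeneous, if_pos rfl]

/-- Reindex by multiplicities. Fixing the t-degree d bounds the occurring i by d, and the x-degree
fixes the number of summands, so only finitely many terms survive; they are those found in the
exponential with N = d + 1. -/
theorem hasFormalSum_omegaTerm (n : ℕ) :
    HasFormalSum (fun μ : NonposAntidominant n => omegaTerm countFamily μ)
      (xHomogeneous n (expSeries logSeries)) := by
  classical
  intro e d
  let g : (ℕ →₀ ℕ) → Qq := fun m => if weight m = d then
    MvPowerSeries.coeff e (blockProd (nilRatio (RatFunc.X : Qq)) m) else 0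
  have hg : ∀ m, g m ≠ 0 → weight m = d ∧ m.degree = (xPart e).degree := by
    intro m hm
    by_cases hw : weight m = d
    · refine ⟨hw, (degree_of_coeff_blockProd_ne_zero (H := nilRatio (RatFunc.X : Qq))
        fun h => hm ?_).1.symm⟩
      exact (if_pos hw).trans h
    · exact absurd (if_neg hw) hm
  have hsupp : Function.support g ⊆
      Finset.finsuppAntidiag (Finset.range (d + 1)) (xPart e).degree := by
    intro m hm
    obtain ⟨hw, hdeg⟩ := hg m hm
    have hs : m.support ⊆ Finset.range (d + 1) := by
      intro i hi
      have h1 : i * m i ≤ weight m :=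
        Finset.single_le_sum (f := fun i => i * m i) (fun _ _ => Nat.zero_le _) hi
      have h2 := Nat.le_mul_of_pos_right i (Nat.pos_of_ne_zero (Finsupp.mem_support_iff.1 hi))
      rw [Finset.mem_range]
      omega
    rw [Finset.mem_coe, Finset.mem_finsuppAntidiag]
    refine ⟨?_, hs⟩
    rw [← hdeg, Finsupp.degree_apply]
    exact (Finset.sum_subset hs fun i _ hi => Finsupp.notMem_support_iff.1 hi).symm
  have hterm : (fun μ : NonposAntidominant n => fullCoeff e d (omegaTerm countFamily μ)) =
      g ∘ multiplicity := funext fun μ => fullCoeff_omegaTerm μ e d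
  rw [hterm, fullCoeff_xHomogeneous]
  have hfin : (Function.support g).Finite := (Finset.finite_toSet _).subset hsupp
  refine ⟨?_, ?_⟩
  · rw [Function.support_comp_eq_preimage]
    exact hfin.preimage multiplicity_injective.injOn
  · split_ifs with he
    · have h1 := finsum_mem_range (f := g) (multiplicity_injective (n := n))
      rw [finsum_congr (g := g) (f := fun m => ∑ᶠ _ : m ∈ Set.range (multiplicity (n := n)), g m)]
        at h1
      · rw [fullCoeff_expSeries_logSeries (Nat.lt_succ_self d),
          ← finsum_eq_sum_of_support_subset g hsupp, h1]
        rfl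
      · intro m
        by_cases hm : g m = 0
        · rw [hm, finsum_zero]
        · obtain ⟨μ, hμ⟩ := exists_multiplicity_eq ((hg m hm).2.trans he)
          exact finsum_eq_if.trans (if_pos ⟨μ, hμ⟩)
    · symm
      rw [← finsum_zero (α := NonposAntidominant n)]
      refine finsum_congr fun μ => ?_
      by_contra hne
      exact he ((hg _ hne).2.symm.trans (degree_multiplicity μ))

end Total

end TwoPoint

end

theorem mainTheorem4 :
    (∃! C : TwoPoint.CountFamily, TwoPoint.IsPointCount.{u} C) ∧
    ∀ C : TwoPoint.CountFamily, TwoPoint.IsPointCount.{u} C →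
      ∃ (Ω : ℕ → TwoPoint.Series) (Z : TwoPoint.Series),
        (∀ n : ℕ, TwoPoint.HasFormalSum
          (fun μ : TwoPoint.NonposAntidominant n => TwoPoint.omegaTerm C μ) (Ω n)) ∧
        TwoPoint.HasFormalSum Ω Z ∧
        TwoPoint.HasPlethysticExp TwoPoint.expArgument Z := by
  refine ⟨⟨TwoPoint.countFamily, TwoPoint.isPointCount_countFamily,
    fun C hC => hC.eq_countFamily⟩, fun C hC => ?_⟩
  obtain rfl := hC.eq_countFamily
  exact ⟨fun n => TwoPoint.xHomogeneous n (TwoPoint.expSeries TwoPoint.logSeries),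
    TwoPoint.expSeries TwoPoint.logSeries, fun n => TwoPoint.hasFormalSum_omegaTerm n,
    TwoPoint.hasFormalSum_xHomogeneous _, TwoPoint.hasPlethysticExp_expArgument⟩
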